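/- **Lie group notation.** Let $\mathfrak g$ be a compact simple Lie algebra, $G$ the corresponding compact connected simply connected Lie group, $\mathbb T\subset G$ a maximal torus with Lie algebra $\mathfrak t$, $n=\dim\mathfrak t$, and $\Lambda=\ker(\exp:\mathfrak t\to \mathbb T)$ the integral lattice, i.e. the lattice generated by the coroots. Let $B$ be the basic inner product (the invariant inner product with $B(\alpha^\vee,\alpha^\vee)=2$ for long roots $\alpha$), used to identify $\mathfrak t$ with $\mathfrak t^*$; $\operatorname{Vol}(\mathfrak t/\Lambda)$ is the corresponding Riemannian volume. Let $W$ be the Weyl group, $(-1)^{\ell(w)}=\det w$ its alternating character, and $\mathfrak A=\{x\in\mathfrak t:\ \alpha(x)>0 \text{ for all positive roots } \alpha,\ \alpha_0(x)<1\}$ the open fundamental alcove for a choice of positive roots with highest root $\alpha_0$. Let $k\ge 1$ be an integer. **Sections.** On $\mathfrak t^2\ni(p,q)$ consider $\omega=2\pi B(dp,dq)$ and the trivial Hermitian line bundle with connection $d+\frac{\pi}{i}(B(p,dq)-B(q,dp))$. The lattice $\Lambda^2$ acts on it by $(\dot x,u)\cdot(x,v)=(\dot x+x,\ uv\,e^{\frac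 i2\omega(\dot x,x)})$ with $u=e^{i\pi B(\dot p,\dot q)}$ for $\dot x=(\dot p,\dot q)$; the quotient is a bundle $L$ over $\mathbb T^2=\mathfrak t^2/\Lambda^2$. For $\tau$ in the upper half-plane $\mathbb H$ use the complex coordinate $\zeta=p+\tau q$. Let $\delta$ be a complex line with an isomorphism $\delta^{\otimes2}\cong\wedge^{n}\mathfrak t_{\mathbb C}^*$, let $\Omega\in\wedge^n\mathfrak t_{\mathbb C}^*$ take the value $1$ on a basis of $\Lambda$, and let $\Omega^{1/2}\in\delta$ be a square root of $\Omega$; $\delta_\tau$ is the trivial bundle with fibre $\delta$ over $\mathbb T^2$, and the constant section $\Omega^{1/2}$ is holomorphic. Let $H^0_\tau(\mathbb T^2,L^k\otimes\delta_\tau)$ be the space of holomorphic sections. $W$ acts diagonally on $\mathfrak t^2$ and trivially on fibres; a section $\Psi$ is alternating if $w.\Psi=(-1)^{\ell(w)}\Psi$ for all $w\in W$. Put $s_\tau=e^{i\pi B(\zeta,q)}$ and, for $\mu\in k^{-1}\Lambda^*$, $$\Theta^\tau_{\mu,k}=\sum_{\gamma\in\mu+\Lambda}e^{2i\pi k(\frac\tau2B(\gamma,\gamma)-B(\zeta,\gamma))},\qquad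 \chi^\tau_{\mu,k}=\sum_{w\in W}(-1)^{\ell(w)}\,\Theta^\tau_{w(\mu),k}\,s_\tau^k .$$ **Modular action.** $A=\begin{pmatrix}a&b\\c&d\end{pmatrix}\in SL(2,\mathbb Z)$ acts by $A.(p,q)=(ap+bq,cp+dq)$ and $A.\tau=\frac{a\tau-b}{-c\tau+d}$, trivially on fibres of the bundle over $\mathfrak t^2$, and on sections by $(A.\Psi)(x)=\Psi(A^{-1}x)$. Let $\mathrm{Mod}_2$ be the group of pairs $(A,e)$ with $e:\mathbb H\to\mathbb C$ continuous and $e(\tau)^2=(-c\tau+d)^n$, with product $(A,e)(A',e')=(AA',\ \tau\mapsto e(A'\tau)e'(\tau))$; $(A,e)$ acts from $\delta_\tau$ to $\delta_{A.\tau}$ as multiplication by $e(\tau)$, hence maps sections of $L^k\otimes\delta_\tau$ to sections of $L^k\otimes\delta_{A.\tau}$. Let $S=\begin{pmatrix}0&-1\\1&0\end{pmatrix}$ and $T=\begin{pmatrix}1&1\\0&1\end{pmatrix}$. **Theorem.** (1) For all $\tau\in\mathbb H$ and $\mu\in\mathfrak A\cap k^{-1}\Lambda^*$, $$S.\chi^\tau_{\mu,k}=\Bigl(\frac{S.\tau}{i}\Bigr)^{n/2}k^{-n/2}\operatorname{Vol}(\mathfrak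 t/\Lambda)^{-1}\sum_{\mu'\in\mathfrak A\cap k^{-1}\Lambda^*}\ \sum_{w\in W}(-1)^{\ell(w)}e^{-2i\pi kB(\mu,w(\mu'))}\,\chi^{S.\tau}_{\mu',k},\qquad T.\chi^\tau_{\mu,k}=e^{i\pi kB(\mu,\mu)}\chi^{T.\tau}_{\mu,k},$$ where the power $n/2$ is continuous in $\tau$ and equal to $1$ when $S.\tau=i$. (2) For each $\tau$ the sections $\Theta^\tau_{\mu,k}s^k_\tau\otimes\Omega^{1/2}$, $\mu\in k^{-1}\Lambda^*$ mod $\Lambda$, are well defined and form a basis of $H^0_\tau(\mathbb T^2,L^k\otimes\delta_\tau)$. Let $\Psi_{\tau_1,\tau_2}$ be the isomorphism $H^0_{\tau_1}(\mathbb T^2,L^k\otimes\delta_{\tau_1})\to H^0_{\tau_2}(\mathbb T^2,L^k\otimes\delta_{\tau_2})$ that matches these bases. Then for each $\tau$, $R_2(A,e)=(A,e)\circ\Psi_{\tau,A^{-1}\tau}$ is a representation of $\mathrm{Mod}_2$ on $H^0_\tau(\mathbb T^2,L^k\otimes\delta_\tau)$. It preserves the subspace of alternating sections, on which it defines a representation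 $R_2^{\mathrm{alt}}$, and the sections $\chi^\tau_{\mu,k}\otimes\Omega^{1/2}$, $\mu\in\mathfrak A\cap k^{-1}\Lambda^*$, form a basis of this subspace. In this basis, for every $e$ with $(S,e)\in\mathrm{Mod}_2$, the coefficients of the matrices of $R_2^{\mathrm{alt}}(S,e)$ and $R_2^{\mathrm{alt}}(T,1)$ are respectively $$\frac{e(i)}{k^{n/2}\operatorname{Vol}(\mathfrak t/\Lambda)}\sum_{w\in W}(-1)^{\ell(w)}e^{-2i\pi kB(\mu,w(\mu'))}\qquad\text{and}\qquad\delta_{\mu,\mu'}\,e^{i\pi kB(\mu,\mu)} .$$ -/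

import Mathlib

open scoped TensorProduct MatrixGroups UpperHalfPlane
open UpperHalfPlane (denom)

noncomputable section

namespace TorusCS

/-! ## Lie group notations

`𝔤` is a compact simple Lie algebra and `j : 𝔱 →ₗ[ℝ] 𝔤` is the inclusion of the Lie algebra of a
maximal torus, `𝔱` being a Euclidean space for the restriction of the basic inner product. This
inner product is used throughout to identify `𝔱` with its dual, so roots and weights are vectors
of `𝔱`. -/

section Roots

variable {𝔱 : Type*} [NormedAddCommGroup 𝔱] [InnerProductSpace ℝ 𝔱]
variable {𝔤 : Type*} [LieRing 𝔤] [LieAlgebra ℝ 𝔤]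

/-- The (real) roots of `(𝔤, 𝔱)`: the nonzero `a ∈ 𝔱` for which there is a nonzero
`X = x + i y` in the complexification of `𝔤` such that `[h, X] = 2 i π ⟪a, h⟫ X` for all `h ∈ 𝔱`
(real and imaginary parts are written separately). -/
def realRoots (j : 𝔱 →ₗ[ℝ] 𝔤) : Set 𝔱 :=
  {a | a ≠ 0 ∧ ∃ x y : 𝔤, (x ≠ 0 ∨ y ≠ 0) ∧ ∀ h : 𝔱,
    ⁅j h, x⁆ = -((2 * Real.pi * inner ℝ a h) • y) ∧
    ⁅j h, y⁆ = (2 * Real.pi * inner ℝ a h) • x}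

/-- The coroot `a^∨ = 2 a / ⟪a, a⟫` of a root `a`. -/
def coroot (a : 𝔱) : 𝔱 := (2 / inner ℝ a a : ℝ) • a

/-- `j` identifies `𝔱` with a maximal abelian subalgebra of `𝔤` (the Lie algebra of a maximal
torus): an element of `𝔤` lies in the image iff it commutes with the image. -/
def IsMaximalAbelian (j : 𝔱 →ₗ[ℝ] 𝔤) : Prop :=
  ∀ x : 𝔤, x ∈ LinearMap.range j ↔ ∀ h : 𝔱, ⁅j h, x⁆ = 0

/-- `B` is the basic inner product of `𝔤` and the inner product of `𝔱` is its restriction. The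
existence of an invariant (positive definite) inner product on `𝔤` is what makes `𝔤` compact. -/
structure IsBasicInnerProduct (B : LinearMap.BilinForm ℝ 𝔤) (j : 𝔱 →ₗ[ℝ] 𝔤) : Prop where
  symm : ∀ x y : 𝔤, B x y = B y x
  pos : ∀ x : 𝔤, x ≠ 0 → 0 < B x x
  invariant : ∀ x y z : 𝔤, B ⁅x, y⁆ z = -B y ⁅x, z⁆
  restrict : ∀ x y : 𝔱, inner ℝ x y = B (j x) (j y)
  /-- coroots of long roots have square length `2` -/
  normalized : ∀ a ∈ realRoots j, (∀ b ∈ realRoots j, ‖b‖ ≤ ‖a‖) →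
    inner ℝ (coroot a) (coroot a) = (2 : ℝ)

/-- The integral lattice, generated by the coroots (`G` is simply connected). -/
def integralLattice (Φ : Set 𝔱) : Submodule ℤ 𝔱 := Submodule.span ℤ (coroot '' Φ)

/-- The lattice `k⁻¹ Λ^*`: the vectors `x` such that `⟪k x, l⟫` is an integer for all `l ∈ Λ`. -/
def scaledDual (Λ : Submodule ℤ 𝔱) (k : ℕ) : Submodule ℤ 𝔱 where
  carrier := {x | ∀ l ∈ Λ, ∃ m : ℤ, inner ℝ ((k : ℝ) • x) l = (m : ℝ)}
  zero_mem' := fun l _ => ⟨0, by simp⟩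
  add_mem' := by
    intro x y hx hy l hl
    obtain ⟨m, hm⟩ := hx l hl
    obtain ⟨m', hm'⟩ := hy l hl
    exact ⟨m + m', by rw [smul_add, inner_add_left, hm, hm']; push_cast; ring⟩
  smul_mem' := by
    intro c x hx l hl
    obtain ⟨m, hm⟩ := hx l hl
    refine ⟨c * m, ?_⟩
    rw [smul_comm, ← Int.cast_smul_eq_zsmul ℝ c, inner_smul_left, hm]
    simp

/-- The Weyl group, generated by the reflections in the hyperplanes orthogonal to the roots. -/
def weylGroup (Φ : Set 𝔱) : Subgroup (𝔱 ≃ₗᵢ[ℝ] 𝔱) :=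
  Subgroup.closure {w | ∃ a ∈ Φ, w = (ℝ ∙ a)ᗮ.reflection}

/-- The alternating character `(-1)^{ℓ(w)} = det w` of the Weyl group. -/
def weylSign {Φ : Set 𝔱} (w : weylGroup Φ) : ℂ :=
  ((LinearMap.det ((w : 𝔱 ≃ₗᵢ[ℝ] 𝔱).toLinearEquiv : 𝔱 →ₗ[ℝ] 𝔱) : ℝ) : ℂ)

/-- `P` is a set of positive roots: the roots lying on one side of a hyperplane containing no
root. -/
def IsPositiveSystem (Φ P : Set 𝔱) : Prop :=
  ∃ v : 𝔱, (∀ a ∈ Φ, inner ℝ a v ≠ (0 : ℝ)) ∧ P = {a | a ∈ Φ ∧ (0 : ℝ) < inner ℝ a v}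

/-- `a₀` is the highest root: for every root `b`, `a₀ - b` is a sum of positive roots. -/
def IsHighestRoot (Φ P : Set 𝔱) (a₀ : 𝔱) : Prop :=
  a₀ ∈ Φ ∧ ∀ b ∈ Φ, a₀ - b ∈ AddSubmonoid.closure P

/-- The open fundamental Weyl alcove. -/
def alcove (P : Set 𝔱) (a₀ : 𝔱) : Set 𝔱 :=
  {x | (∀ a ∈ P, (0 : ℝ) < inner ℝ a x) ∧ inner ℝ a₀ x < (1 : ℝ)}

/-- The index set: the points of the alcove that lie in `k⁻¹ Λ^*`. -/
def alcoveWeights (Λ : Submodule ℤ 𝔱) (P : Set 𝔱) (a₀ : 𝔱) (k : ℕ) : Set 𝔱 :=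
  alcove P a₀ ∩ scaledDual Λ k

end Roots

/-! ## The modular group and its extension -/

/-- Conjugation of `SL(2, ℤ)` by `diag(1, -1)`, i.e. `(a, b; c, d) ↦ (a, -b; -c, d)`. -/
def conj (A : SL(2, ℤ)) : SL(2, ℤ) :=
  ⟨!![A 0 0, -A 0 1; -A 1 0, A 1 1], by
    have h := A.det_coe
    rw [Matrix.det_fin_two] at h
    rw [Matrix.det_fin_two_of]
    linarith⟩

theorem conj_coe (A : SL(2, ℤ)) :
    (conj A : Matrix (Fin 2) (Fin 2) ℤ) = !![A 0 0, -A 0 1; -A 1 0, A 1 1] := rfl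

theorem conj_one : conj 1 = 1 := by
  apply Subtype.ext
  rw [conj_coe]
  ext i l; fin_cases i <;> fin_cases l <;> simp

theorem conj_mul (A B : SL(2, ℤ)) : conj (A * B) = conj A * conj B := by
  apply Subtype.ext
  rw [Matrix.SpecialLinearGroup.coe_mul, conj_coe, conj_coe, conj_coe]
  ext i l
  fin_cases i <;> fin_cases l <;>
    simp [Matrix.mul_apply, Fin.sum_univ_two] <;> ring

/-- The action `A.τ = (a τ - b) / (- c τ + d)` on the upper half-plane. -/
def act (A : SL(2, ℤ)) (τ : ℍ) : ℍ := conj A • τ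

theorem act_coe (A : SL(2, ℤ)) (τ : ℍ) :
    (act A τ : ℂ) = ((A 0 0 : ℂ) * τ - (A 0 1 : ℂ)) / (-(A 1 0 : ℂ) * τ + (A 1 1 : ℂ)) := by
  rw [act, UpperHalfPlane.coe_specialLinearGroup_apply]
  simp [conj_coe, sub_eq_add_neg]

/-- The factor `- c τ + d`. -/
def cocycle (A : SL(2, ℤ)) (τ : ℍ) : ℂ := -(A 1 0 : ℂ) * τ + (A 1 1 : ℂ)

theorem act_one (τ : ℍ) : act 1 τ = τ := by simp [act, conj_one]

theorem act_mul (A B : SL(2, ℤ)) (τ : ℍ) : act (A * B) τ = act A (act B τ) := by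
  simp [act, conj_mul, mul_smul]

theorem continuous_act (A : SL(2, ℤ)) : Continuous (act A) := by
  exact continuous_const_smul (conj A : GL (Fin 2) ℝ)

theorem cocycle_eq_denom (A : SL(2, ℤ)) (τ : ℍ) :
    cocycle A τ = denom (conj A : GL (Fin 2) ℝ) τ := by
  simp [cocycle, UpperHalfPlane.denom, conj_coe]

theorem cocycle_ne_zero (A : SL(2, ℤ)) (τ : ℍ) : cocycle A τ ≠ 0 := by
  rw [cocycle_eq_denom]
  exact UpperHalfPlane.denom_ne_zero _ τ

theorem cocycle_mul (A B : SL(2, ℤ)) (τ : ℍ) :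
    cocycle (A * B) τ = cocycle A (act B τ) * cocycle B τ := by
  have h := cocycle_ne_zero B τ
  unfold cocycle at h ⊢
  rw [act_coe]
  rw [mul_div_assoc', div_add' _ _ _ h, div_mul_cancel₀ _ h]
  simp [Matrix.mul_apply, Fin.sum_univ_two]
  ring

/-- The extension of the modular group by pairs `(A, e)`, where `e` is a continuous square root
of `τ ↦ (- c τ + d)^n`. -/
@[ext]
structure Mo2 (n : ℕ) where
  A : SL(2, ℤ)
  e : ℍ → ℂ
  cont : Continuous e
  sq : ∀ τ, e τ ^ 2 = cocycle A τ ^ n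

namespace Mo2

variable {n : ℕ}

theorem e_ne_zero (g : Mo2 n) (τ : ℍ) : g.e τ ≠ 0 := by
  intro h
  have h2 := g.sq τ
  rw [h, zero_pow two_ne_zero] at h2
  exact pow_ne_zero n (cocycle_ne_zero g.A τ) h2.symm

instance : Mul (Mo2 n) where
  mul g h :=
    { A := g.A * h.A
      e := fun τ => g.e (act h.A τ) * h.e τ
      cont := (g.cont.comp (continuous_act h.A)).mul h.cont
      sq := fun τ => by rw [mul_pow, g.sq, h.sq, cocycle_mul, mul_pow] }

instance : One (Mo2 n) where
  one :=
    { A := 1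
      e := fun _ => 1
      cont := continuous_const
      sq := fun τ => by simp [cocycle] }

instance : Inv (Mo2 n) where
  inv g :=
    { A := g.A⁻¹
      e := fun τ => (g.e (act g.A⁻¹ τ))⁻¹
      cont := (g.cont.comp (continuous_act g.A⁻¹)).inv₀ fun τ => g.e_ne_zero _
      sq := fun τ => by
        have h := cocycle_mul g.A g.A⁻¹ τ
        rw [mul_inv_cancel] at h
        have h1 : cocycle 1 τ = 1 := by simp [cocycle]
        rw [inv_pow, g.sq, ← inv_pow]
        congr 1
        rw [h1] at h
        exact (eq_inv_of_mul_eq_one_right h.symm).symm }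

@[simp] theorem mul_A (g h : Mo2 n) : (g * h).A = g.A * h.A := rfl
@[simp] theorem mul_e (g h : Mo2 n) (τ : ℍ) : (g * h).e τ = g.e (act h.A τ) * h.e τ := rfl
@[simp] theorem one_A : (1 : Mo2 n).A = 1 := rfl
@[simp] theorem one_e (τ : ℍ) : (1 : Mo2 n).e τ = 1 := rfl
@[simp] theorem inv_A (g : Mo2 n) : (g⁻¹).A = g.A⁻¹ := rfl
@[simp] theorem inv_e (g : Mo2 n) (τ : ℍ) : (g⁻¹).e τ = (g.e (act g.A⁻¹ τ))⁻¹ := rfl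

instance : Group (Mo2 n) where
  mul_assoc a b c := by
    ext1
    · simp [mul_assoc]
    · funext τ
      simp [mul_assoc, act_mul]
  one_mul a := by
    ext1
    · simp
    · funext τ
      simp
  mul_one a := by
    ext1
    · simp
    · funext τ
      simp [act_one]
  inv_mul_cancel a := by
    ext1
    · simp
    · funext τ
      simp [← act_mul, act_one, a.e_ne_zero]

end Mo2

/-! ## The prequantum bundle, holomorphic sections, and theta functions

A section over `𝔱²/Λ²` of `L^k ⊗ δ_τ` is the same as a function `𝔱 × 𝔱 → δ` (a section of
the trivial bundle over `𝔱²`) that is invariant under the lifted action of `Λ²`; sections of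
`L^k` are obtained with `δ = ℂ`. -/

section Sections

variable {𝔱 : Type*} [NormedAddCommGroup 𝔱] [InnerProductSpace ℝ 𝔱]
variable {δ : Type*} [NormedAddCommGroup δ] [NormedSpace ℂ δ]

/-- The symplectic form `ω = 2 π B(dp, dq)` on `𝔱²`. -/
def omega (x y : 𝔱 × 𝔱) : ℝ := 2 * Real.pi * (inner ℝ x.1 y.2 - inner ℝ x.2 y.1)

/-- The embedding of `Λ²` into the Heisenberg group `𝔱² × U(1)`, second component. -/
def latticePhase (g : 𝔱 × 𝔱) : ℂ := Complex.exp (Complex.I * Real.pi * (inner ℝ g.1 g.2 : ℝ))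

/-- The unitary factor by which a lattice element `g = (ṗ, q̇)` maps the fibre of the trivial
bundle over `x` to the fibre over `g + x`, through the multiplication
`(x, u).(y, v) = (x + y, u v exp((i/2) ω(x, y)))` of the Heisenberg group. -/
def latticeFactor (g x : 𝔱 × 𝔱) : ℂ :=
  latticePhase g * Complex.exp (Complex.I / 2 * (omega g x : ℝ))

/-- Invariance under `Λ²` of a section of the `k`-th power. -/
def IsLatticeInvariant (Λ : Submodule ℤ 𝔱) (k : ℕ) (F : 𝔱 × 𝔱 → δ) : Prop :=
  ∀ p ∈ Λ, ∀ q ∈ Λ, ∀ x : 𝔱 × 𝔱, F ((p, q) + x) = latticeFactor (p, q) x ^ k • F x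

/-- The covariant derivative of `F` at `x` in the direction `v`, for the connection on the `k`-th
power induced by `d + (π / i) (B(p, dq) - B(q, dp))`. -/
def covDeriv (k : ℕ) (F : 𝔱 × 𝔱 → δ) (x v : 𝔱 × 𝔱) : δ :=
  fderiv ℝ F x v +
    ((k : ℂ) * (Real.pi / Complex.I) *
      ((inner ℝ x.1 v.2 : ℝ) - (inner ℝ x.2 v.1 : ℝ) : ℂ)) • F x

/-- Holomorphy with respect to the complex coordinate `ζ = p + τ q`: the covariant derivative
vanishes along the vectors of type `(0, 1)`, which are spanned by the complex tangent vectors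
`(-τ w, w)`, `w ∈ 𝔱` (those with `dζ = 0`). -/
def IsHolo (k : ℕ) (τ : ℍ) (F : 𝔱 × 𝔱 → δ) : Prop :=
  Differentiable ℝ F ∧
  ∀ (x : 𝔱 × 𝔱) (w : 𝔱), -((τ : ℂ) • covDeriv k F x (w, 0)) + covDeriv k F x (0, w) = 0

/-- The space `H⁰_τ(T², L^k ⊗ δ_τ)` of holomorphic sections. -/
def H (δ : Type*) [NormedAddCommGroup δ] [NormedSpace ℂ δ]
    (Λ : Submodule ℤ 𝔱) (k : ℕ) (τ : ℍ) : Submodule ℂ (𝔱 × 𝔱 → δ) where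
  carrier := {F | IsLatticeInvariant Λ k F ∧ IsHolo k τ F}
  zero_mem' := by
    refine ⟨fun p _ q _ x => by simp, ?_, fun x w => ?_⟩
    · exact differentiable_const (0 : δ)
    · have h0 : ∀ v : 𝔱 × 𝔱, covDeriv k (0 : 𝔱 × 𝔱 → δ) x v = 0 := fun v => by
        simp [covDeriv]
      rw [h0, h0]
      simp
  add_mem' := by
    rintro F G ⟨hF, hF1, hF2⟩ ⟨hG, hG1, hG2⟩
    refine ⟨fun p hp q hq x => ?_, ?_, fun x w => ?_⟩
    · simp only [Pi.add_apply]
      rw [hF p hp q hq x, hG p hp q hq x, smul_add]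
    · exact Differentiable.add hF1 hG1
    · have h0 : ∀ v, covDeriv k (F + G) x v = covDeriv k F x v + covDeriv k G x v := fun v => by
        simp only [covDeriv]
        rw [fderiv_add (hF1 x) (hG1 x)]
        simp only [_root_.add_apply, Pi.add_apply, smul_add]
        abel
      have h1 := congrArg₂ (· + ·) (hF2 x w) (hG2 x w)
      simp only [add_zero] at h1
      rw [h0, h0, ← h1, smul_add]
      abel
  smul_mem' := by
    rintro c F ⟨hF, hF1, hF2⟩
    refine ⟨fun p hp q hq x => ?_, ?_, fun x w => ?_⟩
    · simp only [Pi.smul_apply]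
      rw [hF p hp q hq x, smul_comm]
    · exact Differentiable.const_smul hF1 c
    · have h0 : ∀ v, covDeriv k (c • F) x v = c • covDeriv k F x v := fun v => by
        simp only [covDeriv]
        rw [fderiv_const_smul (hF1 x) c]
        simp only [_root_.smul_apply, Pi.smul_apply, smul_add]
        rw [smul_comm c _ (F x)]
      rw [h0, h0, smul_comm (τ : ℂ) c, ← smul_neg, ← smul_add, hF2 x w, smul_zero]

/-- The alternating sections: `w.F = (-1)^{ℓ(w)} F` for all `w` in the Weyl group, which acts
diagonally on the base, and trivially on the fibres. -/
def alternating (δ : Type*) [NormedAddCommGroup δ] [NormedSpace ℂ δ]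
    (Λ : Submodule ℤ 𝔱) (Φ : Set 𝔱) (k : ℕ) (τ : ℍ) : Submodule ℂ (H δ Λ k τ) where
  carrier := {F | ∀ (w : weylGroup Φ) (x : 𝔱 × 𝔱),
    (F : 𝔱 × 𝔱 → δ) ((w⁻¹ : weylGroup Φ).1 x.1, (w⁻¹ : weylGroup Φ).1 x.2) =
      weylSign w • (F : 𝔱 × 𝔱 → δ) x}
  zero_mem' := fun w x => by simp
  add_mem' := fun {F G} hF hG w x => by
    have h1 := hF w x
    have h2 := hG w x
    simp only [Submodule.coe_add, Pi.add_apply, smul_add, h1, h2]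
  smul_mem' := fun c F hF w x => by
    have h1 := hF w x
    simp only [Submodule.coe_smul, Pi.smul_apply, h1]
    rw [smul_comm]

/-- The section `s_τ = exp(i π B(ζ, q))`, `ζ = p + τ q`, with `B` extended `ℂ`-bilinearly. -/
def sSec (τ : ℍ) (x : 𝔱 × 𝔱) : ℂ :=
  Complex.exp (Complex.I * Real.pi *
    ((inner ℝ x.1 x.2 : ℝ) + (τ : ℂ) * (inner ℝ x.2 x.2 : ℝ)))

/-- The theta function `Θ^τ_{μ,k}`, a sum over `γ ∈ μ + Λ`. -/
def theta (Λ : Submodule ℤ 𝔱) (k : ℕ) (τ : ℍ) (μ : 𝔱) (x : 𝔱 × 𝔱) : ℂ :=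
  ∑' l : Λ, Complex.exp (2 * Complex.I * Real.pi * k *
    ((τ : ℂ) / 2 * (inner ℝ (μ + l) (μ + l) : ℝ)
      - ((inner ℝ x.1 (μ + l) : ℝ) + (τ : ℂ) * (inner ℝ x.2 (μ + l) : ℝ))))

/-- The section `Θ^τ_{μ,k} s_τ^k` of `L^k`. -/
def thetaSec (Λ : Submodule ℤ 𝔱) (k : ℕ) (τ : ℍ) (μ : 𝔱) (x : 𝔱 × 𝔱) : ℂ :=
  theta Λ k τ μ x * sSec τ x ^ k

/-- The section `χ^τ_{μ,k} = ∑_w (-1)^{ℓ(w)} Θ^τ_{w(μ),k} s_τ^k` of `L^k`. -/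
def chi (Λ : Submodule ℤ 𝔱) (Φ : Set 𝔱) (k : ℕ) (τ : ℍ) (μ : 𝔱) (x : 𝔱 × 𝔱) : ℂ :=
  ∑ᶠ w : weylGroup Φ, weylSign w * thetaSec Λ k τ ((w : 𝔱 ≃ₗᵢ[ℝ] 𝔱) μ) x

/-- The action `A.(p, q) = (a p + b q, c p + d q)` of the modular group on `𝔱²`. -/
def actPair (A : SL(2, ℤ)) (x : 𝔱 × 𝔱) : 𝔱 × 𝔱 :=
  (A 0 0 • x.1 + A 0 1 • x.2, A 1 0 • x.1 + A 1 1 • x.2)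

/-- The action of `A` on sections, `(A.F)(x) = F(A⁻¹ x)`, for the trivial lift of `A` to the
prequantum bundle. -/
def modAct (A : SL(2, ℤ)) (F : 𝔱 × 𝔱 → δ) (x : 𝔱 × 𝔱) : δ := F (actPair A⁻¹ x)

/-- The map from sections of `L^k ⊗ δ_τ` to sections of `L^k ⊗ δ_{A.τ}` induced by `(A, e)`, which
acts from `δ_τ` to `δ_{A.τ}` as the multiplication by `e(τ)`. -/
def metaAct {n : ℕ} (g : Mo2 n) (τ : ℍ) (F : 𝔱 × 𝔱 → δ) (x : 𝔱 × 𝔱) : δ :=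
  g.e τ • modAct g.A F x

/-- `k⁻¹ Λ^*` modulo `Λ`. -/
abbrev ThetaIndex (Λ : Submodule ℤ 𝔱) (k : ℕ) : Type _ :=
  scaledDual Λ k ⧸ Λ.submoduleOf (scaledDual Λ k)

end Sections

/-- The coefficient `∑_w (-1)^{ℓ(w)} exp(-2 i π k B(μ, w(μ')))`. -/
def weylSum {𝔱 : Type*} [NormedAddCommGroup 𝔱] [InnerProductSpace ℝ 𝔱]
    (Φ : Set 𝔱) (k : ℕ) (μ μ' : 𝔱) : ℂ :=
  ∑ᶠ w : weylGroup Φ, weylSign w *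
    Complex.exp (-(2 * Complex.I * Real.pi * k * (inner ℝ μ ((w : 𝔱 ≃ₗᵢ[ℝ] 𝔱) μ') : ℝ)))

/-- The constant `k^{-n/2} Vol(𝔱/Λ)⁻¹`, with `n = dim 𝔱`. -/
def volConst {𝔱 : Type*} [NormedAddCommGroup 𝔱] [InnerProductSpace ℝ 𝔱] [FiniteDimensional ℝ 𝔱]
    [MeasurableSpace 𝔱] [BorelSpace 𝔱] (Λ : Submodule ℤ 𝔱) (k : ℕ) : ℂ :=
  (((k : ℝ) ^ (-(Module.finrank ℝ 𝔱 : ℝ) / 2) *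
    (ZLattice.covolume Λ (MeasureTheory.volume : MeasureTheory.Measure 𝔱))⁻¹ : ℝ) : ℂ)

end TorusCS

end

/-! Fix `τ`. Dividing a holomorphic section by a single term of a theta series cancels both the
connection and the automorphy factors: the quotient is an ordinary function, holomorphic in `ζ = p +
τ q` and `Λ`-periodic in `p`. Its integral over a period in `p` does not depend on `q`: along a
complex line the integral is entire and invariant under real translations, hence constant
(`setIntegral_slice`). These integrals are the coefficients `coeff`. Translation in `q` shows that
they depend only on the index modulo `Λ`, Fourier uniqueness on each slice shows that they determine
the section, and on theta functions they are Kronecker deltas. So theta functions form a basis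
(`thetaEquiv`).

`T` multiplies each theta term by a quadratic character, well defined modulo `Λ` because the coroot
lattice is even. For `S`, the coefficients of `S.Θ` unfold from a fundamental domain to Gaussian
integrals over `𝔱`, which is Poisson summation; the outcome is a finite Fourier matrix times `(S.τ /
i)^(n/2) k^(-n/2) / Vol` (`coeff_modAct_S`). The multiplier `e(τ)` removes the dependence on `τ`,
since `e(τ) (S.τ / i)^(n/2)` is continuous with constant square. As `S` and `T` generate `SL(2, ℤ)`,
every element of the extension acts in the theta bases by a matrix independent of `τ`
(`exists_hasMatrix`). This matrix is unique, therefore multiplicative, and transporting it to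
sections gives `R₂`.

The Weyl group permutes the theta basis, so alternating sections correspond to alternating functions
on `k⁻¹ Λ^*` modulo `Λ`. Every point can be moved to the closed alcove by the affine Weyl group; a
point on a wall is fixed by an odd element, so an alternating function vanishes there; points of the
open alcove have trivial stabilizers and lie in distinct orbits. Hence the values at the alcove
weights are coordinates, and the `χ_μ` form the dual basis.

The facts on roots are derived from the Lie algebra. Exponentiating the adjoint action of a root
vector gives automorphisms that induce the reflections and force integrality; a norm estimate in the
style of `sl₂` gives reducedness; simplicity gives irreducibility. The highest root is long, so its
square length is `2`, coroots are integer multiples of roots, and the coroot lattice is even.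
Freeness of the affine action comes from the exchange condition for reflections in the walls of the
alcove. -/

noncomputable section

namespace TorusCS

/-! ## Commuting skew operators and one-parameter groups -/

section LinearAlgebra

variable {V : Type*} [AddCommGroup V] [Module ℝ V] [FiniteDimensional ℝ V]

/-- The inner product given by a positive definite symmetric bilinear form. -/
@[reducible] def innerCore (B : LinearMap.BilinForm ℝ V) (hs : ∀ x y, B x y = B y x)
    (hp : ∀ x, x ≠ 0 → 0 < B x x) : InnerProductSpace.Core ℝ V where
  inner x y := B x y
  conj_inner_symm x y := by simp [hs x y]
  re_inner_nonneg x := by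
    rcases eq_or_ne x 0 with rfl | h
    · simp
    · simpa using (hp x h).le
  add_left x y z := by simp
  smul_left x y r := by simp
  definite x h := by
    by_contra hx
    exact (hp x hx).ne' h

/-- A skew operator has no nonzero real eigenvalue, but the product of two commuting skew operators
is symmetric. The products form a commuting family of symmetric operators, hence are simultaneously
diagonalizable; they determine the roots up to sign without complexifying. -/
theorem span_joint_eigenvectors_eq_top (B : LinearMap.BilinForm ℝ V)
    (hs : ∀ x y, B x y = B y x) (hp : ∀ x, x ≠ 0 → 0 < B x x) {ι : Type*}
    (T : ι → V →ₗ[ℝ] V) (hT : ∀ i x y, B (T i x) y = -B x (T i y))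
    (hc : ∀ i j x, T i (T j x) = T j (T i x)) :
    Submodule.span ℝ {x : V | ∀ i j, ∃ c : ℝ, T i (T j x) = c • x} = ⊤ := by
  let : NormedAddCommGroup V := (innerCore B hs hp).toNormedAddCommGroup
  let : InnerProductSpace ℝ V := InnerProductSpace.ofCore (innerCore B hs hp).toCore
  have hsym : ∀ i : ι × ι, (T i.1 ∘ₗ T i.2).IsSymmetric := by
    intro i x y
    change B (T i.1 (T i.2 x)) y = B x (T i.1 (T i.2 y))
    rw [hT, hT, neg_neg, hc]
  have hcomm : Pairwise (Function.onFun Commute fun i : ι × ι => T i.1 ∘ₗ T i.2) := by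
    intro i i' _
    apply LinearMap.ext
    intro x
    change T i.1 (T i.2 (T i'.1 (T i'.2 x))) = T i'.1 (T i'.2 (T i.1 (T i.2 x)))
    rw [hc i.2, hc i.1 i'.1, hc i.2 i'.2, hc i.1 i'.2]
  have key := LinearMap.IsSymmetric.iSup_iInf_eq_top_of_commute hsym hcomm
  refine top_le_iff.mp (key ▸ iSup_le fun χ => ?_)
  intro x hx
  refine Submodule.subset_span fun i j => ⟨χ (i, j), ?_⟩
  have h := (Submodule.mem_iInf _).mp hx (i, j)
  exact Module.End.mem_eigenspace_iff.mp h

end LinearAlgebra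

/-! ### One-parameter groups of linear operators, and uniqueness for linear differential equations.
-/

section Flow

variable {V : Type*} [NormedAddCommGroup V] [NormedSpace ℝ V] [FiniteDimensional ℝ V]

/-- The one-parameter group generated by a linear operator. -/
def flow (D : V →ₗ[ℝ] V) (t : ℝ) : V →L[ℝ] V :=
  NormedSpace.exp (t • LinearMap.toContinuousLinearMap D)

theorem flow_hasDerivAt (D : V →ₗ[ℝ] V) (v : V) (t : ℝ) :
    HasDerivAt (fun s => flow D s v) (D (flow D t v)) t := by
  have : CompleteSpace V := FiniteDimensional.complete ℝ V
  have h := hasDerivAt_exp_smul_const' (𝕂 := ℝ) (LinearMap.toContinuousLinearMap D) t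
  exact h.clm_apply (hasDerivAt_const t v) |>.congr_deriv (by simp [flow])

theorem flow_zero (D : V →ₗ[ℝ] V) (v : V) : flow D 0 v = v := by
  simp [flow]

theorem flow_neg_hasDerivAt (D : V →ₗ[ℝ] V) {y : ℝ → V} (hy : ∀ t, HasDerivAt y (D (y t)) t)
    (t : ℝ) : HasDerivAt (fun s => flow D (-s) (y s)) 0 t := by
  have : CompleteSpace V := FiniteDimensional.complete ℝ V
  have h := hasDerivAt_exp_smul_const (𝕂 := ℝ) (LinearMap.toContinuousLinearMap D) (-t)
  have h2 := (h.scomp t (hasDerivAt_neg t)).clm_apply (hy t)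
  refine h2.congr_deriv ?_
  simp

/-- Uniqueness of solutions: the derivative of `exp(-tD) y(t)` vanishes. The later identities on
`flow` all follow by exhibiting two solutions of `y' = D y` with the same initial value. -/
theorem flow_neg_apply (D : V →ₗ[ℝ] V) {y : ℝ → V} (hy : ∀ t, HasDerivAt y (D (y t)) t)
    (t : ℝ) : flow D (-t) (y t) = y 0 := by
  have h := is_const_of_deriv_eq_zero
    (fun s => (flow_neg_hasDerivAt D hy s).differentiableAt)
    (fun s => (flow_neg_hasDerivAt D hy s).deriv) t 0
  simpa [flow_zero] using h

theorem flow_neg_flow (D : V →ₗ[ℝ] V) (t : ℝ) (v : V) : flow D (-t) (flow D t v) = v := by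
  simpa [flow_zero] using flow_neg_apply D (flow_hasDerivAt D v) t

theorem flow_flow_neg (D : V →ₗ[ℝ] V) (t : ℝ) (v : V) : flow D t (flow D (-t) v) = v := by
  simpa using flow_neg_flow D (-t) v

theorem eq_flow (D : V →ₗ[ℝ] V) {y : ℝ → V} (hy : ∀ t, HasDerivAt y (D (y t)) t)
    (t : ℝ) : y t = flow D t (y 0) := by
  rw [← flow_neg_apply D hy t, flow_flow_neg]

/-- The exponential of a derivation is an automorphism. It is used for the Lie bracket, with `D` an
inner derivation. -/
theorem flow_bilin (D : V →ₗ[ℝ] V) (m : V →ₗ[ℝ] V →ₗ[ℝ] V)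
    (hm : ∀ u v, D (m u v) = m (D u) v + m u (D v)) (t : ℝ) (u v : V) :
    flow D t (m u v) = m (flow D t u) (flow D t v) := by
  let m' : V →L[ℝ] V →L[ℝ] V := LinearMap.toContinuousLinearMap
    ((LinearMap.toContinuousLinearMap : (V →ₗ[ℝ] V) ≃ₗ[ℝ] (V →L[ℝ] V)).toLinearMap ∘ₗ m)
  have hm' : ∀ a b, m' a b = m a b := fun a b => rfl
  have h : ∀ t, HasDerivAt (fun s => m' (flow D s u) (flow D s v))
      (D (m' (flow D t u) (flow D t v))) t := by
    intro t
    have h1 := (m'.hasFDerivAt.comp_hasDerivAt t (flow_hasDerivAt D u t)).clm_apply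
      (flow_hasDerivAt D v t)
    refine h1.congr_deriv ?_
    simp [hm', hm]
  have h2 := eq_flow D h t
  simp only [hm', flow_zero] at h2
  exact h2.symm

theorem flow_comm (D : V →ₗ[ℝ] V) (φ : V →ₗ[ℝ] V) (h : ∀ v, φ (D v) = D (φ v)) (t : ℝ) (v : V) :
    φ (flow D t v) = flow D t (φ v) := by
  have h1 : ∀ t, HasDerivAt (fun s => LinearMap.toContinuousLinearMap φ (flow D s v))
      (D (LinearMap.toContinuousLinearMap φ (flow D t v))) t := by
    intro t
    refine ((LinearMap.toContinuousLinearMap φ).hasFDerivAt.comp_hasDerivAt t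
      (flow_hasDerivAt D v t)).congr_deriv ?_
    simp [h]
  simpa [flow_zero] using eq_flow D h1 t

/-- If `φ` intertwines `D` with `-D`, it intertwines `exp(tD)` with `exp(-tD)`. -/
theorem flow_anticomm (D : V →ₗ[ℝ] V) (φ : V →ₗ[ℝ] V) (h : ∀ v, φ (D v) = -D (φ v)) (t : ℝ)
    (v : V) : flow D t (φ (flow D t v)) = φ v := by
  have h1 : ∀ t, HasDerivAt (fun s => LinearMap.toContinuousLinearMap φ (flow D (-s) v))
      (D (LinearMap.toContinuousLinearMap φ (flow D (-t) v))) t := by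
    intro t
    refine ((LinearMap.toContinuousLinearMap φ).hasFDerivAt.comp_hasDerivAt t
      ((flow_hasDerivAt D v (-t)).scomp t (hasDerivAt_neg t))).congr_deriv ?_
    simp [h]
  have h2 : φ (flow D (- -t) v) = flow D (-t) (φ v) := by
    simpa [flow_zero] using eq_flow D h1 (-t)
  rw [neg_neg] at h2
  rw [h2, flow_flow_neg]

theorem flow_eq_self (D : V →ₗ[ℝ] V) {v : V} (h : D v = 0) (t : ℝ) : flow D t v = v := by
  have h1 : ∀ t : ℝ, HasDerivAt (fun _ => v) (D v) t := fun t => by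
    rw [h]; exact hasDerivAt_const t v
  exact (eq_flow D h1 t).symm

theorem flow_rotation (D : V →ₗ[ℝ] V) {v w : V} {ω : ℝ} (h : D v = ω • w) (h' : D w = -(ω • v))
    (t : ℝ) : flow D t v = Real.cos (ω * t) • v + Real.sin (ω * t) • w := by
  have h1 : ∀ t : ℝ, HasDerivAt (fun s => Real.cos (ω * s) • v + Real.sin (ω * s) • w)
      (D (Real.cos (ω * t) • v + Real.sin (ω * t) • w)) t := by
    intro t
    have hl : HasDerivAt (fun s : ℝ => ω * s) ω t := by
      simpa using (hasDerivAt_id t).const_mul ω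
    refine ((hl.cos.smul_const v).add (hl.sin.smul_const w)).congr_deriv ?_
    rw [map_add, map_smul, map_smul, h, h']
    module
  simpa using (eq_flow D h1 t).symm

end Flow

/-- A positive definite symmetric form on a real vector space provides exponentials of all linear
operators, compatible with the bilinear products of which they are derivations. -/
theorem exists_exp {V : Type*} [AddCommGroup V] [Module ℝ V] [FiniteDimensional ℝ V]
    (B : LinearMap.BilinForm ℝ V) (hs : ∀ x y, B x y = B y x) (hp : ∀ x, x ≠ 0 → 0 < B x x) :
    ∃ E : (V →ₗ[ℝ] V) → V →ₗ[ℝ] V,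
      (∀ D, Function.Injective (E D)) ∧
      (∀ (D : V →ₗ[ℝ] V) (m : V →ₗ[ℝ] V →ₗ[ℝ] V),
        (∀ u v, D (m u v) = m (D u) v + m u (D v)) → ∀ u v, E D (m u v) = m (E D u) (E D v)) ∧
      (∀ D φ : V →ₗ[ℝ] V, (∀ v, φ (D v) = D (φ v)) → ∀ v, φ (E D v) = E D (φ v)) ∧
      (∀ D φ : V →ₗ[ℝ] V, (∀ v, φ (D v) = -D (φ v)) → ∀ v, E D (φ (E D v)) = φ v) ∧
      (∀ (D : V →ₗ[ℝ] V) (v : V), D v = 0 → E D v = v) ∧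
      (∀ (D : V →ₗ[ℝ] V) (v w : V) (ω : ℝ), D v = ω • w → D w = -(ω • v) →
        E D v = Real.cos ω • v + Real.sin ω • w) := by
  -- The form provides a norm, needed only to give a meaning to the exponential; the conclusion is
  -- purely algebraic, so this local norm does not appear in it.
  let : NormedAddCommGroup V := (innerCore B hs hp).toNormedAddCommGroup
  let : InnerProductSpace ℝ V := InnerProductSpace.ofCore (innerCore B hs hp).toCore
  refine ⟨fun D => (flow D 1 : V →ₗ[ℝ] V), fun D => ?_, fun D m h u v => flow_bilin D m h 1 u v,
    fun D φ h v => flow_comm D φ h 1 v, fun D φ h v => flow_anticomm D φ h 1 v,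
    fun D v h => flow_eq_self D h 1, fun D v w ω h h' => ?_⟩
  · exact Function.LeftInverse.injective (g := flow D (-1)) fun v => flow_neg_flow D 1 v
  · have := flow_rotation D h h' 1
    rwa [mul_one] at this

/-! ## Root vectors -/

section RootVectors

variable {𝔱 : Type*} [NormedAddCommGroup 𝔱] [InnerProductSpace ℝ 𝔱]
variable {𝔤 : Type*} [LieRing 𝔤] [LieAlgebra ℝ 𝔤]

open scoped RealInnerProductSpace

/-- `x + i y` is a vector of weight `2 i π a`. -/
def IsWeightPair (j : 𝔱 →ₗ[ℝ] 𝔤) (a : 𝔱) (x y : 𝔤) : Prop :=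
  ∀ h : 𝔱, ⁅j h, x⁆ = -((2 * Real.pi * ⟪a, h⟫) • y) ∧ ⁅j h, y⁆ = (2 * Real.pi * ⟪a, h⟫) • x

/-- The reflection in the hyperplane orthogonal to `a`. -/
def refl (a h : 𝔱) : 𝔱 := h - ⟪h, coroot a⟫ • a

theorem inner_refl (a b h : 𝔱) : ⟪refl a b, h⟫ = ⟪b, refl a h⟫ := by
  simp only [refl, coroot, inner_sub_left, inner_sub_right, inner_smul_left, inner_smul_right,
    RCLike.conj_to_real]
  rw [real_inner_comm a h]
  ring

theorem inner_self_coroot {a : 𝔱} (ha : a ≠ 0) : ⟪a, coroot a⟫ = 2 := by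
  rw [coroot, inner_smul_right, div_mul_cancel₀]
  exact inner_self_ne_zero.mpr ha

theorem refl_refl {a : 𝔱} (ha : a ≠ 0) (h : 𝔱) : refl a (refl a h) = h := by
  have := inner_self_coroot ha
  simp only [refl, inner_sub_left, inner_smul_left, RCLike.conj_to_real, this]
  module

theorem refl_self {a : 𝔱} (ha : a ≠ 0) : refl a a = -a := by
  rw [refl, inner_self_coroot ha]; module

variable {B : LinearMap.BilinForm ℝ 𝔤} {j : 𝔱 →ₗ[ℝ] 𝔤}

namespace IsBasicInnerProduct

theorem injective (hB : IsBasicInnerProduct B j) : Function.Injective j := by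
  refine (injective_iff_map_eq_zero j).mpr fun h hh => ?_
  have := hB.restrict h h
  rw [hh, map_zero] at this
  exact inner_self_eq_zero.mp this

theorem eq_zero (hB : IsBasicInnerProduct B j) {x : 𝔤} (h : B x x = 0) : x = 0 := by
  by_contra hx
  exact (hB.pos x hx).ne' h

theorem nonneg (hB : IsBasicInnerProduct B j) (x : 𝔤) : 0 ≤ B x x := by
  rcases eq_or_ne x 0 with rfl | h
  · simp
  · exact (hB.pos x h).le

end IsBasicInnerProduct

theorem lie_torus (hj : IsMaximalAbelian j) (h h' : 𝔱) : ⁅j h, j h'⁆ = 0 :=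
  (hj (j h')).mp ⟨h', rfl⟩ h

namespace IsWeightPair

variable {a b : 𝔱} {x y u v : 𝔤}

/-- Multiplication of `x + i y` by `-i`. It exchanges the roles of real and imaginary parts. -/
theorem rotate (hp : IsWeightPair j a x y) : IsWeightPair j a y (-x) := fun h => by
  rw [lie_neg, (hp h).1, (hp h).2]
  constructor <;> module

/-- Complex conjugation turns a root vector for `a` into one for `-a`. -/
theorem conj (hp : IsWeightPair j a x y) : IsWeightPair j (-a) x (-y) := fun h => by
  rw [lie_neg, (hp h).1, (hp h).2, inner_neg_left]
  constructor <;> module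

theorem lie_left (hp : IsWeightPair j a x y) (h : 𝔱) : ⁅x, j h⁆ = (2 * Real.pi * ⟪a, h⟫) • y := by
  rw [← lie_skew, (hp h).1, neg_neg]

theorem lie_right (hp : IsWeightPair j a x y) (h : 𝔱) :
    ⁅y, j h⁆ = -((2 * Real.pi * ⟪a, h⟫) • x) := by
  rw [← lie_skew, (hp h).2]

theorem two_pi_inner_self_ne (ha : a ≠ 0) : 2 * Real.pi * ⟪a, a⟫ ≠ 0 :=
  mul_ne_zero (mul_ne_zero two_ne_zero Real.pi_ne_zero) (inner_self_ne_zero.mpr ha)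

theorem eq_zero_of_left (hp : IsWeightPair j a x y) (ha : a ≠ 0) (hx : x = 0) : y = 0 := by
  have := (hp a).1
  rw [hx, lie_zero, eq_comm, neg_eq_zero] at this
  exact (smul_eq_zero.mp this).resolve_left (two_pi_inner_self_ne ha)

theorem eq_zero_of_right (hp : IsWeightPair j a x y) (ha : a ≠ 0) (hy : y = 0) : x = 0 := by
  simpa using hp.rotate.eq_zero_of_left ha hy

theorem orthogonal_torus (hp : IsWeightPair j a x y) (hB : IsBasicInnerProduct B j)
    (hj : IsMaximalAbelian j) (ha : a ≠ 0) (h : 𝔱) : B x (j h) = 0 := by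
  have h1 := hB.invariant (j a) y (j h)
  rw [lie_torus hj, map_zero, neg_zero, (hp a).2, map_smul, LinearMap.smul_apply] at h1
  exact (smul_eq_zero.mp h1).resolve_left (two_pi_inner_self_ne ha)

theorem norm_eq (hp : IsWeightPair j a x y) (hB : IsBasicInnerProduct B j) (ha : a ≠ 0) :
    B y y = B x x := by
  have h1 := hB.invariant (j a) x y
  simp only [(hp a).1, (hp a).2, map_neg, map_smul, LinearMap.neg_apply, LinearMap.smul_apply,
    neg_inj, smul_eq_mul] at h1
  exact mul_left_cancel₀ (two_pi_inner_self_ne ha) h1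

theorem inner_eq_zero (hp : IsWeightPair j a x y) (hB : IsBasicInnerProduct B j) (ha : a ≠ 0) :
    B x y = 0 := by
  have h1 := hB.invariant (j a) x x
  simp only [(hp a).1, map_neg, map_smul, LinearMap.neg_apply, LinearMap.smul_apply,
    neg_neg, smul_eq_mul, hB.symm y x] at h1
  have h2 : (2 * Real.pi * ⟪a, a⟫) * B x y = 0 := by linarith
  exact (mul_eq_zero.mp h2).resolve_left (two_pi_inner_self_ne ha)

/-- The bracket of two weight vectors, `[x + i y, u + i v]`. -/
theorem lie (hp : IsWeightPair j a x y) (hq : IsWeightPair j b u v) :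
    IsWeightPair j (a + b) (⁅x, u⁆ - ⁅y, v⁆) (⁅x, v⁆ + ⁅y, u⁆) := fun h => by
  simp only [lie_sub, lie_add, leibniz_lie (j h), (hp h).1, (hp h).2, (hq h).1, (hq h).2,
    inner_add_left, neg_lie, lie_neg, smul_lie, lie_smul]
  constructor <;> module

theorem mem_torus_of_zero (hj : IsMaximalAbelian j) (hp : IsWeightPair j 0 x y) :
    ∃ h, j h = x := (hj x).mpr fun h => by simp [(hp h).1]

/-- The bracket commutes with the torus, so it lies in it by maximality; pairing with an arbitrary
`h` and using invariance identifies the element. -/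
theorem lie_self (hp : IsWeightPair j a x y) (hB : IsBasicInnerProduct B j)
    (hj : IsMaximalAbelian j) (ha : a ≠ 0) : ⁅x, y⁆ = j (-(2 * Real.pi * B x x) • a) := by
  obtain ⟨t, ht⟩ : ∃ t, j t = ⁅x, y⁆ := (hj _).mpr fun h => by
    rw [leibniz_lie, (hp h).1, (hp h).2]
    simp
  rw [← ht]
  congr 1
  refine ext_inner_right ℝ fun h => ?_
  rw [hB.restrict t h, ht, hB.invariant, hp.lie_left, inner_smul_left, map_smul, hp.norm_eq hB ha]
  simp
  ring

end IsWeightPair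

/-! ## The roots form an irreducible reduced root system -/

/-- A reduced irreducible crystallographic root system spanning `𝔱`. -/
structure IsRootSet (Φ : Set 𝔱) : Prop where
  finite : Φ.Finite
  span : Submodule.span ℝ Φ = ⊤
  ne_zero : ∀ a ∈ Φ, a ≠ 0
  refl_mem : ∀ a ∈ Φ, ∀ b ∈ Φ, refl a b ∈ Φ
  integral : ∀ a ∈ Φ, ∀ b ∈ Φ, ∃ m : ℤ, ⟪b, coroot a⟫ = m
  reduced : ∀ a ∈ Φ, ∀ c : ℝ, c • a ∈ Φ → c = 1 ∨ c = -1
  irreducible : ∀ Φ' ⊆ Φ, Φ'.Nonempty → (∀ a ∈ Φ', ∀ b ∈ Φ, b ∉ Φ' → ⟪a, b⟫ = 0) → Φ' = Φ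

theorem mem_realRoots {a : 𝔱} :
    a ∈ realRoots j ↔ a ≠ 0 ∧ ∃ x y : 𝔤, (x ≠ 0 ∨ y ≠ 0) ∧ IsWeightPair j a x y := Iff.rfl

theorem IsWeightPair.mem_realRoots {a : 𝔱} {x y : 𝔤} (hp : IsWeightPair j a x y) (ha : a ≠ 0)
    (h : x ≠ 0 ∨ y ≠ 0) : a ∈ realRoots j := ⟨ha, x, y, h, hp⟩

theorem exists_weightPair {a : 𝔱} (ha : a ∈ realRoots j) :
    a ≠ 0 ∧ ∃ x y : 𝔤, x ≠ 0 ∧ y ≠ 0 ∧ IsWeightPair j a x y := by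
  obtain ⟨h0, x, y, h, hp⟩ := mem_realRoots.mp ha
  refine ⟨h0, x, y, fun hx => ?_, fun hy => ?_, hp⟩
  · exact h.elim (fun h => h hx) (fun h => h (hp.eq_zero_of_left h0 hx))
  · exact h.elim (fun h => h (hp.eq_zero_of_right h0 hy)) (fun h => h hy)

/-- The inner automorphism realising a root reflection on the torus, together with the square root
of the identity attached to the coroot. -/
theorem exists_reflection_automorphism [FiniteDimensional ℝ 𝔤] (hB : IsBasicInnerProduct B j)
    (hj : IsMaximalAbelian j) {a : 𝔱} (ha : a ∈ realRoots j) :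
    ∃ φ : 𝔤 →ₗ[ℝ] 𝔤, Function.Injective φ ∧ (∀ u v, φ ⁅u, v⁆ = ⁅φ u, φ v⁆) ∧
      (∀ h, φ (j h) = j (refl a h)) ∧
      ∀ b, ∀ u v : 𝔤, u ≠ 0 → b ≠ 0 → IsWeightPair j b u v →
        Real.cos (2 * Real.pi * ⟪b, coroot a⟫) = 1 := by
  obtain ⟨h0, x, y, hx, hy, hp⟩ := exists_weightPair ha
  obtain ⟨E, hEinj, hEbil, hEcomm, hEanti, hEself, hErot⟩ := exists_exp B hB.symm hB.pos
  have hpos : 0 < B x x := hB.pos x hx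
  have haa : 0 < ⟪a, a⟫ := real_inner_self_pos.mpr h0
  have hder : ∀ (z : 𝔤) (c : ℝ) (u v : 𝔤), (c • LieAlgebra.ad ℝ 𝔤 z : 𝔤 →ₗ[ℝ] 𝔤) ⁅u, v⁆ =
      ⁅(c • LieAlgebra.ad ℝ 𝔤 z : 𝔤 →ₗ[ℝ] 𝔤) u, v⁆ +
        ⁅u, (c • LieAlgebra.ad ℝ 𝔤 z : 𝔤 →ₗ[ℝ] 𝔤) v⁆ := by
    intro z c u v
    simp only [LinearMap.smul_apply, LieAlgebra.ad_apply, leibniz_lie z u v, smul_lie, lie_smul,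
      smul_add]
  have hmul : ∀ (z : 𝔤) (c : ℝ) (u v : 𝔤), E (c • LieAlgebra.ad ℝ 𝔤 z) ⁅u, v⁆ =
      ⁅E (c • LieAlgebra.ad ℝ 𝔤 z) u, E (c • LieAlgebra.ad ℝ 𝔤 z) v⁆ := fun z c u v =>
    hEbil _ (LieModule.toEnd ℝ 𝔤 𝔤 : 𝔤 →ₗ[ℝ] 𝔤 →ₗ[ℝ] 𝔤) (hder z c) u v
  -- The normalization makes `ad (s x)` an infinitesimal rotation of frequency `π` in the plane of
  -- `j a` and `y`. At time `1` it is a half turn, which sends `j a` to `-j a`; the orthogonal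
  -- complement of `a` in the torus is annihilated by `ad x` and stays fixed.
  obtain ⟨s, hs⟩ : ∃ s : ℝ, 4 * s ^ 2 * ⟪a, a⟫ * B x x = 1 := by
    refine ⟨(Real.sqrt (4 * ⟪a, a⟫ * B x x))⁻¹, ?_⟩
    have hq : 0 < 4 * ⟪a, a⟫ * B x x := by positivity
    rw [inv_pow, Real.sq_sqrt hq.le]
    field_simp
  set φ := E (s • LieAlgebra.ad ℝ 𝔤 x) with hφ
  have hφa : φ (j a) = -j a := by
    have := hErot (s • LieAlgebra.ad ℝ 𝔤 x) (j a) ((2 * s * ⟪a, a⟫) • y) Real.pi ?_ ?_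
    · simpa using this
    · simp only [LinearMap.smul_apply, LieAlgebra.ad_apply, hp.lie_left]
      module
    · simp only [LinearMap.smul_apply, LieAlgebra.ad_apply, hp.lie_self hB hj h0,
        map_smul, smul_smul]
      rw [← neg_smul]
      congr 1
      linear_combination (-Real.pi) * hs
  have hφt : ∀ h, φ (j h) = j (refl a h) := by
    intro h
    have horth : ⟪a, h - (⟪h, coroot a⟫ / 2) • a⟫ = 0 := by
      rw [inner_sub_right, inner_smul_right, coroot, inner_smul_right, real_inner_comm a h]
      field_simp
      ring
    have h1 : φ (j (h - (⟪h, coroot a⟫ / 2) • a)) = j (h - (⟪h, coroot a⟫ / 2) • a) := by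
      refine hEself _ _ ?_
      simp only [LinearMap.smul_apply, LieAlgebra.ad_apply, hp.lie_left, horth]
      simp
    have h2 : h = (h - (⟪h, coroot a⟫ / 2) • a) + (⟪h, coroot a⟫ / 2) • a := by module
    conv_lhs => rw [h2, map_add, map_add, h1, map_smul, map_smul, hφa, ← map_neg, ← map_smul,
      ← map_add]
    rw [refl]
    congr 1
    module
  refine ⟨φ, hEinj _, hmul x s, hφt, fun b u v hu hb hq => ?_⟩
  -- Here `E D` is the exponential of `ad (a^∨ / 2)`. It turns the plane of `x` and `y` by a full
  -- turn, so it fixes `x` and commutes with `φ`. Since `φ` maps `j a` to `-j a`, also `E D ∘ φ ∘ E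
  -- D = φ`. Together these give `(E D)² = 1`, that is `exp (ad a^∨) = 1`, and reading this on `u`
  -- yields the cosine condition.
  set c : ℝ := (⟪a, a⟫)⁻¹ with hc
  set D := c • LieAlgebra.ad ℝ 𝔤 (j a) with hD
  have hGx : E D x = x := by
    have := hErot D x y (-(2 * Real.pi)) ?_ ?_
    · simpa using this
    · simp only [hD, LinearMap.smul_apply, LieAlgebra.ad_apply, (hp a).1, hc]
      rw [smul_neg, smul_smul, ← neg_smul]
      congr 1
      field_simp
    · simp only [hD, LinearMap.smul_apply, LieAlgebra.ad_apply, (hp a).2, hc]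
      rw [smul_smul, ← neg_smul]
      congr 1
      field_simp
  have hGφ : ∀ z, E D (φ z) = φ (E D z) := by
    refine hEcomm (s • LieAlgebra.ad ℝ 𝔤 x) (E D) fun z => ?_
    simp only [LinearMap.smul_apply, LieAlgebra.ad_apply, map_smul]
    rw [hD, hmul, ← hD, hGx]
  have hφG : ∀ z, E D (φ (E D z)) = φ z := by
    refine hEanti D φ fun z => ?_
    simp only [hD, LinearMap.smul_apply, LieAlgebra.ad_apply, map_smul]
    rw [hφ, hmul, ← hφ, hφa, neg_lie, smul_neg]
  have hGG : ∀ z, E D (E D z) = z := fun z => hEinj _ ((hGφ (E D z)).symm.trans (hφG z))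
  set t : ℝ := ⟪b, a⟫ * c with ht
  have hDu : D u = (-(2 * Real.pi * t)) • v := by
    simp only [hD, LinearMap.smul_apply, LieAlgebra.ad_apply, (hq a).1, ht]
    module
  have hDv : D v = (2 * Real.pi * t) • u := by
    simp only [hD, LinearMap.smul_apply, LieAlgebra.ad_apply, (hq a).2, ht]
    module
  have hGu := hErot D u v _ hDu (by rw [hDv]; module)
  have hGv := hErot D v (-u) (-(2 * Real.pi * t)) (by rw [hDv]; module)
    (by rw [map_neg, hDu])
  have h1 := hGG u
  rw [hGu, map_add, map_smul, map_smul, hGu, hGv] at h1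
  have h2 := congrArg (B u) h1
  simp only [map_add, map_smul, smul_eq_mul, map_neg, hq.inner_eq_zero hB hb] at h2
  have hpu := hB.pos u hu
  have h3 : Real.cos (-(2 * Real.pi * t)) ^ 2 - Real.sin (-(2 * Real.pi * t)) ^ 2 = 1 := by
    refine mul_right_cancel₀ hpu.ne' ?_
    linear_combination h2
  have h4 : 2 * Real.pi * ⟪b, coroot a⟫ = 2 * (2 * Real.pi * t) := by
    rw [coroot, inner_smul_right, ht, hc]
    ring
  rw [h4, Real.cos_two_mul']
  simpa using h3

/-- The automorphism attached to `a` carries a root vector for `b` to a root vector for the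
reflected root. -/
theorem refl_mem_realRoots [FiniteDimensional ℝ 𝔤] (hB : IsBasicInnerProduct B j)
    (hj : IsMaximalAbelian j) {a b : 𝔱} (ha : a ∈ realRoots j) (hb : b ∈ realRoots j) :
    refl a b ∈ realRoots j := by
  obtain ⟨φ, hinj, hmul, hφt, -⟩ := exists_reflection_automorphism hB hj ha
  obtain ⟨hb0, u, v, hu, hv, hq⟩ := exists_weightPair hb
  refine ⟨fun h => hb0 ?_, φ u, φ v, Or.inl ?_, fun h => ?_⟩
  · rw [← refl_refl ha.1 b, h]
    simp [refl]
  · rwa [Ne, map_eq_zero_iff _ hinj]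
  · have hh : j h = φ (j (refl a h)) := by rw [hφt, refl_refl ha.1]
    rw [hh, ← hmul, ← hmul, (hq _).1, (hq _).2, inner_refl]
    simp

theorem integral_realRoots [FiniteDimensional ℝ 𝔤] (hB : IsBasicInnerProduct B j)
    (hj : IsMaximalAbelian j) {a b : 𝔱} (ha : a ∈ realRoots j) (hb : b ∈ realRoots j) :
    ∃ m : ℤ, ⟪b, coroot a⟫ = m := by
  obtain ⟨φ, -, -, -, h⟩ := exists_reflection_automorphism hB hj ha
  obtain ⟨hb0, u, v, hu, hv, hq⟩ := exists_weightPair hb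
  obtain ⟨m, hm⟩ := (Real.cos_eq_one_iff _).mp (h b u v hu hb0 hq)
  refine ⟨m, ?_⟩
  have := Real.pi_ne_zero
  have h2 : (2 * Real.pi) ≠ 0 := by positivity
  exact mul_left_cancel₀ h2 (by linear_combination -hm)

end RootVectors

/-! ### Reducedness, root space decomposition, finiteness and irreducibility. -/

section RootVectors

variable {𝔱 : Type*} [NormedAddCommGroup 𝔱] [InnerProductSpace ℝ 𝔱]
variable {𝔤 : Type*} [LieRing 𝔤] [LieAlgebra ℝ 𝔤]

open scoped RealInnerProductSpace

variable {B : LinearMap.BilinForm ℝ 𝔤} {j : 𝔱 →ₗ[ℝ] 𝔤}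
-- The hypotheses `h1`, `h2` say that the lowering operator `x - i y` kills `u + i v`. Expanding the
-- square norm of this zero bracket by invariance and the Jacobi identity, what remains is a sum of
-- squares plus a positive multiple of `⟪b, a⟫ B(u, u)`: a lowest weight cannot pair positively with
-- `a`.
theorem IsWeightPair.eq_zero_of_conj_lie_eq_zero {a b : 𝔱} {x y u v : 𝔤}
    (hp : IsWeightPair j a x y) (hq : IsWeightPair j b u v) (hB : IsBasicInnerProduct B j)
    (hj : IsMaximalAbelian j) (ha : a ≠ 0) (hx : x ≠ 0) (hab : 0 < ⟪b, a⟫)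
    (h1 : ⁅x, u⁆ + ⁅y, v⁆ = 0) (h2 : ⁅x, v⁆ - ⁅y, u⁆ = 0) : u = 0 := by
  have e1 : B ⁅x, u⁆ ⁅y, v⁆ = -B u ⁅x, ⁅y, v⁆⁆ := hB.invariant _ _ _
  have e2 : B ⁅x, v⁆ ⁅y, u⁆ = -B u ⁅y, ⁅x, v⁆⁆ := by rw [hB.symm]; exact hB.invariant _ _ _
  have e3 : ⁅x, ⁅y, v⁆⁆ = ⁅⁅x, y⁆, v⁆ + ⁅y, ⁅x, v⁆⁆ := leibniz_lie x y v
  have e4 : B u ⁅⁅x, y⁆, v⁆ = -(4 * Real.pi ^ 2 * B x x * ⟪b, a⟫ * B u u) := by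
    rw [hp.lie_self hB hj ha, (hq _).2, inner_smul_right, map_smul, smul_eq_mul]
    ring
  have e5 : B (⁅x, u⁆ + ⁅y, v⁆) (⁅x, u⁆ + ⁅y, v⁆) + B (⁅x, v⁆ - ⁅y, u⁆) (⁅x, v⁆ - ⁅y, u⁆) = 0 := by
    rw [h1, h2]; simp
  simp only [map_add, map_sub, LinearMap.add_apply, LinearMap.sub_apply] at e5
  rw [hB.symm ⁅y, v⁆ ⁅x, u⁆, hB.symm ⁅y, u⁆ ⁅x, v⁆] at e5
  rw [e3, map_add] at e1
  have n1 := hB.nonneg ⁅x, u⁆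
  have n2 := hB.nonneg ⁅y, v⁆
  have n3 := hB.nonneg ⁅x, v⁆
  have n4 := hB.nonneg ⁅y, u⁆
  by_contra hu
  have n5 : 0 < 4 * Real.pi ^ 2 * B x x * ⟪b, a⟫ * B u u := by
    have := hB.pos x hx
    have := hB.pos u hu
    positivity
  linarith

/-- Apply the lowering operator `x - i y` twice to a root vector for `2a`. The result has weight
zero, so it lies in the torus; by invariance it is also orthogonal to the torus, because `[x, y]` is
in the torus and root vectors are orthogonal to it. Hence it is zero, and two applications of the
previous lemma kill the vector one started from. -/
theorem two_smul_notMem_realRoots (hB : IsBasicInnerProduct B j)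
    (hj : IsMaximalAbelian j) {a : 𝔱} (ha : a ∈ realRoots j) : (2 : ℝ) • a ∉ realRoots j := by
  intro ha2
  obtain ⟨h0, x, y, hx, hy, hp⟩ := exists_weightPair ha
  obtain ⟨h02, z, z', hz, hz', hq⟩ := exists_weightPair ha2
  have haa : 0 < ⟪a, a⟫ := real_inner_self_pos.mpr h0
  have hw := hp.conj.lie hq
  have hu := hp.conj.lie hw
  rw [show -a + (2 : ℝ) • a = a by module] at hw
  rw [show -a + (-a + (2 : ℝ) • a) = 0 by module] at hu
  simp only [neg_lie, sub_neg_eq_add, ← sub_eq_add_neg] at hw hu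
  have c1 : B ⁅y, z'⁆ x = B ⁅x, y⁆ z' := by
    rw [hB.invariant, hB.symm ⁅x, y⁆, ← lie_skew x y, map_neg]
  have c2 : B ⁅x, z'⁆ y = -B ⁅x, y⁆ z' := by rw [hB.invariant, hB.symm]
  have c3 : B ⁅y, z⁆ x = B ⁅x, y⁆ z := by
    rw [hB.invariant, hB.symm ⁅x, y⁆, ← lie_skew x y, map_neg]
  have c4 : B ⁅x, z⁆ y = -B ⁅x, y⁆ z := by rw [hB.invariant, hB.symm]
  have t1 : B ⁅x, y⁆ z = 0 := by
    rw [hp.lie_self hB hj h0, hB.symm, hq.orthogonal_torus hB hj h02]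
  have t2 : B ⁅x, y⁆ z' = 0 := by
    rw [hp.lie_self hB hj h0, hB.symm, hq.rotate.orthogonal_torus hB hj h02]
  have c5 : ∀ w, B ⁅x, w⁆ x = 0 := fun w => by rw [hB.invariant, lie_self, map_zero, neg_zero]
  have c6 : ∀ w, B ⁅y, w⁆ y = 0 := fun w => by rw [hB.invariant, lie_self, map_zero, neg_zero]
  have key : ∀ u : 𝔤, (∃ h, j h = u) → (∀ h, B u (j h) = 0) → u = 0 := by
    rintro _ ⟨h, rfl⟩ hh
    exact hB.eq_zero (hh h)
  have hu1 := key _ (hu.mem_torus_of_zero hj) fun h => by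
    rw [map_add, LinearMap.add_apply, hB.invariant x _ (j h), hB.invariant y _ (j h), hp.lie_left,
      hp.lie_right]
    simp only [map_add, LinearMap.add_apply, map_smul, map_neg, map_sub, LinearMap.sub_apply, c3,
      c4, c5, c6, t1, smul_eq_mul]
    simp
  have hu2 := key _ (hu.rotate.mem_torus_of_zero hj) fun h => by
    rw [map_sub, LinearMap.sub_apply, hB.invariant x _ (j h), hB.invariant y _ (j h), hp.lie_left,
      hp.lie_right]
    simp only [map_add, LinearMap.add_apply, map_smul, map_neg, map_sub, LinearMap.sub_apply, c1,
      c2, c5, c6, t2, smul_eq_mul]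
    simp
  have hw1 := hp.eq_zero_of_conj_lie_eq_zero hw hB hj h0 hx haa hu1 hu2
  have hw2 := hw.eq_zero_of_left h0 hw1
  refine hz (hp.eq_zero_of_conj_lie_eq_zero hq hB hj h0 hx ?_ hw1 hw2)
  rw [inner_smul_left, RCLike.conj_to_real]
  positivity

/-- Integrality in both directions makes `2c` and `2/c` integers with product `4`, so `c` is one of
`±1/2, ±1, ±2`. The factors of absolute value `2` and `1/2` are excluded because no root is twice
another. -/
theorem reduced_realRoots [FiniteDimensional ℝ 𝔤] (hB : IsBasicInnerProduct B j)
    (hj : IsMaximalAbelian j) {a : 𝔱} (ha : a ∈ realRoots j) (c : ℝ) (hc : c • a ∈ realRoots j) :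
    c = 1 ∨ c = -1 := by
  have h0 := ha.1
  have haa : ⟪a, a⟫ ≠ 0 := inner_self_ne_zero.mpr h0
  have hc0 : c ≠ 0 := by
    rintro rfl
    exact hc.1 (zero_smul ℝ a)
  obtain ⟨m, hm⟩ := integral_realRoots hB hj ha hc
  obtain ⟨l, hl⟩ := integral_realRoots hB hj hc ha
  rw [inner_smul_left, inner_self_coroot h0] at hm
  have hl' : 2 / c = (l : ℝ) := by
    rw [← hl]
    simp only [coroot, inner_smul_left, inner_smul_right, RCLike.conj_to_real]
    field_simp
  simp only [RCLike.conj_to_real] at hm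
  have hml : m * l = 4 := by
    have : (m : ℝ) * l = 4 := by
      rw [← hm, ← hl']
      field_simp
      norm_num
    exact_mod_cast this
  have hneg : ∀ b ∈ realRoots j, -b ∈ realRoots j := fun b hb => by
    have := refl_mem_realRoots hB hj hb hb
    rwa [refl_self hb.1] at this
  have two : ∀ b ∈ realRoots j, (2 : ℝ) • b ∉ realRoots j := fun b hb =>
    two_smul_notMem_realRoots hB hj hb
  have hmd : m ∣ 4 := ⟨l, hml.symm⟩
  have hm1 : m ≤ 4 := Int.le_of_dvd (by norm_num) hmd
  have hm2 : -4 ≤ m := by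
    have := Int.le_of_dvd (by norm_num) (neg_dvd.mpr hmd)
    omega
  have hcm : c = m / 2 := by linarith
  interval_cases m <;> norm_num at hcm <;> first | omega | skip
  · exact absurd (hneg _ hc) (by rw [hcm]; simpa using two a ha)
  · exact Or.inr hcm
  · refine absurd ?_ (two _ hc)
    rw [hcm, smul_smul]
    have := hneg a ha
    norm_num
    exact this
  · refine absurd ?_ (two _ hc)
    rw [hcm, smul_smul]
    norm_num
    exact ha
  · exact Or.inl hcm
  · exact absurd hc (by rw [hcm]; exact two a ha)

variable [FiniteDimensional ℝ 𝔱]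

/-- The root space decomposition. -/
theorem span_torus_union_root_vectors [FiniteDimensional ℝ 𝔤] (hB : IsBasicInnerProduct B j)
    (hj : IsMaximalAbelian j) :
    Submodule.span ℝ (Set.range j ∪ {x | ∃ a ∈ realRoots j, ∃ y, IsWeightPair j a x y}) = ⊤ := by
  rw [← top_le_iff, ← span_joint_eigenvectors_eq_top B hB.symm hB.pos
    (fun h : 𝔱 => (LieAlgebra.ad ℝ 𝔤 (j h) : 𝔤 →ₗ[ℝ] 𝔤)) (fun h x y => hB.invariant _ _ _)
    (fun h h' x => ?_)]
  · refine Submodule.span_mono fun z hz => ?_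
    simp only [Set.mem_ofPred_eq, LieAlgebra.ad_apply] at hz
    choose s hs using hz
    have hcomm : ∀ h h' : 𝔱, ⁅j h, ⁅j h', z⁆⁆ = ⁅j h', ⁅j h, z⁆⁆ := fun h h' => by
      rw [leibniz_lie, lie_torus hj, zero_lie, zero_add]
    have hsq : ∀ h, B ⁅j h, z⁆ ⁅j h, z⁆ = -(s h h * B z z) := fun h => by
      rw [hB.invariant, hs, map_smul, smul_eq_mul]
    rcases eq_or_ne z 0 with rfl | hz0
    · exact Or.inl ⟨0, map_zero j⟩
    have hzz := hB.pos z hz0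
    by_cases hall : ∀ h, s h h = 0
    · refine Or.inl ((hj z).mpr fun h => hB.eq_zero ?_)
      rw [hsq, hall]; simp
    push Not at hall
    obtain ⟨h₀, hh₀⟩ := hall
    refine Or.inr ?_
    have hneg : s h₀ h₀ < 0 := by
      have h1 := hsq h₀
      have h2 := hB.nonneg ⁅j h₀, z⁆
      by_contra hcon
      have : 0 < s h₀ h₀ := lt_of_le_of_ne (not_lt.mp hcon) (Ne.symm hh₀)
      have := mul_pos this hzz
      linarith
    -- This will be `2π ⟪a, h₀⟫` for the root `a` under construction; it fixes the sign of `a`.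
    set c := Real.sqrt (-s h₀ h₀) with hc
    have hc0 : 0 < c := Real.sqrt_pos.mpr (by linarith)
    have hc2 : c ^ 2 = -s h₀ h₀ := Real.sq_sqrt (by linarith)
    -- The eigenvalues `s` come from a choice, so their linearity is not known. Writing `s h₀ h` as
    -- `B(z, [h₀, [h, z]]) / B(z, z)` makes the functional visibly linear, and `a` represents it.
    let S : 𝔱 →ₗ[ℝ] ℝ := (-(2 * Real.pi * c * B z z)⁻¹) •
      ((B z) ∘ₗ (LieAlgebra.ad ℝ 𝔤 (j h₀) : 𝔤 →ₗ[ℝ] 𝔤) ∘ₗ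
        ((LieModule.toEnd ℝ 𝔤 𝔤 : 𝔤 →ₗ[ℝ] 𝔤 →ₗ[ℝ] 𝔤).flip z) ∘ₗ j)
    have hS : ∀ h, S h = -(s h₀ h / (2 * Real.pi * c)) := fun h => by
      have : S h = -(2 * Real.pi * c * B z z)⁻¹ * B z ⁅j h₀, ⁅j h, z⁆⁆ := rfl
      rw [this, hs, map_smul, smul_eq_mul]
      field_simp
    set a := (InnerProductSpace.toDual ℝ 𝔱).symm (LinearMap.toContinuousLinearMap S) with hadef
    have ha : ∀ h, ⟪a, h⟫ = -(s h₀ h / (2 * Real.pi * c)) := fun h => by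
      rw [hadef, InnerProductSpace.toDual_symm_apply, ← hS]; rfl
    have hpair : IsWeightPair j a z (-(c⁻¹ • ⁅j h₀, z⁆)) := fun h => by
      have e1 : s h₀ h₀ • ⁅j h, z⁆ = s h₀ h • ⁅j h₀, z⁆ := by
        rw [← lie_smul, ← hs h₀ h₀, leibniz_lie, lie_torus hj, zero_lie, zero_add, hcomm h h₀, hs,
          lie_smul]
      rw [ha]
      constructor
      · refine smul_right_injective 𝔤 hh₀ (?_ : s h₀ h₀ • _ = s h₀ h₀ • _)
        simp only [e1, smul_neg, smul_smul, neg_neg, neg_mul, mul_neg, neg_smul]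
        rw [← neg_smul]
        congr 1
        have hpi := Real.pi_ne_zero
        field_simp
        linear_combination (s h₀ h) * hc2
      · rw [lie_neg, lie_smul, hcomm, hs, smul_smul, ← neg_smul]
        congr 1
        have hpi := Real.pi_ne_zero
        field_simp
    refine ⟨a, hpair.mem_realRoots (fun h0 => ?_) (Or.inl hz0), _, hpair⟩
    have := ha h₀
    rw [h0, inner_zero_left] at this
    have hpi := Real.pi_pos
    have h3 : s h₀ h₀ / (2 * Real.pi * c) = 0 := by linarith
    rw [div_eq_zero_iff] at h3
    rcases h3 with h3 | h3
    · exact hh₀ h3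
    · have : 0 < 2 * Real.pi * c := by positivity
      linarith
  · simp only [LieAlgebra.ad_apply]
    rw [leibniz_lie, lie_torus hj, zero_lie, zero_add]

/-- Each coordinate of a root in an orthonormal basis is determined up to sign by an eigenvalue of
the square of `ad (j (e i))`, and an endomorphism of a finite dimensional space has finitely many
eigenvalues. -/
theorem finite_realRoots [FiniteDimensional ℝ 𝔤] (j : 𝔱 →ₗ[ℝ] 𝔤) : (realRoots j).Finite := by
  let e := stdOrthonormalBasis ℝ 𝔱
  let T : 𝔱 → Module.End ℝ 𝔤 := fun h =>
    (LieAlgebra.ad ℝ 𝔤 (j h) : 𝔤 →ₗ[ℝ] 𝔤) ∘ₗ (LieAlgebra.ad ℝ 𝔤 (j h) : 𝔤 →ₗ[ℝ] 𝔤)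
  have hT : ∀ a ∈ realRoots j, ∀ h, (T h).HasEigenvalue (-(2 * Real.pi * ⟪a, h⟫) ^ 2) := by
    intro a ha h
    obtain ⟨h0, x, y, hx, hy, hp⟩ := exists_weightPair ha
    refine Module.End.hasEigenvalue_of_hasEigenvector (x := x)
      ⟨Module.End.mem_eigenspace_iff.mpr ?_, hx⟩
    change ⁅j h, ⁅j h, x⁆⁆ = _
    rw [(hp h).1, lie_neg, lie_smul, (hp h).2]
    module
  have hfin : ∀ i, {r : ℝ | (T (e i)).HasEigenvalue (-(2 * Real.pi * r) ^ 2)}.Finite := by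
    intro i
    refine Set.Finite.subset (Set.Finite.preimage' (f := fun r : ℝ => -(2 * Real.pi * r) ^ 2)
      (Module.End.finite_hasEigenvalue (T (e i))) fun c _ => ?_) fun r hr => hr
    have hpi := Real.pi_pos
    refine Set.Finite.subset (Set.toFinite {Real.sqrt (-c) / (2 * Real.pi),
      -(Real.sqrt (-c) / (2 * Real.pi))}) fun r hr => ?_
    have hr' : (2 * Real.pi * r) ^ 2 = -c := by
      have : -(2 * Real.pi * r) ^ 2 = c := hr
      linarith
    have h2 : |2 * Real.pi * r| = Real.sqrt (-c) := by rw [← hr', Real.sqrt_sq_eq_abs]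
    rw [← h2]
    rcases abs_choice (2 * Real.pi * r) with h | h <;> rw [h]
    · left; field_simp
    · right; simp only [Set.mem_singleton_iff]; field_simp
  have := (Set.Finite.pi hfin).preimage (f := fun a : 𝔱 => fun i => ⟪a, e i⟫)
    (Function.Injective.injOn fun a b hab => e.repr.injective (by
      ext i
      simpa [e.repr_apply_apply, real_inner_comm] using congrFun hab i))
  refine this.subset fun a ha => ?_
  simp only [Set.mem_preimage, Set.mem_pi]
  exact fun i _ => hT a ha (e i)

theorem eq_zero_of_central [LieAlgebra.IsSimple ℝ 𝔤] {x : 𝔤} (h : ∀ y : 𝔤, ⁅x, y⁆ = 0) : x = 0 := by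
  have := LieAlgebra.center_eq_bot ℝ 𝔤
  have hx : x ∈ LieAlgebra.center ℝ 𝔤 := (LieModule.mem_maxTrivSubmodule ℝ 𝔤 𝔤 x).mpr fun y => by
    rw [← lie_skew, h, neg_zero]
  rw [this] at hx
  simpa using hx

/-- An induction principle along the root space decomposition. Only the first member of a weight
pair is tested, since `IsWeightPair.rotate` makes the second one a first member. -/
theorem lie_eq_zero_of_span [FiniteDimensional ℝ 𝔤] (hB : IsBasicInnerProduct B j)
    (hj : IsMaximalAbelian j) {p : 𝔤 → Prop} (h0 : p 0) (hadd : ∀ x y, p x → p y → p (x + y))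
    (hsmul : ∀ (c : ℝ) x, p x → p (c • x)) (ht : ∀ h, p (j h))
    (hr : ∀ a ∈ realRoots j, ∀ x y, IsWeightPair j a x y → p x) (x : 𝔤) : p x := by
  have hx : x ∈ Submodule.span ℝ
      (Set.range j ∪ {x | ∃ a ∈ realRoots j, ∃ y, IsWeightPair j a x y}) := by
    rw [span_torus_union_root_vectors hB hj]; trivial
  induction hx using Submodule.span_induction with
  | mem x hx =>
    rcases hx with ⟨h, rfl⟩ | ⟨a, ha, y, hp⟩
    · exact ht h
    · exact hr a ha x y hp
  | zero => exact h0
  | add x y _ _ hx hy => exact hadd x y hx hy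
  | smul c x _ hx => exact hsmul c x hx

/-- A vector orthogonal to all roots is central, hence zero. -/
theorem span_realRoots [LieAlgebra.IsSimple ℝ 𝔤] [FiniteDimensional ℝ 𝔤] (hB : IsBasicInnerProduct B j)
    (hj : IsMaximalAbelian j) : Submodule.span ℝ (realRoots j) = ⊤ := by
  rw [← Submodule.orthogonal_eq_bot_iff, Submodule.eq_bot_iff]
  intro h hh
  have hh' : ∀ a ∈ realRoots j, ⟪a, h⟫ = 0 := fun a ha =>
    (Submodule.mem_orthogonal _ h).mp hh a (Submodule.subset_span ha)
  refine hB.injective ((eq_zero_of_central fun x => ?_).trans (map_zero j).symm)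
  refine lie_eq_zero_of_span hB hj (p := fun x => ⁅j h, x⁆ = 0) (lie_zero _)
    (fun x y hx hy => by rw [lie_add, hx, hy, add_zero])
    (fun c x hx => by rw [lie_smul, hx, smul_zero]) (fun h' => lie_torus hj h h')
    (fun a ha x y hp => ?_) x
  rw [(hp h).1, hh' a ha]
  simp

/-- The root vectors of `Φ'` generate an ideal that commutes with the root vectors of the other
roots. By simplicity the ideal is all of `𝔤`, so a root outside `Φ'` would have a nonzero central
root vector. -/
theorem irreducible_realRoots [LieAlgebra.IsSimple ℝ 𝔤] [FiniteDimensional ℝ 𝔤] (hB : IsBasicInnerProduct B j)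
    (hj : IsMaximalAbelian j) (Φ' : Set 𝔱) (hsub : Φ' ⊆ realRoots j) (hne : Φ'.Nonempty)
    (horth : ∀ a ∈ Φ', ∀ b ∈ realRoots j, b ∉ Φ' → ⟪a, b⟫ = 0) : Φ' = realRoots j := by
  refine hsub.antisymm fun c hc => ?_
  by_contra hcΦ
  set s : Set 𝔤 := {x | ∃ a ∈ Φ', ∃ y, IsWeightPair j a x y} with hs
  -- brackets between the two families of root vectors vanish
  have hnot : ∀ a ∈ Φ', ∀ b ∈ realRoots j, b ∉ Φ' → a + b ≠ 0 ∧ a + b ∉ realRoots j := by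
    intro a ha b hb hb'
    have hab := horth a ha b hb hb'
    have haa : ⟪a, a⟫ ≠ 0 := inner_self_ne_zero.mpr (hsub ha).1
    have hbb : ⟪b, b⟫ ≠ 0 := inner_self_ne_zero.mpr hb.1
    refine ⟨fun h => haa ?_, fun h => ?_⟩
    · have : ⟪a, a + b⟫ = 0 := by rw [h, inner_zero_right]
      rwa [inner_add_right, hab, add_zero] at this
    · by_cases h' : a + b ∈ Φ'
      · have := horth _ h' b hb hb'
        rw [inner_add_left, hab, zero_add] at this
        exact hbb this
      · have := horth a ha _ h h'
        rw [inner_add_right, hab, add_zero] at this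
        exact haa this
  have hzero : ∀ a ∈ Φ', ∀ b ∈ realRoots j, b ∉ Φ' → ∀ x y u v, IsWeightPair j a x y →
      IsWeightPair j b u v → ⁅x, u⁆ - ⁅y, v⁆ = 0 := by
    intro a ha b hb hb' x y u v hp hq
    by_contra hcon
    have h := hnot a ha b hb hb'
    exact h.2 ((hp.lie hq).mem_realRoots h.1 (Or.inl hcon))
  have hnegroot : ∀ b ∈ realRoots j, b ∉ Φ' → -b ∈ realRoots j ∧ -b ∉ Φ' := by
    intro b hb hb'
    have h1 : -b ∈ realRoots j := by
      have := refl_mem_realRoots hB hj hb hb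
      rwa [refl_self hb.1] at this
    refine ⟨h1, fun h2 => ?_⟩
    have := horth _ h2 b hb hb'
    rw [inner_neg_left, neg_eq_zero] at this
    exact hb.1 (inner_self_eq_zero.mp this)
  have hcomm : ∀ a ∈ Φ', ∀ b ∈ realRoots j, b ∉ Φ' → ∀ x y u v, IsWeightPair j a x y →
      IsWeightPair j b u v → ⁅x, u⁆ = 0 := by
    intro a ha b hb hb' x y u v hp hq
    have h1 := hzero a ha b hb hb' x y u v hp hq
    have h2 := hzero a ha (-b) (hnegroot b hb hb').1 (hnegroot b hb hb').2 x y u (-v) hp hq.conj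
    rw [lie_neg, sub_neg_eq_add] at h2
    have h3 : (2 : ℝ) • ⁅x, u⁆ = 0 := by
      rw [two_smul]
      calc _ = (⁅x, u⁆ - ⁅y, v⁆) + (⁅x, u⁆ + ⁅y, v⁆) := by abel
        _ = 0 := by rw [h1, h2, add_zero]
    exact (smul_eq_zero.mp h3).resolve_left two_ne_zero
  -- the subalgebra generated by `s` is an ideal
  let M := LieSubalgebra.lieSpan ℝ 𝔤 s
  have hM : ∀ z m : 𝔤, m ∈ M → ⁅z, m⁆ ∈ M := by
    intro z
    have hgen : ∀ m ∈ s, ⁅z, m⁆ ∈ M := by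
      rintro m ⟨a, ha, y, hp⟩
      refine lie_eq_zero_of_span hB hj (p := fun z => ⁅z, m⁆ ∈ M) (by simp)
        (fun x y hx hy => by rw [add_lie]; exact M.add_mem hx hy)
        (fun c x hx => by rw [smul_lie]; exact M.smul_mem c hx) (fun h => ?_)
        (fun b hb u v hq => ?_) z
      · rw [(hp h).1]
        exact M.neg_mem (M.smul_mem _ (LieSubalgebra.subset_lieSpan ⟨a, ha, _, hp.rotate⟩))
      · by_cases hb' : b ∈ Φ'
        · exact M.lie_mem (LieSubalgebra.subset_lieSpan ⟨b, hb', v, hq⟩)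
            (LieSubalgebra.subset_lieSpan ⟨a, ha, y, hp⟩)
        · rw [← lie_skew, hcomm a ha b hb hb' m y u v hp hq, neg_zero]
          exact M.zero_mem
    intro m hm
    induction hm using LieSubalgebra.lieSpan_induction with
    | mem x h => exact hgen x h
    | zero => rw [lie_zero]; exact M.zero_mem
    | add x y _ _ hx hy => rw [lie_add]; exact M.add_mem hx hy
    | smul c x _ hx => rw [lie_smul]; exact M.smul_mem c hx
    | lie x y hx' hy' hx hy =>
      rw [leibniz_lie]
      exact M.add_mem (M.lie_mem hx hy') (M.lie_mem hx' hy)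
  let I : LieIdeal ℝ 𝔤 := { M.toSubmodule with lie_mem := fun {z m} hm => hM z m hm }
  obtain ⟨a, ha⟩ := hne
  obtain ⟨h0, x, y, hx, hy, hp⟩ := exists_weightPair (hsub ha)
  have hI : I = ⊤ := by
    refine (LieAlgebra.IsSimple.eq_bot_or_eq_top I).resolve_left fun hbot => hx ?_
    have : x ∈ I := (LieSubalgebra.subset_lieSpan ⟨a, ha, y, hp⟩ : x ∈ M)
    rw [hbot] at this
    simpa using this
  obtain ⟨c0, u, v, hu, hv, hq⟩ := exists_weightPair hc
  refine hu (eq_zero_of_central fun z => ?_)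
  have hz : z ∈ M := by
    have : z ∈ I := by rw [hI]; trivial
    exact this
  induction hz using LieSubalgebra.lieSpan_induction with
  | mem x h =>
    obtain ⟨a, ha, y, hp⟩ := h
    rw [← lie_skew, hcomm a ha c hc hcΦ x y u v hp hq, neg_zero]
  | zero => exact lie_zero u
  | add x y _ _ hx hy => rw [lie_add, hx, hy, add_zero]
  | smul r x _ hx => rw [lie_smul, hx, smul_zero]
  | lie x y _ _ hx hy => rw [leibniz_lie, hx, hy, zero_lie, lie_zero, add_zero]

theorem isRootSet_realRoots [LieAlgebra.IsSimple ℝ 𝔤] [FiniteDimensional ℝ 𝔤] (hB : IsBasicInnerProduct B j)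
    (hj : IsMaximalAbelian j) : IsRootSet (realRoots j) where
  finite := finite_realRoots j
  span := span_realRoots hB hj
  ne_zero _ ha := ha.1
  refl_mem _ ha _ hb := refl_mem_realRoots hB hj ha hb
  integral _ ha _ hb := integral_realRoots hB hj ha hb
  reduced _ ha := reduced_realRoots hB hj ha
  irreducible := irreducible_realRoots hB hj
end RootVectors

/-! ## Combinatorics of the affine Weyl group -/

section AffineWeyl

variable {𝔱 : Type*} [NormedAddCommGroup 𝔱] [InnerProductSpace ℝ 𝔱]

open scoped RealInnerProductSpace

theorem inner_coroot (a x : 𝔱) : ⟪x, coroot a⟫ = 2 * ⟪x, a⟫ / ⟪a, a⟫ := by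
  rw [coroot, inner_smul_right]; ring

theorem reflection_eq_refl (a x : 𝔱) : (ℝ ∙ a)ᗮ.reflection x = refl a x := by
  rw [Submodule.reflection_orthogonal_apply, Submodule.reflection_singleton_apply, refl,
    inner_coroot, real_inner_self_eq_norm_sq, real_inner_comm]
  simp only [RCLike.ofReal_real_eq_id, id_eq]
  module

theorem coroot_map (w : 𝔱 ≃ₗᵢ[ℝ] 𝔱) (a : 𝔱) : coroot (w a) = w (coroot a) := by
  rw [coroot, coroot, LinearIsometryEquiv.inner_map_map, map_smul]

theorem refl_map (w : 𝔱 ≃ₗᵢ[ℝ] 𝔱) (a x : 𝔱) : refl (w a) (w x) = w (refl a x) := by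
  rw [refl, coroot_map, LinearIsometryEquiv.inner_map_map, refl, map_sub, map_smul]

/-- A root system with a positive system and its highest root, in the basic normalization. -/
structure IsBasedRootSet (Φ P : Set 𝔱) (a₀ : 𝔱) : Prop extends IsRootSet Φ where
  positive : IsPositiveSystem Φ P
  highest : IsHighestRoot Φ P a₀
  normalized : ∀ a ∈ Φ, (∀ b ∈ Φ, ‖b‖ ≤ ‖a‖) → ⟪coroot a, coroot a⟫ = 2

variable {Φ P : Set 𝔱} {a₀ : 𝔱}

namespace IsRootSet

theorem neg_mem (h : IsRootSet Φ) {a : 𝔱} (ha : a ∈ Φ) : -a ∈ Φ := by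
  have := h.refl_mem a ha a ha
  rwa [refl_self (h.ne_zero a ha)] at this

theorem inner_self_pos (h : IsRootSet Φ) {a : 𝔱} (ha : a ∈ Φ) : 0 < ⟪a, a⟫ :=
  real_inner_self_pos.mpr (h.ne_zero a ha)

theorem map_mem (h : IsRootSet Φ) (w : weylGroup Φ) : ∀ {a : 𝔱}, a ∈ Φ → w.1 a ∈ Φ := by
  obtain ⟨w, hw⟩ := w
  induction hw using Subgroup.closure_induction with
  | mem x hx =>
    obtain ⟨b, hb, rfl⟩ := hx
    intro a ha
    simp only [reflection_eq_refl]
    exact h.refl_mem b hb a ha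
  | one => exact fun ha => ha
  | mul x y _ _ hx hy => exact fun ha => hx (hy ha)
  | inv x _ hx =>
    intro a ha
    -- An injective self-map of the finite set `Φ` is onto, which gives stability under inverses.
    have hinj : Set.InjOn x Φ := x.injective.injOn
    have hmaps : Set.MapsTo x Φ Φ := fun _ hb => hx hb
    obtain ⟨b, hb, rfl⟩ := (Set.Finite.surjOn_iff_bijOn_of_mapsTo h.finite hmaps |>.mpr
      ((h.finite.injOn_iff_bijOn_of_mapsTo hmaps).mp hinj)) ha
    change x.symm (x b) ∈ Φ
    rwa [x.symm_apply_apply]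

/-- The element of the Weyl group given by a root. -/
def reflection {a : 𝔱} (ha : a ∈ Φ) : weylGroup Φ :=
  ⟨(ℝ ∙ a)ᗮ.reflection, Subgroup.subset_closure ⟨a, ha, rfl⟩⟩

theorem reflection_apply {a : 𝔱} (ha : a ∈ Φ) (x : 𝔱) : (reflection ha).1 x = refl a x :=
  reflection_eq_refl a x

theorem finite_weylGroup (h : IsRootSet Φ) : Finite (weylGroup Φ) := by
  have := h.finite.to_subtype
  refine Finite.of_injective
    (fun w : weylGroup Φ => fun a : Φ => (⟨w.1 a, h.map_mem w a.2⟩ : Φ)) fun w w' hww => ?_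
  apply Subtype.ext
  apply LinearIsometryEquiv.toLinearEquiv_injective
  apply LinearEquiv.toLinearMap_injective
  refine LinearMap.ext_on h.span fun a ha => ?_
  exact congrArg Subtype.val (congrFun hww ⟨a, ha⟩)

end IsRootSet

theorem weylSign_mul (w w' : weylGroup Φ) : weylSign (w * w') = weylSign w * weylSign w' := by
  have : (((w * w' : weylGroup Φ) : 𝔱 ≃ₗᵢ[ℝ] 𝔱).toLinearEquiv : 𝔱 →ₗ[ℝ] 𝔱) =
    ((w : 𝔱 ≃ₗᵢ[ℝ] 𝔱).toLinearEquiv : 𝔱 →ₗ[ℝ] 𝔱) ∘ₗ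
      ((w' : 𝔱 ≃ₗᵢ[ℝ] 𝔱).toLinearEquiv : 𝔱 →ₗ[ℝ] 𝔱) := rfl
  rw [weylSign, this, LinearMap.det_comp]
  simp [weylSign]

theorem weylSign_one : weylSign (1 : weylGroup Φ) = 1 := by
  have : (((1 : weylGroup Φ) : 𝔱 ≃ₗᵢ[ℝ] 𝔱).toLinearEquiv : 𝔱 →ₗ[ℝ] 𝔱) = LinearMap.id := rfl
  rw [weylSign, this, LinearMap.det_id]
  simp

theorem weylSign_reflection [FiniteDimensional ℝ 𝔱] (h : IsRootSet Φ) {a : 𝔱} (ha : a ∈ Φ) :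
    weylSign (IsRootSet.reflection ha) = -1 := by
  have h1 : LinearMap.det (((IsRootSet.reflection ha).1 : 𝔱 ≃ₗᵢ[ℝ] 𝔱).toLinearEquiv : 𝔱 →ₗ[ℝ] 𝔱) =
      (-1 : ℝ) := by
    have := (ℝ ∙ a)ᗮ.det_reflection
    rw [Submodule.orthogonal_orthogonal, finrank_span_singleton (h.ne_zero a ha), pow_one] at this
    exact this
  rw [weylSign, h1]
  simp

theorem weylGroup_induction {p : weylGroup Φ → Prop}
    (hr : ∀ (a : 𝔱) (ha : a ∈ Φ), p (IsRootSet.reflection ha)) (h1 : p 1)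
    (hm : ∀ w w', p w → p w' → p (w * w')) (hi : ∀ w, p w → p w⁻¹) (w : weylGroup Φ) : p w := by
  obtain ⟨w, hw⟩ := w
  induction hw using Subgroup.closure_induction with
  | mem x hx =>
    obtain ⟨b, hb, rfl⟩ := hx
    exact hr b hb
  | one => exact h1
  | mul x y hx' hy' hx hy => exact hm ⟨x, hx'⟩ ⟨y, hy'⟩ hx hy
  | inv x hx' hx => exact hi ⟨x, hx'⟩ hx

theorem weylSign_mul_self [FiniteDimensional ℝ 𝔱] (h : IsRootSet Φ) (w : weylGroup Φ) :
    weylSign w * weylSign w = 1 := by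
  induction w using weylGroup_induction with
  | hr a ha => rw [weylSign_reflection h ha]; norm_num
  | h1 => rw [weylSign_one, one_mul]
  | hm w w' hw hw' => rw [weylSign_mul, mul_mul_mul_comm, hw, hw', one_mul]
  | hi w hw =>
    have h2 := weylSign_mul w w⁻¹
    rw [mul_inv_cancel, weylSign_one] at h2
    calc weylSign w⁻¹ * weylSign w⁻¹ = (weylSign w * weylSign w⁻¹) * (weylSign w * weylSign w⁻¹) := by
          rw [mul_mul_mul_comm, hw, one_mul]
      _ = 1 := by rw [← h2, one_mul]

theorem weylSign_inv [FiniteDimensional ℝ 𝔱] (h : IsRootSet Φ) (w : weylGroup Φ) :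
    weylSign w⁻¹ = weylSign w := by
  have h1 := weylSign_mul w w⁻¹
  rw [mul_inv_cancel, weylSign_one] at h1
  have h2 := weylSign_mul_self h w
  have hne : weylSign w ≠ 0 := fun h => by simp [h] at h2
  exact mul_left_cancel₀ hne (h1.symm.trans h2.symm)


/-- The cone condition: nonnegative on positive roots implies nonnegative on their sums. -/
theorem inner_nonneg_of_mem_closure {S : Set 𝔱} {x c : 𝔱} (hx : ∀ a ∈ S, 0 ≤ ⟪a, x⟫)
    (hc : c ∈ AddSubmonoid.closure S) : 0 ≤ ⟪c, x⟫ := by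
  induction hc using AddSubmonoid.closure_induction with
  | mem a ha => exact hx a ha
  | zero => rw [inner_zero_left]
  | add a b _ _ ha hb => rw [inner_add_left]; exact add_nonneg ha hb

/-! ### The highest root, its Weyl orbit and the basic normalization. -/

namespace IsBasedRootSet

/-- Collects what a defining vector `v` of the positive system provides. The last clause says that
the cone generated by the positive roots is pointed. -/
theorem exists_vector (h : IsBasedRootSet Φ P a₀) : ∃ v : 𝔱, (∀ a ∈ P, 0 < ⟪a, v⟫) ∧
    (∀ a ∈ P, a ∈ Φ) ∧ (∀ a ∈ Φ, a ∈ P ∨ -a ∈ P) ∧ (∀ a ∈ Φ, 0 < ⟪a, v⟫ → a ∈ P) ∧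
    (∀ c ∈ AddSubmonoid.closure P, ⟪c, v⟫ ≤ 0 → c = 0) := by
  obtain ⟨v, hv, rfl⟩ := h.positive
  refine ⟨v, fun a ha => ha.2, fun a ha => ha.1, fun a ha => ?_, fun a ha h => ⟨ha, h⟩,
    fun c hc => ?_⟩
  · rcases lt_or_gt_of_ne (hv a ha) with h1 | h1
    · exact Or.inr ⟨h.neg_mem ha, by rw [inner_neg_left]; linarith⟩
    · exact Or.inl ⟨ha, h1⟩
  · induction hc using AddSubmonoid.closure_induction with
    | mem a ha => exact fun h => absurd ha.2 (not_lt.mpr h)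
    | zero => exact fun _ => rfl
    | add a b hac hbc ha hb =>
      intro hab
      have n1 := inner_nonneg_of_mem_closure (x := v) (fun a ha => ha.2.le) hac
      have n2 := inner_nonneg_of_mem_closure (x := v) (fun a ha => ha.2.le) hbc
      rw [inner_add_left] at hab
      rw [ha (by linarith), hb (by linarith), add_zero]

theorem pos_mem (h : IsBasedRootSet Φ P a₀) {a : 𝔱} (ha : a ∈ P) : a ∈ Φ := by
  obtain ⟨v, -, h1, -⟩ := h.exists_vector
  exact h1 a ha

theorem highest_mem (h : IsBasedRootSet Φ P a₀) : a₀ ∈ P := by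
  obtain ⟨v, h1, h2, h3, h4, h5⟩ := h.exists_vector
  refine (h3 a₀ h.highest.1).resolve_right fun hneg => ?_
  have h6 := h.highest.2 (-a₀) (h2 _ hneg)
  have h7 := inner_nonneg_of_mem_closure (fun a ha => (h1 a ha).le) h6
  have h8 := h1 _ hneg
  rw [inner_sub_left] at h7
  rw [inner_neg_left] at h7 h8
  linarith

/-- The difference between `a₀` and its reflection in `b` is a multiple of `b` and a sum of positive
roots, so the multiple is nonnegative. -/
theorem highest_dominant (h : IsBasedRootSet Φ P a₀) {b : 𝔱} (hb : b ∈ P) : 0 ≤ ⟪b, a₀⟫ := by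
  obtain ⟨v, h1, h2, h3, h4, h5⟩ := h.exists_vector
  have hbΦ := h2 b hb
  have h6 := h.highest.2 _ (h.refl_mem b hbΦ a₀ h.highest.1)
  have h7 := inner_nonneg_of_mem_closure (fun a ha => (h1 a ha).le) h6
  rw [refl, sub_sub_cancel, inner_smul_left, inner_coroot, RCLike.conj_to_real] at h7
  have h8 := h1 b hb
  have h9 := h.inner_self_pos hbΦ
  rw [real_inner_comm]
  by_contra hcon
  have : 2 * ⟪a₀, b⟫ / ⟪b, b⟫ < 0 := div_neg_of_neg_of_pos (by linarith) h9
  nlinarith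

/-- A positive root other than the highest root pairs to `0` or `1` with its coroot. -/
theorem inner_highest_coroot (h : IsBasedRootSet Φ P a₀) {b : 𝔱} (hb : b ∈ P) (hne : b ≠ a₀) :
    ⟪b, coroot a₀⟫ = 0 ∨ ⟪b, coroot a₀⟫ = 1 := by
  obtain ⟨v, h1, h2, h3, h4, h5⟩ := h.exists_vector
  have hbΦ := h2 b hb
  have ha₀ := h.highest.1
  obtain ⟨m, hm⟩ := h.integral a₀ ha₀ b hbΦ
  have hm0 : 0 ≤ m := by
    have : (0 : ℝ) ≤ m := by
      rw [← hm, inner_coroot]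
      exact div_nonneg (mul_nonneg zero_le_two (h.highest_dominant hb)) (h.inner_self_pos ha₀).le
    exact_mod_cast this
  have hm1 : m ≤ 1 := by
    by_contra hcon
    have hm2 : (2 : ℝ) ≤ m := by exact_mod_cast not_le.mp hcon
    -- Both `a₀ - b` and `a₀ + refl a₀ b` are sums of positive roots, and they add up to `(2 - m)
    -- a₀`. So `m ≥ 2` forces `m = 2`; the second sum is then `b - a₀`, and pointedness of the cone
    -- gives `b = a₀`.
    have c1 := h.highest.2 b hbΦ
    have c2 := h.highest.2 _ (h.neg_mem (h.refl_mem a₀ ha₀ b hbΦ))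
    have h6 := add_mem c1 c2
    have h7 := inner_nonneg_of_mem_closure (fun a ha => (h1 a ha).le) h6
    have h8 := inner_nonneg_of_mem_closure (fun a ha => (h1 a ha).le) c2
    have e1 : a₀ - b + (a₀ - -refl a₀ b) = (2 - (m : ℝ)) • a₀ := by
      rw [refl, hm]; module
    have hpos := h1 a₀ h.highest_mem
    rw [e1, inner_smul_left, RCLike.conj_to_real] at h7
    have hm3 : (m : ℝ) = 2 := by nlinarith
    have e2 : a₀ - -refl a₀ b = b - a₀ := by rw [refl, hm, hm3]; module
    rw [e2] at h8
    have := h5 _ c1 (by rw [inner_sub_left] at h8 ⊢; linarith)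
    exact hne (sub_eq_zero.mp this).symm
  rw [hm]
  interval_cases m <;> simp

/-- Consider the roots in the double orthogonal of the orbit of `a₀`. If `b` is not among them, some
`x` orthogonal to the orbit has `⟪x, b⟫ ≠ 0`; as the reflection in `b` preserves the orbit, `b` must
be orthogonal to the orbit. Irreducibility then puts every root in the double orthogonal, where
orthogonality to the orbit implies being zero. -/
theorem exists_orbit_inner_ne_zero (h : IsBasedRootSet Φ P a₀) {b : 𝔱} (hb : b ∈ Φ) :
    ∃ w : weylGroup Φ, ⟪b, w.1 a₀⟫ ≠ 0 := by
  set Φ' := {b | b ∈ Φ ∧ ∀ x, (∀ w : weylGroup Φ, ⟪x, w.1 a₀⟫ = 0) → ⟪x, b⟫ = 0} with hΦ'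
  have ha₀ : a₀ ∈ Φ' := ⟨h.highest.1, fun x hx => hx 1⟩
  have := h.irreducible Φ' (fun b hb => hb.1) ⟨a₀, ha₀⟩ fun a ha b hb hb' => by
    have : ∃ x, (∀ w : weylGroup Φ, ⟪x, w.1 a₀⟫ = 0) ∧ ⟪x, b⟫ ≠ 0 := by
      by_contra! hcon
      exact hb' ⟨hb, hcon⟩
    obtain ⟨x, hx, hxb⟩ := this
    rw [real_inner_comm]
    refine ha.2 b fun w => ?_
    have h1 := hx (IsRootSet.reflection hb * w)
    change ⟪x, (IsRootSet.reflection hb).1 (w.1 a₀)⟫ = 0 at h1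
    rw [IsRootSet.reflection_apply, refl, inner_sub_right, hx w, inner_smul_right, zero_sub,
      neg_eq_zero] at h1
    have h2 := (mul_eq_zero.mp h1).resolve_right hxb
    rw [inner_coroot, div_eq_zero_iff] at h2
    have h3 := h2.resolve_right (h.inner_self_pos hb).ne'
    rw [real_inner_comm]
    linarith
  rw [← this] at hb
  by_contra! hcon
  exact h.ne_zero b hb.1 (inner_self_eq_zero.mp (hb.2 b hcon))

/-- Every root is, up to sign, a Weyl conjugate `c` of the highest root, or pairs to `±1` with the
coroot of such a conjugate. -/
theorem exists_orbit (h : IsBasedRootSet Φ P a₀) {b : 𝔱} (hb : b ∈ Φ) :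
    ∃ w : weylGroup Φ, (b = w.1 a₀ ∨ b = -w.1 a₀) ∨
      (⟪b, coroot (w.1 a₀)⟫ = 1 ∨ ⟪b, coroot (w.1 a₀)⟫ = -1) := by
  obtain ⟨v, h1, h2, h3, h4, h5⟩ := h.exists_vector
  obtain ⟨w, hw⟩ := h.exists_orbit_inner_ne_zero hb
  refine ⟨w, ?_⟩
  have hb' : (w⁻¹).1 b ∈ Φ := h.map_mem w⁻¹ hb
  have e1 : w.1 ((w⁻¹).1 b) = b := w.1.apply_symm_apply b
  set b' := (w⁻¹).1 b with hbdef
  rw [← e1, LinearIsometryEquiv.inner_map_map] at hw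
  rw [← e1, coroot_map, LinearIsometryEquiv.inner_map_map, ← map_neg, w.1.injective.eq_iff,
    w.1.injective.eq_iff]
  have hne : ⟪b', coroot a₀⟫ ≠ 0 := by
    rw [inner_coroot]
    exact div_ne_zero (mul_ne_zero two_ne_zero hw) (h.inner_self_pos h.highest.1).ne'
  rcases h3 b' hb' with hp | hp
  · by_cases he : b' = a₀
    · exact Or.inl (Or.inl he)
    · exact Or.inr (Or.inl ((h.inner_highest_coroot hp he).resolve_left hne))
  · by_cases he : -b' = a₀
    · exact Or.inl (Or.inr (neg_eq_iff_eq_neg.mp he))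
    · have := h.inner_highest_coroot hp he
      rw [inner_neg_left] at this
      exact Or.inr (Or.inr (by
        rcases this with h | h
        · exact absurd (neg_eq_zero.mp h) hne
        · linarith))

theorem inner_orbit (_h : IsBasedRootSet Φ P a₀) (w : weylGroup Φ) :
    ⟪w.1 a₀, w.1 a₀⟫ = ⟪a₀, a₀⟫ := LinearIsometryEquiv.inner_map_map _ _ _

/-- If `b` pairs to `±1` with the coroot of a conjugate `c` of `a₀`, then `2⟪b, c⟫ = ±⟪c, c⟫`, and
the integer pairing of `c` with the coroot of `b` is up to sign the ratio of square lengths. In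
particular `a₀` is a long root. -/
theorem exists_ratio (h : IsBasedRootSet Φ P a₀) {b : 𝔱} (hb : b ∈ Φ) :
    ∃ m : ℤ, 0 < m ∧ ⟪a₀, a₀⟫ = m * ⟪b, b⟫ := by
  obtain ⟨w, hw⟩ := h.exists_orbit hb
  have hc := h.map_mem w h.highest.1
  have hcc := h.inner_orbit w
  have hbb := h.inner_self_pos hb
  have h00 := h.inner_self_pos h.highest.1
  rcases hw with (rfl | rfl) | hw
  · exact ⟨1, one_pos, by rw [hcc]; simp⟩
  · exact ⟨1, one_pos, by rw [inner_neg_neg, hcc]; simp⟩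
  · obtain ⟨m, hm⟩ := h.integral b hb _ hc
    rw [inner_coroot, div_eq_iff hbb.ne'] at hm
    rw [inner_coroot, div_eq_iff (by rw [hcc]; exact h00.ne'),
      div_eq_iff (by rw [hcc]; exact h00.ne'), real_inner_comm, hcc] at hw
    rcases hw with hw | hw
    · refine ⟨m, ?_, by linarith⟩
      have : 0 < (m : ℝ) := by
        by_contra hcon
        nlinarith
      exact_mod_cast this
    · refine ⟨-m, ?_, by push_cast; linarith⟩
      have : (m : ℝ) < 0 := by
        by_contra hcon
        nlinarith
      have : m < 0 := by exact_mod_cast this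
      omega

theorem inner_highest_self (h : IsBasedRootSet Φ P a₀) : ⟪a₀, a₀⟫ = 2 := by
  have h1 := h.normalized a₀ h.highest.1 fun b hb => by
    obtain ⟨m, hm, he⟩ := h.exists_ratio hb
    have hm1 : (1 : ℝ) ≤ m := by exact_mod_cast hm
    have hbb := h.inner_self_pos hb
    have : ‖b‖ ^ 2 ≤ ‖a₀‖ ^ 2 := by
      rw [← real_inner_self_eq_norm_sq, ← real_inner_self_eq_norm_sq]
      nlinarith
    exact (sq_le_sq₀ (norm_nonneg _) (norm_nonneg _)).mp this
  have h2 := h.inner_self_pos h.highest.1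
  rw [inner_coroot, coroot, inner_smul_left, RCLike.conj_to_real] at h1
  field_simp at h1
  linarith

theorem coroot_highest (h : IsBasedRootSet Φ P a₀) : coroot a₀ = a₀ := by
  rw [coroot, h.inner_highest_self]; norm_num

theorem coroot_orbit (h : IsBasedRootSet Φ P a₀) (w : weylGroup Φ) :
    coroot (w.1 a₀) = w.1 a₀ := by
  rw [coroot_map, h.coroot_highest]

theorem coroot_eq (h : IsBasedRootSet Φ P a₀) {b : 𝔱} (hb : b ∈ Φ) :
    ∃ m : ℤ, 2 / ⟪b, b⟫ = m ∧ coroot b = m • b := by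
  obtain ⟨m, -, hm⟩ := h.exists_ratio hb
  have hbb := h.inner_self_pos hb
  rw [h.inner_highest_self] at hm
  have h2 : 2 / ⟪b, b⟫ = m := by rw [hm]; field_simp
  refine ⟨m, h2, ?_⟩
  rw [coroot, h2, Int.cast_smul_eq_zsmul]

/-! ### The integral lattice -/

theorem inner_lattice (h : IsBasedRootSet Φ P a₀) {b : 𝔱} (hb : b ∈ Φ) {l : 𝔱}
    (hl : l ∈ integralLattice Φ) : ∃ m : ℤ, ⟪b, l⟫ = m := by
  induction hl using Submodule.span_induction with
  | mem x hx =>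
    obtain ⟨a, ha, rfl⟩ := hx
    exact h.integral a ha b hb
  | zero => exact ⟨0, by simp⟩
  | add x y _ _ hx hy =>
    obtain ⟨m, hm⟩ := hx
    obtain ⟨m', hm'⟩ := hy
    exact ⟨m + m', by rw [inner_add_right, hm, hm']; push_cast; ring⟩
  | smul c x _ hx =>
    obtain ⟨m, hm⟩ := hx
    exact ⟨c * m, by
      rw [← Int.cast_smul_eq_zsmul ℝ c, inner_smul_right, hm]; push_cast; ring⟩

theorem lattice_integral (h : IsBasedRootSet Φ P a₀) {l l' : 𝔱}
    (hl : l ∈ integralLattice Φ) (hl' : l' ∈ integralLattice Φ) : ∃ m : ℤ, ⟪l, l'⟫ = m := by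
  induction hl using Submodule.span_induction with
  | mem x hx =>
    obtain ⟨a, ha, rfl⟩ := hx
    obtain ⟨m, -, hm⟩ := h.coroot_eq ha
    obtain ⟨m', hm'⟩ := h.inner_lattice ha hl'
    exact ⟨m * m', by
      rw [hm, ← Int.cast_smul_eq_zsmul ℝ m, inner_smul_left, hm']; push_cast; simp⟩
  | zero => exact ⟨0, by simp⟩
  | add x y _ _ hx hy =>
    obtain ⟨m, hm⟩ := hx
    obtain ⟨m', hm'⟩ := hy
    exact ⟨m + m', by rw [inner_add_left, hm, hm']; push_cast; ring⟩
  | smul c x _ hx =>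
    obtain ⟨m, hm⟩ := hx
    exact ⟨c * m, by
      rw [← Int.cast_smul_eq_zsmul ℝ c, inner_smul_left, hm]; push_cast; simp⟩

/-- A coroot has square length `4 / ⟪b, b⟫`, which is `2` times the integer `2 / ⟪b, b⟫`; evenness
passes to sums because the lattice is integral. -/
theorem lattice_even (h : IsBasedRootSet Φ P a₀) {l : 𝔱}
    (hl : l ∈ integralLattice Φ) : ∃ m : ℤ, ⟪l, l⟫ = 2 * m := by
  induction hl using Submodule.span_induction with
  | mem x hx =>
    obtain ⟨a, ha, rfl⟩ := hx
    obtain ⟨m, hm, -⟩ := h.coroot_eq ha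
    refine ⟨m, ?_⟩
    have := h.inner_self_pos ha
    rw [← hm, coroot, inner_smul_left, inner_smul_right, RCLike.conj_to_real]
    field_simp
  | zero => exact ⟨0, by simp⟩
  | add x y hx' hy' hx hy =>
    obtain ⟨m, hm⟩ := hx
    obtain ⟨m', hm'⟩ := hy
    obtain ⟨c, hc⟩ := h.lattice_integral hx' hy'
    refine ⟨m + m' + c, ?_⟩
    rw [inner_add_left, inner_add_right, inner_add_right, hm, hm', real_inner_comm x y, hc]
    push_cast; ring
  | smul c x _ hx =>
    obtain ⟨m, hm⟩ := hx
    exact ⟨c * c * m, by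
      rw [← Int.cast_smul_eq_zsmul ℝ c, inner_smul_left, inner_smul_right, hm]
      push_cast; simp; ring⟩

theorem coroot_mem {b : 𝔱} (hb : b ∈ Φ) : coroot b ∈ integralLattice Φ :=
  Submodule.subset_span ⟨b, hb, rfl⟩

theorem map_lattice (h : IsBasedRootSet Φ P a₀) (w : weylGroup Φ) {l : 𝔱}
    (hl : l ∈ integralLattice Φ) : w.1 l ∈ integralLattice Φ := by
  induction hl using Submodule.span_induction with
  | mem x hx =>
    obtain ⟨a, ha, rfl⟩ := hx
    rw [← coroot_map]
    exact coroot_mem (h.map_mem w ha)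
  | zero => rw [map_zero]; exact zero_mem _
  | add x y _ _ hx hy => rw [map_add]; exact add_mem hx hy
  | smul c x _ hx => rw [map_zsmul]; exact Submodule.smul_mem _ c hx

end IsBasedRootSet
end AffineWeyl

/-! ## The alcove is a fundamental domain for the affine Weyl group -/

section Alcove

variable {𝔱 : Type*} [NormedAddCommGroup 𝔱] [InnerProductSpace ℝ 𝔱]

open scoped RealInnerProductSpace

variable {Φ P : Set 𝔱} {a₀ : 𝔱}

/-- Positive roots that are not sums of two positive roots. -/
def simpleRoots (P : Set 𝔱) : Set 𝔱 := {a | a ∈ P ∧ ∀ b ∈ P, ∀ c ∈ P, a ≠ b + c}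

namespace IsBasedRootSet

/-- A counterexample of least height `⟪b, v⟫` would be a sum of two positive roots of smaller
height. -/
theorem mem_closure_simpleRoots (h : IsBasedRootSet Φ P a₀) {b : 𝔱} (hb : b ∈ P) :
    b ∈ AddSubmonoid.closure (simpleRoots P) := by
  obtain ⟨v, h1, h2, h3, h4, h5⟩ := h.exists_vector
  by_contra hcon
  have hfin : {b | b ∈ P ∧ b ∉ AddSubmonoid.closure (simpleRoots P)}.Finite :=
    h.finite.subset fun b hb => h2 b hb.1
  obtain ⟨c, ⟨hc, hc'⟩, hmin⟩ := Set.exists_min_image _ (fun b => ⟪b, v⟫) hfin ⟨b, hb, hcon⟩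
  have hns : c ∉ simpleRoots P := fun hh => hc' (AddSubmonoid.subset_closure hh)
  obtain ⟨x, hx, y, hy, rfl⟩ : ∃ x ∈ P, ∃ y ∈ P, c = x + y := by
    by_contra! hcon
    exact hns ⟨hc, hcon⟩
  have hxv := h1 x hx
  have hyv := h1 y hy
  refine hc' (add_mem ?_ ?_)
  · by_contra hx'
    have := hmin x ⟨hx, hx'⟩
    rw [inner_add_left] at this
    linarith
  · by_contra hy'
    have := hmin y ⟨hy, hy'⟩
    rw [inner_add_left] at this
    linarith

/-- The difference of two simple roots is not a root. If the inner product were positive, both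
Cartan integers would be positive and different from `1`, hence at least `2`; this is the equality
case of Cauchy–Schwarz, so the roots are proportional, and equal by reducedness. -/
theorem simpleRoots_obtuse (h : IsBasedRootSet Φ P a₀) {a b : 𝔱} (ha : a ∈ simpleRoots P)
    (hb : b ∈ simpleRoots P) (hab : a ≠ b) : ⟪a, b⟫ ≤ 0 := by
  obtain ⟨v, h1, h2, h3, h4, h5⟩ := h.exists_vector
  have haΦ := h2 a ha.1
  have hbΦ := h2 b hb.1
  have haa := h.inner_self_pos haΦ
  have hbb := h.inner_self_pos hbΦ
  have hdiff : a - b ∉ Φ := fun hd => by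
    rcases h3 _ hd with hd | hd
    · exact ha.2 _ hd b hb.1 (by abel)
    · exact hb.2 _ hd a ha.1 (by abel)
  by_contra! hpos
  obtain ⟨p, hp⟩ := h.integral b hbΦ a haΦ
  obtain ⟨q, hq⟩ := h.integral a haΦ b hbΦ
  have hp1 : p ≠ 1 := fun h' => hdiff (by
    have := h.refl_mem b hbΦ a haΦ
    rwa [refl, hp, h', Int.cast_one, one_smul] at this)
  have hq1 : q ≠ 1 := fun h' => hdiff (by
    have := h.neg_mem (h.refl_mem a haΦ b hbΦ)
    rwa [refl, hq, h', Int.cast_one, one_smul, neg_sub] at this)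
  rw [inner_coroot] at hp hq
  rw [real_inner_comm] at hq
  have hp0 : 0 < p := by
    have : (0 : ℝ) < p := by rw [← hp]; positivity
    exact_mod_cast this
  have hq0 : 0 < q := by
    have : (0 : ℝ) < q := by rw [← hq]; positivity
    exact_mod_cast this
  have hp2 : (2 : ℝ) ≤ p := by exact_mod_cast (by omega : 2 ≤ p)
  have hq2 : (2 : ℝ) ≤ q := by exact_mod_cast (by omega : 2 ≤ q)
  rw [div_eq_iff (ne_of_gt (by assumption))] at hp hq
  have hd : ⟪⟪a, a⟫ • b - ⟪a, b⟫ • a, ⟪a, a⟫ • b - ⟪a, b⟫ • a⟫ =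
      ⟪a, a⟫ * (⟪a, a⟫ * ⟪b, b⟫ - ⟪a, b⟫ * ⟪a, b⟫) := by
    simp only [inner_sub_left, inner_sub_right, inner_smul_left, inner_smul_right,
      RCLike.conj_to_real, real_inner_comm a b]
    ring
  have hle : ⟪a, a⟫ * ⟪b, b⟫ ≤ ⟪a, b⟫ * ⟪a, b⟫ :=
    mul_le_mul (by nlinarith) (by nlinarith) hbb.le hpos.le
  have hd0 : ⟪a, a⟫ • b - ⟪a, b⟫ • a = 0 := by
    refine inner_self_eq_zero.mp (le_antisymm ?_ real_inner_self_nonneg)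
    rw [hd]
    nlinarith
  have hbc : b = (⟪a, b⟫ / ⟪a, a⟫) • a := by
    rw [div_eq_inv_mul, mul_smul, ← sub_eq_zero.mp hd0, smul_smul, inv_mul_cancel₀ haa.ne',
      one_smul]
  rcases h.reduced a haΦ _ (hbc ▸ hbΦ) with hc | hc
  · rw [hc, one_smul] at hbc
    exact hab hbc.symm
  · have : 0 < ⟪a, b⟫ / ⟪a, a⟫ := by positivity
    linarith

theorem exists_decomp {S : Set 𝔱} (a : 𝔱) {c : 𝔱} (hc : c ∈ AddSubmonoid.closure S) :
    ∃ (r : ℝ), ∃ c' ∈ AddSubmonoid.closure (S \ {a}), c = r • a + c' := by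
  induction hc using AddSubmonoid.closure_induction with
  | mem x hx =>
    by_cases he : x = a
    · exact ⟨1, 0, zero_mem _, by rw [he, one_smul, add_zero]⟩
    · exact ⟨0, x, AddSubmonoid.subset_closure ⟨hx, he⟩, by rw [zero_smul, zero_add]⟩
  | zero => exact ⟨0, 0, zero_mem _, by simp⟩
  | add x y _ _ hx hy =>
    obtain ⟨r, x', hx', rfl⟩ := hx
    obtain ⟨s, y', hy', rfl⟩ := hy
    exact ⟨r + s, x' + y', add_mem hx' hy', by module⟩

/-- A simple reflection permutes the other positive roots. -/
theorem refl_simple_mem (h : IsBasedRootSet Φ P a₀) {a b : 𝔱} (ha : a ∈ simpleRoots P)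
    (hb : b ∈ P) (hab : b ≠ a) : refl a b ∈ P := by
  obtain ⟨v, h1, h2, h3, h4, h5⟩ := h.exists_vector
  have haΦ := h2 a ha.1
  have hbΦ := h2 b hb
  have haa := h.inner_self_pos haΦ
  refine (h3 _ (h.refl_mem a haΦ b hbΦ)).resolve_right fun hneg => hab ?_
  obtain ⟨r, b', hb', eb⟩ := exists_decomp a (h.mem_closure_simpleRoots hb)
  obtain ⟨s, q, hq, eq⟩ := exists_decomp a (h.mem_closure_simpleRoots hneg)
  -- If `b` and minus its reflection are both positive, their parts away from `a` add up to a
  -- multiple of `a`. Pairing with `v` and with `-a` shows the multiple to be nonnegative and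
  -- nonpositive, so `b' = 0` and `b` is proportional to `a`.
  have hsum : b' + q = (⟪b, coroot a⟫ - r - s) • a := by
    have e1 : b' = b - r • a := by rw [eb]; abel_nf
    have e2 : q = -refl a b - s • a := by rw [eq]; abel_nf
    rw [e1, e2, refl]; module
  have hmem := add_mem hb' hq
  have n1 : 0 ≤ ⟪b' + q, v⟫ :=
    inner_nonneg_of_mem_closure (fun x hx => (h1 x hx.1.1).le) hmem
  have n2 : 0 ≤ ⟪b' + q, -a⟫ := inner_nonneg_of_mem_closure (fun x hx => by
    rw [inner_neg_right]
    have := h.simpleRoots_obtuse hx.1 ha hx.2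
    linarith) hmem
  have hav := h1 a ha.1
  rw [hsum, inner_smul_left, RCLike.conj_to_real] at n1 n2
  rw [inner_neg_right] at n2
  have n3 : ⟪b, coroot a⟫ - r - s = 0 := by
    refine le_antisymm ?_ ?_
    · by_contra! hcon; nlinarith
    · by_contra! hcon; nlinarith
  have hmono : AddSubmonoid.closure (simpleRoots P \ {a}) ≤ AddSubmonoid.closure P :=
    AddSubmonoid.closure_mono fun x hx => hx.1.1
  have hb0 : b' = 0 := by
    refine h5 b' (hmono hb') ?_
    have n4 := inner_nonneg_of_mem_closure (x := v) (fun x hx => (h1 x hx.1.1).le) hq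
    have n5 : ⟪b' + q, v⟫ = 0 := by rw [hsum, n3, zero_smul, inner_zero_left]
    rw [inner_add_left] at n5
    linarith
  rw [hb0, add_zero] at eb
  rcases h.reduced a haΦ r (eb ▸ hbΦ) with hr | hr
  · rw [eb, hr, one_smul]
  · have := h1 b hb
    rw [eb, hr, inner_smul_left, RCLike.conj_to_real] at this
    linarith

end IsBasedRootSet

/-! ### Affine reflections and the exchange condition. -/

/-- The affine reflection in the hyperplane `⟪a, x⟫ = m`. -/
def affRefl (p : 𝔱 × ℤ) (x : 𝔱) : 𝔱 := x - (⟪p.1, x⟫ - p.2) • coroot p.1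

theorem affRefl_eq (p : 𝔱 × ℤ) (x : 𝔱) : affRefl p x = refl p.1 x + p.2 • coroot p.1 := by
  have : ⟪p.1, x⟫ • coroot p.1 = ⟪x, coroot p.1⟫ • p.1 := by
    rw [inner_coroot, coroot, smul_smul, real_inner_comm]
    congr 1; ring
  rw [affRefl, refl, sub_smul, this, Int.cast_smul_eq_zsmul]
  abel

theorem affRefl_value {p : 𝔱 × ℤ} (hp : p.1 ≠ 0) (x : 𝔱) :
    ⟪p.1, affRefl p x⟫ - p.2 = -(⟪p.1, x⟫ - p.2) := by
  rw [affRefl, inner_sub_right, inner_smul_right, inner_self_coroot hp]; ring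

theorem affRefl_affRefl {p : 𝔱 × ℤ} (hp : p.1 ≠ 0) (x : 𝔱) : affRefl p (affRefl p x) = x := by
  have := affRefl_value hp x
  rw [affRefl, this, affRefl]
  module

theorem affRefl_neg (a : 𝔱) (m : ℤ) (x : 𝔱) : affRefl (-a, -m) x = affRefl (a, m) x := by
  have : coroot (-a) = -coroot a := by simp [coroot]
  simp only [affRefl, this, inner_neg_left]
  push_cast
  module

/-- Composition of the affine reflections in a list. -/
def affComp : List (𝔱 × ℤ) → 𝔱 → 𝔱
  | [], x => x
  | p :: L, x => affRefl p (affComp L x)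

theorem affComp_append (L L' : List (𝔱 × ℤ)) (x : 𝔱) :
    affComp (L ++ L') x = affComp L (affComp L' x) := by
  induction L with
  | nil => rfl
  | cons p L ih => simp [affComp, ih]

/-- Only the hyperplane of `p` separates `ρ` from its image under the reflection. -/
def IsWall (Φ : Set 𝔱) (ρ : 𝔱) (p : 𝔱 × ℤ) : Prop :=
  p.1 ∈ Φ ∧ ∀ a ∈ Φ, ∀ m : ℤ, (⟪a, ρ⟫ - m) * (⟪a, affRefl p ρ⟫ - m) < 0 →
    (a = p.1 ∧ m = p.2) ∨ (a = -p.1 ∧ m = -p.2)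

/-- The exchange condition. -/
theorem exchange (h : IsRootSet Φ) {ρ : 𝔱} (hρ : ∀ a ∈ Φ, ∀ m : ℤ, ⟪a, ρ⟫ ≠ m)
    (L : List (𝔱 × ℤ)) (hL : ∀ p ∈ L, IsWall Φ ρ p) :
    ∀ a ∈ Φ, ∀ m : ℤ, (⟪a, ρ⟫ - m) * (⟪a, affComp L ρ⟫ - m) < 0 →
      ∃ L' : List (𝔱 × ℤ), (∀ p ∈ L', IsWall Φ ρ p) ∧ L'.length < L.length ∧
        ∀ x, affComp L' x = affRefl (a, m) (affComp L x) := by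
  induction L with
  | nil =>
    intro a _ m hlt
    exact absurd (mul_self_nonneg _) (not_le.mpr hlt)
  | cons p L ih =>
    intro a ha m hlt
    have hp : IsWall Φ ρ p := hL p (by simp)
    have hL' : ∀ p ∈ L, IsWall Φ ρ p := fun q hq => hL q (by simp [hq])
    have hp0 := h.ne_zero _ hp.1
    by_cases hsep : (⟪a, ρ⟫ - m) * (⟪a, affRefl p ρ⟫ - m) < 0
    -- The outermost reflection already crosses the hyperplane. Being a wall reflection it crosses
    -- only its own, so the two reflections coincide and the letter is deleted.
    · refine ⟨L, hL', by simp, fun x => ?_⟩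
      rcases hp.2 a ha m hsep with ⟨rfl, rfl⟩ | ⟨rfl, rfl⟩
      · exact (affRefl_affRefl hp0 _).symm
      · rw [affRefl_neg]
        exact (affRefl_affRefl hp0 _).symm
    -- Otherwise the hyperplane is moved by the reflection of `p` to one that separates `ρ` from its
    -- image under the shorter word, and the deletion takes place there.
    · obtain ⟨c, hc⟩ := h.integral _ hp.1 a ha
      have hval : ∀ x, ⟪a, affRefl p x⟫ - m = ⟪refl p.1 a, x⟫ - (m - p.2 * c : ℤ) := fun x => by
        rw [affRefl_eq, inner_add_right, inner_refl, ← Int.cast_smul_eq_zsmul ℝ, inner_smul_right,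
          hc]
        push_cast; ring
      have ha' := h.refl_mem _ hp.1 a ha
      have hlt' : (⟪refl p.1 a, ρ⟫ - (m - p.2 * c : ℤ)) *
          (⟪refl p.1 a, affComp L ρ⟫ - (m - p.2 * c : ℤ)) < 0 := by
        rw [← hval, ← hval]
        change (⟪a, ρ⟫ - m) * (⟪a, affRefl p (affComp L ρ)⟫ - m) < 0 at hlt
        have h0 : ⟪a, ρ⟫ - m ≠ 0 := sub_ne_zero.mpr (hρ a ha m)
        have h1 : ⟪a, affRefl p ρ⟫ - m ≠ 0 := by
          rw [hval]; exact sub_ne_zero.mpr (hρ _ ha' _)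
        rcases lt_or_gt_of_ne h0 with h0 | h0 <;> rcases lt_or_gt_of_ne h1 with h1 | h1 <;>
          nlinarith [mul_pos_of_neg_of_neg (a := ⟪a, ρ⟫ - m) (b := ⟪a, affRefl p ρ⟫ - m)]
      obtain ⟨L₁, hw, hlen, hx⟩ := ih hL' _ ha' _ hlt'
      refine ⟨p :: L₁, fun q hq => ?_, by simpa using hlen, fun x => ?_⟩
      · rcases List.mem_cons.mp hq with rfl | hq
        · exact hp
        · exact hw q hq
      · change affRefl p (affComp L₁ x) = affRefl (a, m) (affRefl p (affComp L x))
        rw [hx]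
        have hco : coroot (refl p.1 a) = refl p.1 (coroot a) := by
          rw [← reflection_eq_refl, coroot_map, reflection_eq_refl]
        have hlin : ∀ (x y : 𝔱) (r : ℝ), affRefl p (x - r • y) = affRefl p x - r • refl p.1 y := by
          intro x y r
          simp only [affRefl_eq, refl, inner_sub_left, inner_smul_left, RCLike.conj_to_real]
          module
        have e1 : affRefl (refl p.1 a, m - p.2 * c) (affComp L x) =
          affComp L x - (⟪refl p.1 a, affComp L x⟫ - (m - p.2 * c : ℤ)) • coroot (refl p.1 a) := rfl
        rw [e1, hlin, ← hval, hco, refl_refl hp0]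
        rfl

/-- A product of wall reflections that maps one point of the alcove to another is the identity. -/
theorem affComp_eq_self (h : IsRootSet Φ) {ρ : 𝔱} (hρ : ∀ a ∈ Φ, ∀ m : ℤ, ⟪a, ρ⟫ ≠ m) (k : ℕ) :
    ∀ L : List (𝔱 × ℤ), L.length = k → (∀ p ∈ L, IsWall Φ ρ p) →
    (∀ a ∈ Φ, ∀ m : ℤ, 0 < (⟪a, ρ⟫ - m) * (⟪a, affComp L ρ⟫ - m)) → ∀ x, affComp L x = x := by
  induction k using Nat.strong_induction_on with
  | _ k ih =>
    intro L hk hL hpos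
    cases L with
    | nil => exact fun x => rfl
    | cons p L =>
      have hp : IsWall Φ ρ p := hL p (by simp)
      have hp0 := h.ne_zero _ hp.1
      -- The full word keeps `ρ` on its side of every hyperplane, so the word without its outermost
      -- letter crosses the hyperplane of that letter. Exchange then rewrites the full word as a
      -- strictly shorter one.
      have hsep : (⟪p.1, ρ⟫ - p.2) * (⟪p.1, affComp L ρ⟫ - p.2) < 0 := by
        have h1 := hpos p.1 hp.1 p.2
        change 0 < (⟪p.1, ρ⟫ - p.2) * (⟪p.1, affRefl p (affComp L ρ)⟫ - p.2) at h1
        rw [affRefl_value hp0] at h1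
        linarith
      obtain ⟨L', hw, hlen, hx⟩ := exchange h hρ L (fun q hq => hL q (by simp [hq])) _ hp.1 _ hsep
      have hx' : ∀ x, affComp L' x = affComp (p :: L) x := hx
      intro x
      rw [← hx']
      refine ih L'.length (by rw [← hk]; simp; omega) L' rfl hw (fun a ha m => ?_) x
      rw [hx']
      exact hpos a ha m

namespace IsBasedRootSet

theorem mem_alcove_bounds (h : IsBasedRootSet Φ P a₀) {x : 𝔱} (hx : x ∈ alcove P a₀) {a : 𝔱}
    (ha : a ∈ P) : 0 < ⟪a, x⟫ ∧ ⟪a, x⟫ < 1 := by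
  refine ⟨hx.1 a ha, lt_of_le_of_lt ?_ hx.2⟩
  have := inner_nonneg_of_mem_closure (fun a ha => (hx.1 a ha).le) (h.highest.2 a (h.pos_mem ha))
  rw [inner_sub_left] at this
  linarith

theorem pos_or_neg (h : IsBasedRootSet Φ P a₀) {a : 𝔱} (ha : a ∈ Φ) : a ∈ P ∨ -a ∈ P := by
  obtain ⟨v, -, -, h3, -⟩ := h.exists_vector
  exact h3 a ha

theorem same_side {s t : ℝ} (hs : 0 < s ∧ s < 1) (ht : 0 < t ∧ t < 1) (m : ℤ) :
    0 < (s - m) * (t - m) := by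
  rcases le_or_gt m 0 with hm | hm
  · have : (m : ℝ) ≤ 0 := by exact_mod_cast hm
    exact mul_pos (by linarith) (by linarith)
  · have : (1 : ℝ) ≤ m := by exact_mod_cast hm
    exact mul_pos_of_neg_of_neg (by linarith) (by linarith)

theorem alcove_same_side (h : IsBasedRootSet Φ P a₀) {x y : 𝔱} (hx : x ∈ alcove P a₀)
    (hy : y ∈ alcove P a₀) {a : 𝔱} (ha : a ∈ Φ) (m : ℤ) : 0 < (⟪a, x⟫ - m) * (⟪a, y⟫ - m) := by
  rcases h.pos_or_neg ha with hp | hp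
  · exact same_side (h.mem_alcove_bounds hx hp) (h.mem_alcove_bounds hy hp) m
  · have := same_side (h.mem_alcove_bounds hx hp) (h.mem_alcove_bounds hy hp) (-m)
    rw [inner_neg_left, inner_neg_left] at this
    push_cast at this
    linarith

theorem alcove_regular (h : IsBasedRootSet Φ P a₀) {x : 𝔱} (hx : x ∈ alcove P a₀)
    (a : 𝔱) (ha : a ∈ Φ) (m : ℤ) : ⟪a, x⟫ ≠ m := fun he => by
  have := h.alcove_same_side hx hx ha m
  rw [he] at this
  simp at this

/-- It suffices to check the separating hyperplanes on positive roots. -/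
theorem isWall_of_pos (h : IsBasedRootSet Φ P a₀) {ρ : 𝔱} {p : 𝔱 × ℤ} (hp : p.1 ∈ Φ)
    (hs : ∀ a ∈ P, ∀ m : ℤ, (⟪a, ρ⟫ - m) * (⟪a, affRefl p ρ⟫ - m) < 0 → a = p.1 ∧ m = p.2) :
    IsWall Φ ρ p := by
  refine ⟨hp, fun a ha m hlt => ?_⟩
  rcases h.pos_or_neg ha with hpos | hpos
  · exact Or.inl (hs a hpos m hlt)
  · have := hs (-a) hpos (-m) (by rw [inner_neg_left, inner_neg_left]; push_cast; linarith)
    exact Or.inr ⟨neg_eq_iff_eq_neg.mp this.1, by omega⟩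

/-- Positive roots other than `a` are permuted, so their values at the reflected point remain in
`(0, 1)` and cross no integer. -/
theorem isWall_simple (h : IsBasedRootSet Φ P a₀) {ρ : 𝔱} (hρ : ρ ∈ alcove P a₀) {a : 𝔱}
    (ha : a ∈ simpleRoots P) : IsWall Φ ρ (a, 0) := by
  have haΦ := h.pos_mem ha.1
  refine h.isWall_of_pos haΦ fun b hb m hlt => ?_
  rw [affRefl_eq, zero_smul, add_zero, ← inner_refl] at hlt
  by_cases hba : b = a
  · subst hba
    refine ⟨rfl, ?_⟩
    rw [refl_self (h.ne_zero _ haΦ), inner_neg_left] at hlt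
    obtain ⟨b1, b2⟩ := h.mem_alcove_bounds hρ hb
    by_contra hm
    rcases lt_or_gt_of_ne hm with hm | hm
    · have : (m : ℝ) ≤ -1 := by exact_mod_cast Int.le_sub_one_of_lt hm
      nlinarith
    · have : (1 : ℝ) ≤ m := by exact_mod_cast hm
      nlinarith
  · exact absurd (same_side (h.mem_alcove_bounds hρ hb)
      (h.mem_alcove_bounds hρ (h.refl_simple_mem ha hb hba)) m) (not_lt.mpr hlt.le)

/-- For a positive root `b ≠ a₀` pairing to `0` with the coroot of `a₀` the value does not change.
If it pairs to `1`, then `a₀ - b` is a positive root and the new value is `1 - ⟪a₀ - b, ρ⟫`, again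
in `(0, 1)`. -/
theorem isWall_highest (h : IsBasedRootSet Φ P a₀) {ρ : 𝔱} (hρ : ρ ∈ alcove P a₀) :
    IsWall Φ ρ (a₀, 1) := by
  refine h.isWall_of_pos h.highest.1 fun b hb m hlt => ?_
  rw [affRefl_eq, one_smul, inner_add_right, ← inner_refl] at hlt
  obtain ⟨b1, b2⟩ := h.mem_alcove_bounds hρ hb
  by_cases hba : b = a₀
  · subst hba
    refine ⟨rfl, ?_⟩
    rw [refl_self (h.ne_zero _ h.highest.1), inner_neg_left,
      inner_self_coroot (h.ne_zero _ h.highest.1)] at hlt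
    by_contra hm
    rcases lt_or_gt_of_ne hm with hm | hm
    · have : (m : ℝ) ≤ 0 := by exact_mod_cast Int.lt_add_one_iff.mp hm
      nlinarith
    · have : (2 : ℝ) ≤ m := by exact_mod_cast hm
      nlinarith
  · refine absurd (same_side ⟨b1, b2⟩ ?_ m) (not_lt.mpr hlt.le)
    rcases h.inner_highest_coroot hb hba with hc | hc
    · rw [hc, refl, hc, zero_smul, sub_zero, add_zero]
      exact ⟨b1, b2⟩
    · have hmem : a₀ - b ∈ P := by
        obtain ⟨v, h1, h2, h3, h4, h5⟩ := h.exists_vector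
        have hΦ := h.neg_mem (h.refl_mem a₀ h.highest.1 b (h.pos_mem hb))
        rw [refl, hc, one_smul, neg_sub] at hΦ
        refine h4 _ hΦ ?_
        by_contra! hcon
        exact h.ne_zero _ hΦ (h5 _ (h.highest.2 b (h.pos_mem hb)) hcon)
      obtain ⟨c1, c2⟩ := h.mem_alcove_bounds hρ hmem
      rw [hc, refl, hc, one_smul, ← neg_sub, inner_neg_left]
      constructor <;> linarith

/-- The maps that are products of wall reflections. -/
def IsWallProduct (Φ : Set 𝔱) (ρ : 𝔱) (f : 𝔱 → 𝔱) : Prop :=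
  ∃ L : List (𝔱 × ℤ), (∀ p ∈ L, IsWall Φ ρ p) ∧ ∀ x, affComp L x = f x

theorem IsWallProduct.comp {ρ : 𝔱} {f g : 𝔱 → 𝔱} (hf : IsWallProduct Φ ρ f)
    (hg : IsWallProduct Φ ρ g) : IsWallProduct Φ ρ (f ∘ g) := by
  obtain ⟨L, hL, hf⟩ := hf
  obtain ⟨L', hL', hg⟩ := hg
  refine ⟨L ++ L', fun p hp => ?_, fun x => by rw [affComp_append, hg, hf]; rfl⟩
  exact (List.mem_append.mp hp).elim (hL p) (hL' p)

theorem isWallProduct_id (ρ : 𝔱) : IsWallProduct Φ ρ id := ⟨[], by simp, fun x => rfl⟩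

theorem isWallProduct_refl (h : IsBasedRootSet Φ P a₀) {ρ : 𝔱} (hρ : ρ ∈ alcove P a₀) {b : 𝔱}
    (hb : b ∈ Φ) : IsWallProduct Φ ρ (refl b) := by
  obtain ⟨v, h1, h2, h3, h4, h5⟩ := h.exists_vector
  have hneg : ∀ b : 𝔱, refl (-b) = refl b := fun b => by
    funext x; simp [refl, coroot]
  have hsimple : ∀ a ∈ simpleRoots P, IsWallProduct Φ ρ (refl a) := fun a ha =>
    ⟨[(a, 0)], by simpa using h.isWall_simple hρ ha, fun x => by
      simp [affComp, affRefl_eq]⟩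
  -- Descent on the height: some simple root `a` pairs positively with a minimal counterexample `c`,
  -- so the reflected root is lower, and the reflection in `c` is its conjugate by the reflection in
  -- `a`.
  have key : ∀ b ∈ P, IsWallProduct Φ ρ (refl b) := by
    by_contra! hcon
    obtain ⟨b, hb, hb'⟩ := hcon
    have hfin : {b | b ∈ P ∧ ¬IsWallProduct Φ ρ (refl b)}.Finite :=
      h.finite.subset fun b hb => h2 b hb.1
    obtain ⟨c, ⟨hc, hc'⟩, hmin⟩ := Set.exists_min_image _ (fun b => ⟪b, v⟫) hfin ⟨b, hb, hb'⟩
    have hcΦ := h2 c hc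
    obtain ⟨a, ha, hac⟩ : ∃ a ∈ simpleRoots P, 0 < ⟪a, c⟫ := by
      by_contra! hcon
      have := inner_nonneg_of_mem_closure (x := -c)
        (fun a ha => by rw [inner_neg_right]; have := hcon a ha; linarith)
        (h.mem_closure_simpleRoots hc)
      rw [inner_neg_right] at this
      have := h.inner_self_pos hcΦ
      linarith
    have hne : c ≠ a := fun he => hc' (he ▸ hsimple a ha)
    have haΦ := h2 a ha.1
    have hmem := h.refl_simple_mem ha hc hne
    have hlt : ⟪refl a c, v⟫ < ⟪c, v⟫ := by
      have hav := h1 a ha.1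
      have haa := h.inner_self_pos haΦ
      rw [refl, inner_sub_left, inner_smul_left, inner_coroot, real_inner_comm a c,
        RCLike.conj_to_real]
      have : 0 < 2 * ⟪a, c⟫ / ⟪a, a⟫ * ⟪a, v⟫ := by positivity
      linarith
    have hprod : IsWallProduct Φ ρ (refl (refl a c)) := by
      by_contra hcon
      exact absurd (hmin _ ⟨hmem, hcon⟩) (not_le.mpr hlt)
    refine hc' ?_
    have : refl c = refl a ∘ refl (refl a c) ∘ refl a := by
      funext x
      simp only [Function.comp_apply]
      rw [← reflection_eq_refl a c, ← reflection_eq_refl a x, refl_map, ← reflection_eq_refl a,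
        Submodule.reflection_reflection]
    rw [this]
    exact (hsimple a ha).comp (hprod.comp (hsimple a ha))
  rcases h3 b hb with hp | hp
  · exact key b hp
  · rw [← hneg]
    exact key _ hp

theorem isWallProduct_weyl (h : IsBasedRootSet Φ P a₀) {ρ : 𝔱} (hρ : ρ ∈ alcove P a₀)
    (w : weylGroup Φ) : IsWallProduct Φ ρ w.1 ∧ IsWallProduct Φ ρ (w⁻¹).1 := by
  induction w using weylGroup_induction with
  | hr a ha =>
    have h1 : ((IsRootSet.reflection ha).1 : 𝔱 → 𝔱) = refl a :=
      funext fun x => IsRootSet.reflection_apply ha x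
    have h2 : (((IsRootSet.reflection ha)⁻¹).1 : 𝔱 → 𝔱) = refl a := by
      funext x
      refine (IsRootSet.reflection ha).1.symm_apply_eq.mpr ?_
      rw [h1, refl_refl (h.ne_zero a ha)]
    rw [h1, h2]
    exact ⟨h.isWallProduct_refl hρ ha, h.isWallProduct_refl hρ ha⟩
  | h1 => exact ⟨isWallProduct_id ρ, by rw [inv_one]; exact isWallProduct_id ρ⟩
  | hm w w' hw hw' =>
    refine ⟨hw.1.comp hw'.1, ?_⟩
    rw [mul_inv_rev]
    exact hw'.2.comp hw.2
  | hi w hw => exact ⟨hw.2, by rw [inv_inv]; exact hw.1⟩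

theorem isWallProduct_translation (h : IsBasedRootSet Φ P a₀) {ρ : 𝔱} (hρ : ρ ∈ alcove P a₀)
    {l : 𝔱} (hl : l ∈ integralLattice Φ) : IsWallProduct Φ ρ (fun x => x + l) := by
  -- Requiring both `l` and `-l` makes `K` a subgroup without having to invert wall products.
  let K : AddSubgroup 𝔱 :=
    { carrier := {l | IsWallProduct Φ ρ (fun x => x + l) ∧ IsWallProduct Φ ρ (fun x => x + -l)}
      zero_mem' := by
        refine ⟨?_, ?_⟩ <;> convert isWallProduct_id ρ using 1 <;> funext x <;> simp
      add_mem' := fun {a b} ha hb => by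
        refine ⟨?_, ?_⟩
        · convert ha.1.comp hb.1 using 1
          funext x
          simp only [Function.comp_apply]; abel
        · convert ha.2.comp hb.2 using 1
          funext x
          simp only [Function.comp_apply]; abel
      neg_mem' := fun {a} ha => ⟨ha.2, by simpa using ha.1⟩ }
  have hKw : ∀ (w : weylGroup Φ) (l : 𝔱), l ∈ K → w.1 l ∈ K := by
    intro w l hl
    have e : ∀ y, w.1 ((w⁻¹).1 y) = y := fun y => w.1.apply_symm_apply y
    obtain ⟨hw, hw'⟩ := h.isWallProduct_weyl hρ w
    refine ⟨?_, ?_⟩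
    · convert hw.comp (hl.1.comp hw') using 1
      funext x
      simp
    · convert hw.comp (hl.2.comp hw') using 1
      funext x
      simp
  -- Translation by `a₀`, which is its own coroot, is the product of the affine and the linear
  -- reflection attached to `a₀`.
  have ha₀ : a₀ ∈ K := by
    have hne := h.ne_zero _ h.highest.1
    have h1 := h.isWallProduct_refl hρ h.highest.1
    have h2 : IsWallProduct Φ ρ (affRefl (a₀, 1)) :=
      ⟨[(a₀, 1)], by simpa using h.isWall_highest hρ, fun x => rfl⟩
    refine ⟨?_, ?_⟩
    · convert h2.comp h1 using 1
      funext x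
      simp [affRefl_eq, refl_refl hne, h.coroot_highest]
    · convert h1.comp h2 using 1
      funext x
      have h3 := refl_refl hne x
      have h4 := refl_self hne
      simp only [Function.comp_apply, affRefl_eq, h.coroot_highest, one_smul]
      rw [← reflection_eq_refl a₀ (refl a₀ x + a₀), map_add, reflection_eq_refl,
        reflection_eq_refl, h3, h4]
  have hco : ∀ b ∈ Φ, coroot b ∈ K := by
    intro b hb
    obtain ⟨w, hw⟩ := h.exists_orbit hb
    have hc := hKw w a₀ ha₀
    rcases hw with (rfl | rfl) | hw
    · rw [h.coroot_orbit]; exact hc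
    · have : coroot (-w.1 a₀) = -coroot (w.1 a₀) := by simp [coroot]
      rw [this, h.coroot_orbit]
      exact K.neg_mem hc
    -- For a conjugate `c` of `a₀` pairing to `±1` with `b`, the difference between `c` and its
    -- reflection in `b` is `±` the coroot of `b`. This reaches the coroots of short roots.
    · have hrc : w.1 a₀ - refl b (w.1 a₀) ∈ K := by
        refine K.sub_mem hc ?_
        rw [← IsRootSet.reflection_apply hb]
        exact hKw _ _ hc
      rw [h.coroot_orbit] at hw
      have e : w.1 a₀ - refl b (w.1 a₀) = ⟪b, w.1 a₀⟫ • coroot b := by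
        rw [refl, sub_sub_cancel, inner_coroot, coroot, smul_smul, real_inner_comm]
        congr 1; ring
      rw [e] at hrc
      rcases hw with hw | hw
      · rwa [hw, one_smul] at hrc
      · rw [hw, neg_smul, one_smul] at hrc
        simpa using K.neg_mem hrc
  have hle : integralLattice Φ ≤ K.toIntSubmodule := by
    refine Submodule.span_le.mpr ?_
    rintro _ ⟨b, hb, rfl⟩
    exact hco b hb
  exact (hle hl : l ∈ K).1

/-- The affine Weyl group acts freely and the alcove meets each orbit at most once. -/
theorem alcove_unique (h : IsBasedRootSet Φ P a₀) {μ μ' : 𝔱} (hμ : μ ∈ alcove P a₀)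
    (hμ' : μ' ∈ alcove P a₀) (w : weylGroup Φ) {l : 𝔱} (hl : l ∈ integralLattice Φ)
    (he : w.1 μ + l = μ') : w = 1 ∧ l = 0 := by
  obtain ⟨L, hL, hx⟩ := (h.isWallProduct_translation hμ hl).comp (h.isWallProduct_weyl hμ w).1
  simp only [Function.comp_apply] at hx
  -- With `μ` itself as base point, the affine map sends `μ` to a point of the same alcove, so as a
  -- product of wall reflections it is the identity.
  have hid := affComp_eq_self h.toIsRootSet (h.alcove_regular hμ) _ L rfl hL fun a ha m => by
    rw [hx, he]
    exact h.alcove_same_side hμ hμ' ha m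
  have hl0 : l = 0 := by
    have := (hx 0).symm.trans (hid 0)
    simpa using this
  refine ⟨?_, hl0⟩
  apply Subtype.ext
  apply LinearIsometryEquiv.ext
  intro x
  have := (hx x).symm.trans (hid x)
  rw [hl0, add_zero] at this
  exact this

theorem exists_mem_alcove (h : IsBasedRootSet Φ P a₀) : (alcove P a₀).Nonempty := by
  obtain ⟨v, h1, h2, h3, h4, h5⟩ := h.exists_vector
  have h0 := h1 a₀ h.highest_mem
  refine ⟨(2 * ⟪a₀, v⟫)⁻¹ • v, fun a ha => ?_, ?_⟩
  · have := h1 a ha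
    rw [inner_smul_right]; positivity
  · rw [inner_smul_right]
    field_simp
    norm_num

/-- Every point can be moved to the closed alcove by the affine Weyl group. -/
theorem exists_mem_closed_alcove (h : IsBasedRootSet Φ P a₀)
    (hfin : ∀ r : ℝ, {l : 𝔱 | l ∈ integralLattice Φ ∧ ‖l‖ ≤ r}.Finite) (x : 𝔱) :
    ∃ (w : weylGroup Φ), ∃ l ∈ integralLattice Φ,
      (∀ a ∈ P, 0 ≤ ⟪a, w.1 x + l⟫) ∧ ⟪a₀, w.1 x + l⟫ ≤ 1 := by
  obtain ⟨ρ, hρ⟩ := h.exists_mem_alcove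
  have := h.finite_weylGroup
  -- The minimizer of the distance from the affine orbit to the interior point `ρ` is sought. For
  -- `l` beyond this radius the distance exceeds `‖x - ρ‖`, so minimizing over a finite set
  -- suffices.
  let S : Set (weylGroup Φ × 𝔱) :=
    Set.univ ×ˢ {l : 𝔱 | l ∈ integralLattice Φ ∧ ‖l‖ ≤ ‖x - ρ‖ + ‖x‖ + ‖ρ‖}
  have hS : S.Finite := Set.Finite.prod Set.finite_univ (hfin _)
  have hS0 : ((1 : weylGroup Φ), (0 : 𝔱)) ∈ S :=
    ⟨trivial, zero_mem _, by rw [norm_zero]; positivity⟩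
  obtain ⟨⟨w, l⟩, hwl, hmin⟩ := Set.exists_min_image S (fun p => ‖p.1.1 x + p.2 - ρ‖) hS ⟨_, hS0⟩
  have hl : l ∈ integralLattice Φ := hwl.2.1
  have hmin' : ∀ (w' : weylGroup Φ), ∀ l' ∈ integralLattice Φ,
      ‖w.1 x + l - ρ‖ ≤ ‖w'.1 x + l' - ρ‖ := by
    intro w' l' hl'
    by_cases hle : ‖l'‖ ≤ ‖x - ρ‖ + ‖x‖ + ‖ρ‖
    · exact hmin (w', l') ⟨trivial, hl', hle⟩
    · refine (hmin _ hS0).trans ?_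
      have e1 : ‖l'‖ ≤ ‖w'.1 x + l' - ρ‖ + ‖w'.1 x‖ + ‖ρ‖ := by
        have : l' = (w'.1 x + l' - ρ) - w'.1 x + ρ := by abel
        calc ‖l'‖ = ‖(w'.1 x + l' - ρ) - w'.1 x + ρ‖ := by rw [← this]
          _ ≤ _ := (norm_add_le _ _).trans (by gcongr; exact norm_sub_le _ _)
      rw [LinearIsometryEquiv.norm_map] at e1
      change ‖x + 0 - ρ‖ ≤ _
      rw [add_zero]
      linarith
  set y := w.1 x + l with hy
  have hstep : ∀ p : 𝔱 × ℤ, p.1 ∈ Φ → ‖y - ρ‖ ≤ ‖affRefl p y - ρ‖ := by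
    intro p hp
    have e : affRefl p y = (IsRootSet.reflection hp * w).1 x + (refl p.1 l + p.2 • coroot p.1) := by
      change _ = (IsRootSet.reflection hp).1 (w.1 x) + _
      rw [affRefl_eq, hy, IsRootSet.reflection_apply, ← reflection_eq_refl p.1 (w.1 x + l), map_add,
        reflection_eq_refl, reflection_eq_refl, add_assoc]
    rw [e]
    refine hmin' _ _ (add_mem ?_ (Submodule.smul_mem _ _ (coroot_mem hp)))
    rw [← IsRootSet.reflection_apply hp]
    exact h.map_lattice _ hl
  -- Reflecting `y` changes its square distance to `ρ` by a positive multiple of the product of the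
  -- two signed values. By minimality no hyperplane strictly separates `y` from `ρ`.
  have hcalc : ∀ p : 𝔱 × ℤ, p.1 ∈ Φ → 0 ≤ (⟪p.1, y⟫ - p.2) * (⟪p.1, ρ⟫ - p.2) := by
    intro p hp
    have h1 := hstep p hp
    have hpp := h.inner_self_pos hp
    have h2 : ‖y - ρ‖ ^ 2 ≤ ‖affRefl p y - ρ‖ ^ 2 := by gcongr
    rw [← real_inner_self_eq_norm_sq, ← real_inner_self_eq_norm_sq] at h2
    have e : affRefl p y - ρ = (y - ρ) - ((⟪p.1, y⟫ - p.2) * (2 / ⟪p.1, p.1⟫)) • p.1 := by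
      rw [affRefl, coroot]; module
    have h3 : ⟪affRefl p y - ρ, affRefl p y - ρ⟫ = ⟪y - ρ, y - ρ⟫ +
        4 / ⟪p.1, p.1⟫ * ((⟪p.1, y⟫ - p.2) * (⟪p.1, ρ⟫ - p.2)) := by
      have c1 := real_inner_comm p.1 y
      have c2 := real_inner_comm p.1 ρ
      rw [e, inner_sub_left (y - ρ), inner_sub_right (y - ρ), inner_sub_right (_ • p.1)]
      simp only [inner_smul_left, inner_smul_right, RCLike.conj_to_real, inner_sub_left y ρ p.1,
        inner_sub_right p.1 y ρ, c1, c2]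
      field_simp
      ring
    rw [h3] at h2
    have h4 : 0 ≤ 4 / ⟪p.1, p.1⟫ * ((⟪p.1, y⟫ - p.2) * (⟪p.1, ρ⟫ - p.2)) := by linarith
    exact (mul_nonneg_iff_of_pos_left (by positivity)).mp h4
  refine ⟨w, l, hl, fun a ha => ?_, ?_⟩
  · have h1 := hcalc (a, 0) (h.pos_mem ha)
    simp only [Int.cast_zero, sub_zero] at h1
    exact nonneg_of_mul_nonneg_left h1 (hρ.1 a ha)
  · have h1 := hcalc (a₀, 1) h.highest.1
    simp only [Int.cast_one] at h1
    have h2 := hρ.2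
    by_contra! hcon
    nlinarith

/-- A point of the closed alcove outside the alcove is fixed by an affine reflection. -/
theorem exists_reflection_fixing (h : IsBasedRootSet Φ P a₀) [FiniteDimensional ℝ 𝔱] {y : 𝔱}
    (h1 : ∀ a ∈ P, 0 ≤ ⟪a, y⟫) (h2 : ⟪a₀, y⟫ ≤ 1) (hy : y ∉ alcove P a₀) :
    ∃ w : weylGroup Φ, weylSign w = -1 ∧ ∃ l ∈ integralLattice Φ, w.1 y + l = y := by
  by_cases hall : ∀ a ∈ P, 0 < ⟪a, y⟫
  · have h3 : ⟪a₀, y⟫ = 1 := le_antisymm h2 (not_lt.mp fun hlt => hy ⟨hall, hlt⟩)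
    refine ⟨IsRootSet.reflection h.highest.1, weylSign_reflection h.toIsRootSet _, coroot a₀,
      coroot_mem h.highest.1, ?_⟩
    rw [IsRootSet.reflection_apply, refl, h.coroot_highest, real_inner_comm, h3, one_smul,
      sub_add_cancel]
  · push Not at hall
    obtain ⟨a, ha, hle⟩ := hall
    have h3 : ⟪a, y⟫ = 0 := le_antisymm hle (h1 a ha)
    refine ⟨IsRootSet.reflection (h.pos_mem ha), weylSign_reflection h.toIsRootSet _, 0,
      zero_mem _, ?_⟩
    rw [IsRootSet.reflection_apply, refl, inner_coroot, real_inner_comm, h3]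
    simp

end IsBasedRootSet

end Alcove

/-! ## Theta series -/

section Theta

variable {𝔱 : Type*} [NormedAddCommGroup 𝔱] [InnerProductSpace ℝ 𝔱]

open scoped RealInnerProductSpace

/-- The summands of the section `Θ^τ_{μ,k} s_τ^k`. -/
def thetaTerm (k : ℕ) (τ : ℍ) (γ : 𝔱) (x : 𝔱 × 𝔱) : ℂ :=
  Complex.exp (Complex.I * Real.pi * k *
    ((τ : ℂ) * (⟪γ - x.2, γ - x.2⟫ : ℝ) - 2 * (⟪x.1, γ⟫ : ℝ) + (⟪x.1, x.2⟫ : ℝ)))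

/-- The factor `s_τ^k` completes the square: the exponent of each term contains `τ ⟪γ - q, γ - q⟫`,
so its norm is a Gaussian function of `γ - q`. -/
theorem thetaSec_eq_tsum (Λ : Submodule ℤ 𝔱) (k : ℕ) (τ : ℍ) (μ : 𝔱) (x : 𝔱 × 𝔱) :
    thetaSec Λ k τ μ x = ∑' l : Λ, thetaTerm k τ (μ + l) x := by
  rw [thetaSec, theta, ← tsum_mul_right]
  refine tsum_congr fun l => ?_
  rw [sSec, ← Complex.exp_nat_mul, ← Complex.exp_add, thetaTerm]
  congr 1
  have : ⟪μ + l - x.2, μ + l - x.2⟫ = ⟪μ + l, μ + l⟫ - 2 * ⟪x.2, μ + l⟫ + ⟪x.2, x.2⟫ := by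
    rw [inner_sub_left, inner_sub_right, inner_sub_right, real_inner_comm x.2 (μ + l)]
    ring
  rw [this]
  push_cast
  ring

theorem norm_thetaTerm (k : ℕ) (τ : ℍ) (γ : 𝔱) (x : 𝔱 × 𝔱) :
    ‖thetaTerm k τ γ x‖ = Real.exp (-(Real.pi * k * τ.im) * ‖γ - x.2‖ ^ 2) := by
  rw [thetaTerm, Complex.norm_exp, ← real_inner_self_eq_norm_sq]
  congr 1
  generalize ⟪γ - x.2, γ - x.2⟫ = r
  simp [Complex.mul_re, Complex.mul_im]
  ring

/-- Translation by a lattice vector. -/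
theorem thetaTerm_add {Λ : Submodule ℤ 𝔱} {k : ℕ} (τ : ℍ) {γ : 𝔱} (hγ : γ ∈ scaledDual Λ k)
    {p : 𝔱} (hp : p ∈ Λ) (q : 𝔱) (x : 𝔱 × 𝔱) :
    thetaTerm k τ γ ((p, q) + x) = latticeFactor (p, q) x ^ k * thetaTerm k τ (γ - q) x := by
  obtain ⟨m, hm⟩ := hγ p hp
  rw [latticeFactor, latticePhase, mul_pow, ← Complex.exp_nat_mul, ← Complex.exp_nat_mul,
    ← Complex.exp_add, thetaTerm, thetaTerm, ← Complex.exp_add, Complex.exp_eq_exp_iff_exists_int]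
  refine ⟨-m, ?_⟩
  have e1 : γ - ((p, q) + x).2 = γ - q - x.2 := by simp [sub_sub]
  rw [inner_smul_left, RCLike.conj_to_real, real_inner_comm] at hm
  have hm' : (k : ℂ) * (⟪p, γ⟫ : ℝ) = m := by exact_mod_cast hm
  rw [e1]
  generalize ⟪γ - q - x.2, γ - q - x.2⟫ = r
  simp only [omega, Prod.fst_add, Prod.snd_add, inner_add_left, inner_add_right,
    inner_sub_right, real_inner_comm x.1 q]
  push_cast
  linear_combination (-2 * Real.pi * Complex.I) * hm'

theorem thetaTerm_isometry (k : ℕ) (τ : ℍ) (w : 𝔱 ≃ₗᵢ[ℝ] 𝔱) (γ : 𝔱) (x : 𝔱 × 𝔱) :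
    thetaTerm k τ (w γ) (w x.1, w x.2) = thetaTerm k τ γ x := by
  simp only [thetaTerm, ← map_sub, LinearIsometryEquiv.inner_map_map]

theorem thetaTerm_sub (k : ℕ) (τ τ' : ℍ) (hτ : (τ' : ℂ) = τ - 1) (γ : 𝔱) (x : 𝔱 × 𝔱) :
    thetaTerm k τ γ (x.1 - x.2, x.2) =
      Complex.exp (Complex.I * Real.pi * k * (⟪γ, γ⟫ : ℝ)) * thetaTerm k τ' γ x := by
  rw [thetaTerm, thetaTerm, ← Complex.exp_add, hτ]
  congr 1
  simp only [inner_sub_left, inner_sub_right, real_inner_comm x.2 γ]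
  push_cast
  ring

/-- The differential of a theta term. -/
def thetaDeriv (k : ℕ) (τ : ℍ) (γ : 𝔱) (x : 𝔱 × 𝔱) : 𝔱 × 𝔱 →L[ℝ] ℂ :=
  ContinuousLinearMap.mul ℝ ℂ (thetaTerm k τ γ x * (Complex.I * Real.pi * k)) ∘L (
    ContinuousLinearMap.mul ℝ ℂ (-(2 * (τ : ℂ))) ∘L Complex.ofRealCLM ∘L innerSL ℝ (γ - x.2) ∘L
      ContinuousLinearMap.snd ℝ 𝔱 𝔱
    - ContinuousLinearMap.mul ℝ ℂ 2 ∘L Complex.ofRealCLM ∘L innerSL ℝ γ ∘L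
      ContinuousLinearMap.fst ℝ 𝔱 𝔱
    + Complex.ofRealCLM ∘L innerSL ℝ x.2 ∘L ContinuousLinearMap.fst ℝ 𝔱 𝔱
    + Complex.ofRealCLM ∘L innerSL ℝ x.1 ∘L ContinuousLinearMap.snd ℝ 𝔱 𝔱)

theorem thetaDeriv_apply (k : ℕ) (τ : ℍ) (γ : 𝔱) (x v : 𝔱 × 𝔱) :
    thetaDeriv k τ γ x v = thetaTerm k τ γ x * (Complex.I * Real.pi * k) *
      (-(2 * (τ : ℂ)) * (⟪γ - x.2, v.2⟫ : ℝ) -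
      2 * (⟪γ, v.1⟫ : ℝ) + (⟪x.2, v.1⟫ : ℝ) + (⟪x.1, v.2⟫ : ℝ)) := rfl

theorem thetaTerm_hasFDerivAt (k : ℕ) (τ : ℍ) (γ : 𝔱) (x : 𝔱 × 𝔱) :
    HasFDerivAt (thetaTerm k τ γ) (thetaDeriv k τ γ x) x := by
  have hf : HasFDerivAt (fun x : 𝔱 × 𝔱 => x.1) (ContinuousLinearMap.fst ℝ 𝔱 𝔱) x := hasFDerivAt_fst
  have hs : HasFDerivAt (fun x : 𝔱 × 𝔱 => x.2) (ContinuousLinearMap.snd ℝ 𝔱 𝔱) x := hasFDerivAt_snd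
  have h1 := ((hs.const_sub γ).inner ℝ (hs.const_sub γ))
  have h2 := hf.inner ℝ (hasFDerivAt_const γ x)
  have h3 := hf.inner ℝ hs
  have h1' := (Complex.ofRealCLM.hasFDerivAt.comp x h1).const_mul (τ : ℂ)
  have h2' := (Complex.ofRealCLM.hasFDerivAt.comp x h2).const_mul (2 : ℂ)
  have h3' := Complex.ofRealCLM.hasFDerivAt.comp x h3
  refine (((h1'.sub h2').add h3').const_mul (Complex.I * Real.pi * k)).cexp.congr_fderiv ?_
  refine ContinuousLinearMap.ext fun v => ?_
  change thetaTerm k τ γ x * (Complex.I * Real.pi * k *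
    ((τ : ℂ) * ((⟪γ - x.2, -v.2⟫ + ⟪-v.2, γ - x.2⟫ : ℝ) : ℂ) - 2 * ((⟪x.1, 0⟫ + ⟪v.1, γ⟫ : ℝ) : ℂ) +
      ((⟪x.1, v.2⟫ + ⟪v.1, x.2⟫ : ℝ) : ℂ))) = thetaDeriv k τ γ x v
  rw [thetaDeriv_apply, inner_neg_right, inner_neg_left, inner_zero_right,
    real_inner_comm (γ - x.2) v.2, real_inner_comm γ v.1, real_inner_comm x.2 v.1]
  push_cast
  ring

theorem norm_thetaDeriv_le (k : ℕ) (τ : ℍ) (γ : 𝔱) (x : 𝔱 × 𝔱) :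
    ‖thetaDeriv k τ γ x‖ ≤ ‖thetaTerm k τ γ x‖ * (Real.pi * k *
      (2 * ‖(τ : ℂ)‖ * (‖γ‖ + ‖x‖) + 2 * ‖γ‖ + ‖x‖ + ‖x‖)) := by
  refine ContinuousLinearMap.opNorm_le_bound _ (by positivity) fun v => ?_
  rw [thetaDeriv_apply, norm_mul, norm_mul]
  have e1 : ‖Complex.I * Real.pi * k‖ = Real.pi * k := by
    simp [abs_of_pos Real.pi_pos]
  rw [e1]
  have hv1 : ‖v.1‖ ≤ ‖v‖ := norm_fst_le v
  have hv2 : ‖v.2‖ ≤ ‖v‖ := norm_snd_le v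
  have hx1 : ‖x.1‖ ≤ ‖x‖ := norm_fst_le x
  have hx2 : ‖x.2‖ ≤ ‖x‖ := norm_snd_le x
  have key : ∀ a b : 𝔱, ‖((⟪a, b⟫ : ℝ) : ℂ)‖ ≤ ‖a‖ * ‖b‖ := fun a b => by
    rw [Complex.norm_real]; exact norm_inner_le_norm a b
  have t1 : ‖-(2 * (τ : ℂ)) * ((⟪γ - x.2, v.2⟫ : ℝ) : ℂ)‖ ≤
      2 * ‖(τ : ℂ)‖ * ((‖γ‖ + ‖x‖) * ‖v‖) := by
    rw [norm_mul, norm_neg, norm_mul, Complex.norm_ofNat]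
    gcongr
    refine (key _ _).trans ?_
    gcongr
    exact (norm_sub_le _ _).trans (by gcongr)
  have t2 : ‖2 * ((⟪γ, v.1⟫ : ℝ) : ℂ)‖ ≤ 2 * (‖γ‖ * ‖v‖) := by
    rw [norm_mul, Complex.norm_ofNat]
    gcongr
    exact (key _ _).trans (by gcongr)
  have t3 : ‖((⟪x.2, v.1⟫ : ℝ) : ℂ)‖ ≤ ‖x‖ * ‖v‖ := (key _ _).trans (by gcongr)
  have t4 : ‖((⟪x.1, v.2⟫ : ℝ) : ℂ)‖ ≤ ‖x‖ * ‖v‖ := (key _ _).trans (by gcongr)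
  have hsum : ‖-(2 * (τ : ℂ)) * ((⟪γ - x.2, v.2⟫ : ℝ) : ℂ) - 2 * ((⟪γ, v.1⟫ : ℝ) : ℂ) +
      ((⟪x.2, v.1⟫ : ℝ) : ℂ) + ((⟪x.1, v.2⟫ : ℝ) : ℂ)‖ ≤
      2 * ‖(τ : ℂ)‖ * ((‖γ‖ + ‖x‖) * ‖v‖) + 2 * (‖γ‖ * ‖v‖) + ‖x‖ * ‖v‖ + ‖x‖ * ‖v‖ := by
    refine (norm_add_le _ _).trans (add_le_add ?_ t4)
    refine (norm_add_le _ _).trans (add_le_add ?_ t3)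
    exact (norm_sub_le _ _).trans (add_le_add t1 t2)
  calc _ ≤ ‖thetaTerm k τ γ x‖ * (Real.pi * k) *
      (2 * ‖(τ : ℂ)‖ * ((‖γ‖ + ‖x‖) * ‖v‖) + 2 * (‖γ‖ * ‖v‖) + ‖x‖ * ‖v‖ + ‖x‖ * ‖v‖) :=
        mul_le_mul_of_nonneg_left hsum (by positivity)
    _ = _ := by ring

variable [FiniteDimensional ℝ 𝔱] (Λ : Submodule ℤ 𝔱) [DiscreteTopology Λ] [IsZLattice ℝ Λ]

theorem summable_gaussian {c : ℝ} (hc : 0 < c) (μ : 𝔱) :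
    Summable fun l : Λ => Real.exp (-c * ‖μ + l‖ ^ 2) := by
  -- The exponent `2N` exceeds the rank, so the series of inverse powers converges; it dominates the
  -- Gaussian through `(c r²)^N / N! ≤ exp (c r²)`.
  set N := Module.finrank ℤ Λ + 1
  have h := ZLattice.summable_norm_sub_inv_pow (L := Λ) (2 * N) (by omega) (-μ)
  refine Summable.of_norm_bounded_eventually (h.mul_left (N.factorial / c ^ N)) ?_
  -- At most one lattice vector gives `μ + l = 0`, where the inverse power is a default value; the
  -- comparison is made off this vector.
  have hfin : {l : Λ | μ + l = 0}.Finite := by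
    refine Set.Subsingleton.finite fun l hl l' hl' => ?_
    have : μ + (l : 𝔱) = μ + l' := hl.trans hl'.symm
    exact Subtype.ext (add_left_cancel this)
  filter_upwards [hfin.compl_mem_cofinite] with l hl
  have hr : 0 < ‖μ + l‖ := norm_pos_iff.mpr hl
  have e : (l : 𝔱) - -μ = μ + l := by abel
  rw [e, Real.norm_eq_abs, Real.abs_exp, neg_mul, Real.exp_neg, inv_pow]
  have h1 := Real.pow_div_factorial_le_exp (c * ‖μ + l‖ ^ 2) (by positivity) N
  have h2 : (c * ‖μ + l‖ ^ 2) ^ N / N.factorial =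
      (N.factorial / c ^ N * (‖μ + l‖ ^ (2 * N))⁻¹)⁻¹ := by
    rw [mul_pow, ← pow_mul]
    field_simp
  rw [h2] at h1
  exact inv_le_of_inv_le₀ (by positivity) h1

theorem summable_gaussian_mul {c : ℝ} (hc : 0 < c) (μ : 𝔱) :
    Summable fun l : Λ => (1 + ‖μ + l‖) * Real.exp (-c * ‖μ + l‖ ^ 2) := by
  refine Summable.of_nonneg_of_le (fun l => by positivity) (fun l => ?_)
    ((summable_gaussian Λ (half_pos hc) μ).mul_left (Real.exp (1 / (2 * c))))
  rw [← Real.exp_add]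
  set r := ‖μ + l‖
  calc (1 + r) * Real.exp (-c * r ^ 2) ≤ Real.exp r * Real.exp (-c * r ^ 2) := by
        gcongr
        linarith [Real.add_one_le_exp r]
    _ = Real.exp (r + -c * r ^ 2) := (Real.exp_add _ _).symm
    _ ≤ _ := by
        refine Real.exp_le_exp.mpr ?_
        -- Expanding the square gives `r ≤ (c/2) r² + 1/(2c)`: half of the Gaussian absorbs the
        -- linear factor.
        have : 0 ≤ (c * r - 1) ^ 2 / (2 * c) := by positivity
        have e : (c * r - 1) ^ 2 / (2 * c) = c / 2 * r ^ 2 - r + 1 / (2 * c) := by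
          field_simp
          ring
        rw [e] at this
        linarith

variable {k : ℕ}

theorem summable_thetaTerm (hk : 0 < k) (τ : ℍ) (μ : 𝔱) (x : 𝔱 × 𝔱) :
    Summable fun l : Λ => thetaTerm k τ (μ + l) x := by
  refine Summable.of_norm ?_
  simp only [norm_thetaTerm]
  have hc : 0 < Real.pi * k * τ.im := by
    have := τ.im_pos
    have := Real.pi_pos
    positivity
  refine (summable_gaussian Λ hc (μ - x.2)).congr fun l => ?_
  rw [add_sub_right_comm]

theorem differentiableAt_tsum_of_bound {ι E : Type*} [NormedAddCommGroup E] [NormedSpace ℝ E]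
    {f : ι → E → ℂ} {f' : ι → E → E →L[ℝ] ℂ} {u : ι → ℝ} (hu : Summable u) {R : ℝ} {x : E}
    (hf : ∀ i, ∀ y ∈ Metric.ball (0 : E) R, HasFDerivAt (f i) (f' i y) y)
    (hb : ∀ i, ∀ y ∈ Metric.ball (0 : E) R, ‖f' i y‖ ≤ u i) (hx : x ∈ Metric.ball (0 : E) R)
    (hs : Summable fun i => f i x) :
    DifferentiableAt ℝ (fun y => ∑' i, f i y) x ∧
    ∀ v, HasSum (fun i => f' i x v) (fderiv ℝ (fun y => ∑' i, f i y) x v) := by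
  have h1 := hasFDerivAt_tsum_of_isPreconnected hu Metric.isOpen_ball
    (convex_ball (0 : E) R).isPreconnected hf hb hx hs hx
  refine ⟨h1.differentiableAt, fun v => ?_⟩
  rw [h1.fderiv]
  exact (ContinuousLinearMap.apply ℝ ℂ v).hasSum (Summable.of_norm_bounded hu fun i => hb i x hx).hasSum

/-- A summable bound, uniform on balls, for the differentials of the theta terms. -/
theorem exists_bound_thetaTerm (hk : 0 < k) (τ : ℍ) (μ : 𝔱) (R : ℝ) :
    ∃ u : Λ → ℝ, Summable u ∧ ∀ (l : Λ) (x : 𝔱 × 𝔱), x ∈ Metric.ball (0 : 𝔱 × 𝔱) R →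
      ‖thetaDeriv k τ (μ + l) x‖ ≤ u l := by
  set c := Real.pi * k * τ.im with hcdef
  have hc : 0 < c := by
    have := τ.im_pos
    have := Real.pi_pos
    positivity
  set K := Real.exp (c * R ^ 2) * (Real.pi * k *
    (2 * ‖(τ : ℂ)‖ * (1 + |R|) + 2 + |R| + |R|)) with hK
  refine ⟨fun l => K * ((1 + ‖μ + l‖) * Real.exp (-(c / 2) * ‖μ + l‖ ^ 2)),
    (summable_gaussian_mul Λ (half_pos hc) μ).mul_left K, fun l x hx => ?_⟩
  rw [mem_ball_zero_iff] at hx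
  have hxR : ‖x‖ ≤ |R| := hx.le.trans (le_abs_self R)
  have hx2 : ‖x.2‖ ≤ |R| := (norm_snd_le x).trans hxR
  refine (norm_thetaDeriv_le k τ _ x).trans ?_
  rw [norm_thetaTerm]
  set g := μ + (l : 𝔱)
  have e1 : Real.exp (-(Real.pi * k * τ.im) * ‖g - x.2‖ ^ 2) ≤
      Real.exp (c * R ^ 2) * Real.exp (-(c / 2) * ‖g‖ ^ 2) := by
    rw [← Real.exp_add]
    refine Real.exp_le_exp.mpr ?_
    have h1 : ‖g‖ ≤ ‖g - x.2‖ + ‖x.2‖ := by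
      calc ‖g‖ = ‖g - x.2 + x.2‖ := by rw [sub_add_cancel]
        _ ≤ _ := norm_add_le _ _
    have h2 : ‖g‖ ^ 2 ≤ (‖g - x.2‖ + ‖x.2‖) ^ 2 := by gcongr
    have h3 : ‖x.2‖ ^ 2 ≤ R ^ 2 := by rw [← sq_abs R]; gcongr
    have h4 : ‖g‖ ^ 2 ≤ 2 * ‖g - x.2‖ ^ 2 + 2 * R ^ 2 := by
      nlinarith [sq_nonneg (‖g - x.2‖ - ‖x.2‖)]
    rw [← hcdef]
    nlinarith
  have e2 : 2 * ‖(τ : ℂ)‖ * (‖g‖ + ‖x‖) + 2 * ‖g‖ + ‖x‖ + ‖x‖ ≤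
      (2 * ‖(τ : ℂ)‖ * (1 + |R|) + 2 + |R| + |R|) * (1 + ‖g‖) := by
    have hg := norm_nonneg g
    have hR := abs_nonneg R
    have hτ := norm_nonneg (τ : ℂ)
    have b1 : ‖g‖ + ‖x‖ ≤ (1 + |R|) * (1 + ‖g‖) := by nlinarith
    have b2 : 2 * ‖(τ : ℂ)‖ * (‖g‖ + ‖x‖) ≤ 2 * ‖(τ : ℂ)‖ * ((1 + |R|) * (1 + ‖g‖)) := by gcongr
    nlinarith
  calc _ ≤ (Real.exp (c * R ^ 2) * Real.exp (-(c / 2) * ‖g‖ ^ 2)) * (Real.pi * k *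
      ((2 * ‖(τ : ℂ)‖ * (1 + |R|) + 2 + |R| + |R|) * (1 + ‖g‖))) := by gcongr
    _ = _ := by rw [hK]; ring

theorem thetaSec_hasFDerivAt (hk : 0 < k) (τ : ℍ) (μ : 𝔱) (x : 𝔱 × 𝔱) :
    DifferentiableAt ℝ (thetaSec Λ k τ μ) x ∧
    ∀ v, HasSum (fun l : Λ => thetaDeriv k τ (μ + l) x v) (fderiv ℝ (thetaSec Λ k τ μ) x v) := by
  obtain ⟨u, hu, hb⟩ := exists_bound_thetaTerm Λ hk τ μ (‖x‖ + 1)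
  have hx : x ∈ Metric.ball (0 : 𝔱 × 𝔱) (‖x‖ + 1) := by simp
  have h := differentiableAt_tsum_of_bound hu
    (fun (l : Λ) y _ => thetaTerm_hasFDerivAt k τ (μ + l) y) hb hx (summable_thetaTerm Λ hk τ μ x)
  rwa [← funext (thetaSec_eq_tsum Λ k τ μ)] at h

theorem isHolo_thetaSec (hk : 0 < k) (τ : ℍ) (μ : 𝔱) : IsHolo k τ (thetaSec Λ k τ μ) := by
  refine ⟨fun x => (thetaSec_hasFDerivAt Λ hk τ μ x).1, fun x w => ?_⟩
  obtain ⟨-, happ⟩ := thetaSec_hasFDerivAt Λ hk τ μ x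
  have hval : HasSum (fun l : Λ => thetaTerm k τ (μ + l) x) (thetaSec Λ k τ μ x) := by
    rw [thetaSec_eq_tsum]
    exact (summable_thetaTerm Λ hk τ μ x).hasSum
  have hcov : ∀ v : 𝔱 × 𝔱, HasSum (fun l : Λ => thetaDeriv k τ (μ + l) x v +
      ((k : ℂ) * (Real.pi / Complex.I) * ((⟪x.1, v.2⟫ : ℝ) - (⟪x.2, v.1⟫ : ℝ) : ℂ)) *
        thetaTerm k τ (μ + l) x) (covDeriv k (thetaSec Λ k τ μ) x v) := fun v =>
    (happ v).add (hval.mul_left _)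
  refine ((hcov (w, 0)).mul_left (τ : ℂ)).neg.add (hcov (0, w)) |>.unique ?_
  convert hasSum_zero using 1
  funext l
  simp only [thetaDeriv_apply, inner_zero_right, inner_sub_left]
  rw [Complex.div_I]
  push_cast
  ring

theorem thetaSec_add_mem {l : 𝔱} (hl : l ∈ Λ) (τ : ℍ) (μ : 𝔱) :
    thetaSec Λ k τ (μ + l) = thetaSec Λ k τ μ := by
  funext x
  rw [thetaSec_eq_tsum, thetaSec_eq_tsum, 
    ← (Equiv.addLeft (⟨l, hl⟩ : Λ)).tsum_eq fun l' : Λ => thetaTerm k τ (μ + l') x]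
  refine tsum_congr fun l' => ?_
  simp [add_assoc]

/-- Translation in `p` multiplies all terms by the same factor because the indices lie in `k⁻¹ Λ^*`;
translation in `q` shifts the summation index. -/
theorem isLatticeInvariant_thetaSec {Λ : Submodule ℤ 𝔱}
    (hint : ∀ l ∈ Λ, ∀ l' ∈ Λ, ∃ m : ℤ, ⟪l, l'⟫ = m) (τ : ℍ) {μ : 𝔱} (hμ : μ ∈ scaledDual Λ k) :
    IsLatticeInvariant Λ k (thetaSec Λ k τ μ) := by
  intro p hp q hq x
  have hdual : ∀ l : Λ, μ + l ∈ scaledDual Λ k := fun l => add_mem hμ fun l' hl' => by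
    obtain ⟨m, hm⟩ := hint l l.2 l' hl'
    exact ⟨k * m, by rw [inner_smul_left, hm]; simp⟩
  rw [thetaSec_eq_tsum, thetaSec_eq_tsum, smul_eq_mul, ← tsum_mul_left,
    ← (Equiv.addLeft (⟨q, hq⟩ : Λ)).tsum_eq fun l : Λ => thetaTerm k τ (μ + l) ((p, q) + x)]
  refine tsum_congr fun l => ?_
  rw [thetaTerm_add τ (hdual _) hp]
  congr 2
  simp only [Equiv.coe_addLeft, Submodule.coe_add]
  abel

theorem thetaSec_isometry (τ : ℍ) (μ : 𝔱) (w : 𝔱 ≃ₗᵢ[ℝ] 𝔱) (hw : ∀ l ∈ Λ, w l ∈ Λ)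
    (hw' : ∀ l ∈ Λ, w.symm l ∈ Λ) (x : 𝔱 × 𝔱) :
    thetaSec Λ k τ (w μ) (w x.1, w x.2) = thetaSec Λ k τ μ x := by
  let e : Λ ≃ Λ :=
    { toFun := fun l => ⟨w l, hw l l.2⟩
      invFun := fun l => ⟨w.symm l, hw' l l.2⟩
      left_inv := fun l => by simp
      right_inv := fun l => by simp }
  rw [thetaSec_eq_tsum, thetaSec_eq_tsum, ← e.tsum_eq]
  refine tsum_congr fun l => ?_
  rw [← thetaTerm_isometry k τ w (μ + l) x]
  simp [e]

end Theta

/-! ## Integration over a fundamental domain of a lattice -/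

section Domain

open MeasureTheory

variable {𝔱 : Type*} [NormedAddCommGroup 𝔱] [InnerProductSpace ℝ 𝔱]

open scoped RealInnerProductSpace Pointwise

variable [FiniteDimensional ℝ 𝔱] [MeasurableSpace 𝔱] [BorelSpace 𝔱]

theorem setIntegral_add_of_periodic {Λ : Submodule ℤ 𝔱} [Countable Λ] {D : Set 𝔱}
    (hD : IsAddFundamentalDomain Λ D) {f : 𝔱 → ℂ} (hf : ∀ l ∈ Λ, ∀ p, f (p + l) = f p) (a : 𝔱) :
    ∫ p in D, f (p + a) = ∫ p in D, f p := by
  have : MeasurableVAdd Λ 𝔱 := (inferInstance : MeasurableVAdd Λ.toAddSubgroup 𝔱)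
  have : VAddInvariantMeasure Λ 𝔱 volume :=
    (inferInstance : VAddInvariantMeasure Λ.toAddSubgroup 𝔱 volume)
  have hv : IsAddFundamentalDomain Λ (a +ᵥ D) := hD.vadd_of_comm a
  have h1 : ∫ p in (a +ᵥ D), f p = ∫ p in D, f p := hv.setIntegral_eq hD fun g x => by
    rw [Submodule.vadd_def, vadd_eq_add, add_comm]
    exact hf g g.2 x
  rw [← h1]
  have h2 : a +ᵥ D = (fun p => p + a) '' D := by
    simp only [add_comm _ a]
    rfl
  rw [h2, (measurePreserving_add_right volume a).setIntegral_image_emb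
    (measurableEmbedding_addRight a)]

/-- Cauchy's estimate on unit circles turns a bound of `g` on the ball of radius `2` into the same
bound of its derivative on the ball of radius `1`, which dominates the derivative under the
integral. -/
theorem differentiable_setIntegral {D : Set 𝔱} (hb : Bornology.IsBounded D)
    (hm : MeasurableSet D) {g : 𝔱 → ℂ → ℂ} (hg : Continuous (Function.uncurry g))
    (hd : ∀ p, Differentiable ℂ (g p)) : Differentiable ℂ fun z => ∫ p in D, g p z := by
  intro z₀
  obtain ⟨M, hM⟩ := (hb.isCompact_closure.prod (isCompact_closedBall z₀ 2)).exists_bound_of_continuousOn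
    hg.continuousOn
  have hfin : volume D < ⊤ := hb.measure_lt_top
  have hbd : ∀ p ∈ D, ∀ z ∈ Metric.ball z₀ 1, ‖deriv (g p) z‖ ≤ M := fun p hp z hz => by
    have := Complex.norm_deriv_le_of_forall_mem_sphere_norm_le (c := z) (C := M) one_pos
      (hd p).diffContOnCl fun w hw => hM (p, w) ⟨subset_closure hp, ?_⟩
    · simpa using this
    · rw [mem_closedBall_iff_norm]
      rw [mem_ball_iff_norm] at hz
      rw [mem_sphere_iff_norm] at hw
      calc ‖w - z₀‖ = ‖(w - z) + (z - z₀)‖ := by rw [sub_add_sub_cancel]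
        _ ≤ ‖w - z‖ + ‖z - z₀‖ := norm_add_le _ _
        _ ≤ 2 := by linarith
  have hcont : ∀ z, Continuous fun p => g p z := fun z =>
    hg.comp (continuous_id.prodMk continuous_const)
  refine (hasDerivAt_integral_of_dominated_loc_of_deriv_le (bound := fun _ => M)
    (F := fun z p => g p z) (F' := fun z p => deriv (g p) z)
    (Metric.ball_mem_nhds z₀ one_pos)
    (Filter.Eventually.of_forall fun z => (hcont z).aestronglyMeasurable) ?_ ?_ ?_ ?_ ?_).2.differentiableAt
  · exact ((hcont z₀).continuousOn.integrableOn_compact hb.isCompact_closure).mono_set subset_closure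
  · exact ((stronglyMeasurable_deriv_with_param hg).comp_measurable
      measurable_prodMk_right).aestronglyMeasurable
  · exact (ae_restrict_iff' hm).mpr (Filter.Eventually.of_forall fun p hp z hz => hbd p hp z hz)
  · exact integrableOn_const hfin.ne
  · exact Filter.Eventually.of_forall fun p z _ => (hd p z).hasDerivAt

/-- A continuous periodic function whose Fourier coefficients vanish is zero. -/
theorem eq_zero_of_fourier_eq_zero {ι : Type*} [Fintype ι] (b : Module.Basis ι ℝ 𝔱)
    {f : 𝔱 → ℂ} (hc : Continuous f) (hf : ∀ i, ∀ p, f (p + b i) = f p)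
    (h : ∀ γ : 𝔱, (∀ i, ∃ m : ℤ, ⟪γ, b i⟫ = m) →
      ∫ p in ZSpan.fundamentalDomain b, f p * Complex.exp (2 * Real.pi * Complex.I * (⟪γ, p⟫ : ℝ)) = 0) :
    f = 0 := by
  classical
  let e : (ι → ℝ) ≃L[ℝ] 𝔱 := b.equivFun.symm.toContinuousLinearEquiv
  have he : ∀ y, e y = ∑ i, y i • b i := fun y => b.equivFun_symm_apply y
  -- the function on the torus
  have hper : ∀ (z : ι → ℤ) (p : 𝔱), f (p + ∑ i, (z i : ℝ) • b i) = f p := by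
    intro z p
    have hz : ∀ i, ∀ (m : ℤ) (p : 𝔱), f (p + (m : ℝ) • b i) = f p := fun i m p => by
      have hp : Function.Periodic f (b i) := hf i
      rw [Int.cast_smul_eq_zsmul]
      exact hp.zsmul m p
    have : ∀ (s : Finset ι) (p : 𝔱), f (p + ∑ i ∈ s, (z i : ℝ) • b i) = f p := by
      intro s
      induction s using Finset.induction_on with
      | empty => simp
      | insert i s hi ih =>
        intro p
        rw [Finset.sum_insert hi, ← add_assoc, ih, hz]
    exact this _ p
  let π : C(ι → ℝ, UnitAddTorus ι) := ⟨fun y i => (y i : UnitAddCircle), by fun_prop⟩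
  have hπ : IsOpenQuotientMap π :=
    IsOpenQuotientMap.piMap fun _ => QuotientAddGroup.isOpenQuotientMap_mk
  have hlift : Function.FactorsThrough (fun y => f (e y)) π := by
    intro y y' hyy
    have : ∀ i, ∃ m : ℤ, y i = y' i + m := fun i => by
      have h1 : (y i : UnitAddCircle) = y' i := congrFun hyy i
      obtain ⟨m, hm⟩ := (QuotientAddGroup.eq_iff_sub_mem.mp h1)
      exact ⟨m, by simp at hm; linarith⟩
    choose z hz using this
    change f (e y) = f (e y')
    rw [he, he, ← hper z (∑ i, y' i • b i), ← Finset.sum_add_distrib]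
    congr 1
    exact Finset.sum_congr rfl fun i _ => by rw [hz i, add_smul]
  let F : C(UnitAddTorus ι, ℂ) :=
    hπ.isQuotientMap.lift ⟨fun y => f (e y), hc.comp e.continuous⟩ hlift
  have hF : ∀ y, F (π y) = f (e y) := fun y =>
    congrFun (congrArg DFunLike.coe (hπ.isQuotientMap.lift_comp ⟨fun y => f (e y), hc.comp e.continuous⟩ hlift)) y
  have hcoeff : UnitAddTorus.mFourierCoeff F = 0 := by
    funext m
    -- the dual vector
    let φ : 𝔱 →ₗ[ℝ] ℝ := b.constr ℝ fun i => -(m i : ℝ)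
    let γ : 𝔱 := (InnerProductSpace.toDual ℝ 𝔱).symm (LinearMap.toContinuousLinearMap φ)
    have hγ : ∀ p, ⟪γ, p⟫ = φ p := fun p => by
      simp [γ]
    have hγb : ∀ i, ⟪γ, b i⟫ = -(m i : ℝ) := fun i => by
      rw [hγ, b.constr_basis]
    have h1 := h γ fun i => ⟨-(m i), by rw [hγb]; simp⟩
    have : (Measure.map e (volume : Measure (ι → ℝ))).IsAddHaarMeasure := e.isAddHaarMeasure_map _
    have hcv := Measure.isAddLeftInvariant_eq_smul (Measure.map e volume) (volume : Measure 𝔱)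
    rw [UnitAddTorus.mFourierCoeff_eq_integral F m 0]
    -- The two half-open cubes differ only by faces, which are null sets.
    have hset : ({x : ι → ℝ | ∀ i, x i ∈ Set.Ioc ((0 : ι → ℝ) i) ((0 : ι → ℝ) i + 1)} : Set (ι → ℝ))
        =ᵐ[volume] e ⁻¹' ZSpan.fundamentalDomain b := by
      have e1 : ({x : ι → ℝ | ∀ i, x i ∈ Set.Ioc ((0 : ι → ℝ) i) ((0 : ι → ℝ) i + 1)} : Set (ι → ℝ)) =
          Set.pi Set.univ fun i => Set.Ioc ((0 : ι → ℝ) i) ((1 : ι → ℝ) i) := by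
        ext; simp [Set.mem_pi]
      have e2 : e ⁻¹' ZSpan.fundamentalDomain b =
          Set.pi Set.univ fun i => Set.Ico ((0 : ι → ℝ) i) ((1 : ι → ℝ) i) := by
        ext y
        have : ∀ i, b.repr (e y) i = y i := fun i => by
          rw [← b.equivFun_apply]
          exact congrFun (b.equivFun.apply_symm_apply y) i
        simp [ZSpan.mem_fundamentalDomain, this, Set.mem_pi]
      rw [e1, e2]
      exact Measure.univ_pi_Ioc_ae_eq_Icc.trans Measure.univ_pi_Ico_ae_eq_Icc.symm
    rw [setIntegral_congr_set hset]
    have hmeas : MeasurableSet (ZSpan.fundamentalDomain b) := ZSpan.fundamentalDomain_measurableSet b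
    have h2 : ∫ y in e ⁻¹' ZSpan.fundamentalDomain b, f (e y) *
        Complex.exp (2 * Real.pi * Complex.I * (⟪γ, e y⟫ : ℝ)) = 0 := by
      have := e.toHomeomorph.measurableEmbedding.setIntegral_map (μ := volume)
        (fun p => f p * Complex.exp (2 * Real.pi * Complex.I * (⟪γ, p⟫ : ℝ)))
        (ZSpan.fundamentalDomain b)
      refine Eq.trans this.symm ?_
      change ∫ y in _, _ ∂(Measure.map e volume) = 0
      rw [hcv, Measure.restrict_smul, integral_smul_nnreal_measure, h1, smul_zero]
    rw [Pi.zero_apply, ← h2]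
    refine setIntegral_congr_fun (e.continuous.measurable hmeas) fun y _ => ?_
    change UnitAddTorus.mFourier (-m) (π y) • F (π y) = _
    rw [hF, smul_eq_mul, mul_comm]
    congr 1
    have hφ : ⟪γ, e y⟫ = ∑ i, y i * -(m i : ℝ) := by
      rw [he, inner_sum]
      exact Finset.sum_congr rfl fun i _ => by rw [inner_smul_right, hγb]
    rw [hφ]
    change ∏ i, fourier ((-m) i) ((y i : ℝ) : UnitAddCircle) = _
    simp only [fourier_coe_apply]
    rw [← Complex.exp_sum]
    congr 1
    push_cast
    rw [Finset.mul_sum]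
    refine Finset.sum_congr rfl fun i _ => ?_
    simp
    ring
  funext p
  have h3 := UnitAddTorus.hasSum_mFourier_series_apply_of_summable (f := F)
    (by rw [hcoeff]; exact summable_zero) (π (e.symm p))
  rw [hcoeff] at h3
  simp only [Pi.zero_apply, zero_smul] at h3
  have h4 := h3.unique hasSum_zero
  rw [hF, e.apply_symm_apply] at h4
  simpa using h4

end Domain

/-! ## Fourier coefficients of holomorphic sections -/

section Coefficients

open MeasureTheory

variable {𝔱 : Type*} [NormedAddCommGroup 𝔱] [InnerProductSpace ℝ 𝔱]

open scoped RealInnerProductSpace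

theorem thetaTerm_ne_zero (k : ℕ) (τ : ℍ) (γ : 𝔱) (x : 𝔱 × 𝔱) : thetaTerm k τ γ x ≠ 0 :=
  Complex.exp_ne_zero _

theorem continuous_thetaTerm (k : ℕ) (τ : ℍ) (γ : 𝔱) : Continuous (thetaTerm k τ γ) :=
  continuous_iff_continuousAt.mpr fun x => (thetaTerm_hasFDerivAt k τ γ x).continuousAt

/-- The quotient of a section by a theta term. -/
def thetaQuot (k : ℕ) (τ : ℍ) (γ : 𝔱) (F : 𝔱 × 𝔱 → ℂ) (x : 𝔱 × 𝔱) : ℂ :=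
  F x * (thetaTerm k τ γ x)⁻¹

theorem thetaQuot_add {Λ : Submodule ℤ 𝔱} {k : ℕ} {τ : ℍ} {F : 𝔱 × 𝔱 → ℂ}
    (hF : IsLatticeInvariant Λ k F) {γ : 𝔱} (hγ : γ ∈ scaledDual Λ k) {l m : 𝔱} (hl : l ∈ Λ)
    (hm : m ∈ Λ) (x : 𝔱 × 𝔱) :
    thetaQuot k τ γ F ((l, m) + x) = thetaQuot k τ (γ - m) F x := by
  have h0 : latticeFactor (l, m) x ^ k ≠ 0 :=
    pow_ne_zero _ (mul_ne_zero (Complex.exp_ne_zero _) (Complex.exp_ne_zero _))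
  rw [thetaQuot, thetaQuot, hF l hl m hm, thetaTerm_add τ hγ hl, smul_eq_mul, mul_inv]
  field_simp

/-- The theta term satisfies the same equation as a holomorphic section, so the connection terms
cancel in the quotient and the ordinary Cauchy–Riemann equation in `ζ` remains. -/
theorem differentiable_thetaQuot {k : ℕ} {τ : ℍ} {F : 𝔱 × 𝔱 → ℂ} (hF : IsHolo k τ F) (γ : 𝔱) :
    Differentiable ℝ (thetaQuot k τ γ F) ∧
    ∀ (x : 𝔱 × 𝔱) (w : 𝔱), fderiv ℝ (thetaQuot k τ γ F) x (0, w) =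
      τ * fderiv ℝ (thetaQuot k τ γ F) x (w, 0) := by
  have key : ∀ x, HasFDerivAt (thetaQuot k τ γ F)
      (F x • (-(thetaTerm k τ γ x ^ 2)⁻¹ • thetaDeriv k τ γ x) +
        (thetaTerm k τ γ x)⁻¹ • fderiv ℝ F x) x := fun x =>
    (hF.1 x).hasFDerivAt.mul ((hasDerivAt_inv (thetaTerm_ne_zero k τ γ x)).comp_hasFDerivAt x
      (thetaTerm_hasFDerivAt k τ γ x))
  refine ⟨fun x => (key x).differentiableAt, fun x w => ?_⟩
  rw [(key x).fderiv]
  have h1 := hF.2 x w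
  have hne := thetaTerm_ne_zero k τ γ x
  simp only [covDeriv, inner_zero_right, Complex.div_I, smul_eq_mul] at h1
  simp only [FunLike.coe_add, Pi.add_apply, FunLike.coe_smul, Pi.smul_apply, smul_eq_mul,
    thetaDeriv_apply, inner_zero_right, inner_sub_left]
  field_simp
  push_cast at h1 ⊢
  linear_combination h1

/-- A function of `(p, q)` that is holomorphic in `p + τ q` is holomorphic along complex lines. -/
theorem differentiable_comp_line {E : Type*} [NormedAddCommGroup E] [NormedSpace ℝ E] {τ : ℍ}
    {h : E × E → ℂ} (hd : Differentiable ℝ h)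
    (hh : ∀ x w, fderiv ℝ h x (0, w) = τ * fderiv ℝ h x (w, 0)) (p w : E) :
    Differentiable ℂ fun z : ℂ => h (p + (z.re - τ.re * (z.im / τ.im)) • w, (z.im / τ.im) • w) := by
  have him : (τ.im : ℝ) ≠ 0 := τ.im_pos.ne'
  -- The real coordinates `(s, t)` of `z = s + τ t` are `t = Im z / Im τ` and `s = Re z - t Re τ`.
  let A : ℂ →L[ℝ] E × E :=
    ((Complex.reCLM - τ.re • τ.im⁻¹ • Complex.imCLM).smulRight w).prod
      ((τ.im⁻¹ • Complex.imCLM).smulRight w)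
  have hA : ∀ z : ℂ, A z = ((z.re - τ.re * (z.im / τ.im)) • w, (z.im / τ.im) • w) := fun z => by
    simp [A, div_eq_inv_mul]
  have hfun : (fun z : ℂ => h (p + (z.re - τ.re * (z.im / τ.im)) • w, (z.im / τ.im) • w)) =
      fun z => h ((p, 0) + A z) := by
    funext z
    rw [hA]
    simp
  rw [hfun]
  intro z
  have hder : HasFDerivAt (fun z => h ((p, 0) + A z)) (fderiv ℝ h ((p, 0) + A z) ∘L A) z :=
    (hd _).hasFDerivAt.comp z (A.hasFDerivAt.const_add (p, 0))
  refine differentiableAt_complex_iff_differentiableAt_real.mpr ⟨hder.differentiableAt, ?_⟩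
  rw [hder.fderiv, ContinuousLinearMap.comp_apply, ContinuousLinearMap.comp_apply]
  have e1 : A 1 = (w, 0) := by rw [hA]; simp
  have eI : A Complex.I = τ.im⁻¹ • (0, w) - (τ.re * τ.im⁻¹) • (w, 0) := by
    rw [hA]
    ext <;> simp
  rw [e1, eI, map_sub, map_smul, map_smul, hh]
  have hτ : (τ : ℂ) = τ.re + τ.im * Complex.I := (Complex.re_add_im _).symm
  have him' : ((τ.im : ℝ) : ℂ) ≠ 0 := by exact_mod_cast him
  rw [hτ]
  simp only [Complex.real_smul, smul_eq_mul]
  push_cast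
  field_simp
  ring

variable [FiniteDimensional ℝ 𝔱] [MeasurableSpace 𝔱] [BorelSpace 𝔱]

section Slice

variable {Λ : Submodule ℤ 𝔱} [Countable Λ] {D : Set 𝔱}

/-- Along the complex line in the direction `q`, the integral over a period in `p` is an entire
function of `z`. A real shift of `z` only translates `p`, so the function is invariant under it and
has zero derivative. The values at `z = τ` and `z = 0` are the two sides. -/
theorem setIntegral_slice (hD : IsAddFundamentalDomain Λ D) (hb : Bornology.IsBounded D)
    (hm : MeasurableSet D) {τ : ℍ} {h : 𝔱 × 𝔱 → ℂ} (hd : Differentiable ℝ h)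
    (hh : ∀ x w, fderiv ℝ h x (0, w) = τ * fderiv ℝ h x (w, 0))
    (hper : ∀ l ∈ Λ, ∀ p q, h (p + l, q) = h (p, q)) (q : 𝔱) :
    ∫ p in D, h (p, q) = ∫ p in D, h (p, 0) := by
  have him : (τ.im : ℝ) ≠ 0 := τ.im_pos.ne'
  let g : 𝔱 → ℂ → ℂ := fun p z => h (p + (z.re - τ.re * (z.im / τ.im)) • q, (z.im / τ.im) • q)
  have hg : Continuous (Function.uncurry g) := by
    refine hd.continuous.comp ?_
    fun_prop
  have hC := differentiable_setIntegral hb hm hg fun p => differentiable_comp_line hd hh p q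
  set C : ℂ → ℂ := fun z => ∫ p in D, g p z with hCdef
  have hshift : ∀ (z : ℂ) (s : ℝ), C (z + s) = C z := by
    intro z s
    rw [hCdef]
    simp only
    rw [← setIntegral_add_of_periodic hD (f := fun p => g p z) (fun l hl p => ?_) (s • q)]
    · refine setIntegral_congr_fun hm fun p _ => ?_
      simp only [g]
      congr 2
      · rw [add_assoc, ← add_smul]
        congr 2
        simp
        ring
      · simp
    · simp only [g]
      rw [add_right_comm, hper l hl]
  have hder : ∀ z, deriv C z = 0 := by
    intro z
    have h1 : HasDerivAt (fun s : ℝ => C (z + s)) (deriv C z) 0 := by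
      have := (hC (z + (0 : ℝ))).hasDerivAt
      rw [Complex.ofReal_zero, add_zero] at this
      have h2 : HasDerivAt (fun s : ℝ => z + (s : ℂ)) 1 0 :=
        (Complex.ofRealCLM.hasDerivAt (x := (0 : ℝ))).const_add z
      have h3 := HasDerivAt.comp (0 : ℝ) (h₂ := C) (h := fun s : ℝ => z + (s : ℂ)) (h₂' := deriv C z)
        (by simpa using this) h2
      rw [mul_one] at h3
      exact h3
    have h2 : (fun s : ℝ => C (z + s)) = fun _ => C z := funext (hshift z)
    rw [h2] at h1
    exact h1.unique (hasDerivAt_const _ _)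
  have := is_const_of_deriv_eq_zero hC hder τ 0
  simp only [hCdef, g] at this
  have e1 : (τ : ℂ).im = τ.im := rfl
  have e2 : (τ : ℂ).re = τ.re := rfl
  rw [e1, e2, div_self him] at this
  simpa using this

end Slice

variable (Λ : Submodule ℤ 𝔱) [DiscreteTopology Λ] [IsZLattice ℝ Λ] {k : ℕ}

/-- A fundamental domain of the lattice `Λ`. -/
def domain : Set 𝔱 := ZSpan.fundamentalDomain ((Module.Free.chooseBasis ℤ Λ).ofZLatticeBasis ℝ Λ)

theorem isAddFundamentalDomain_domain : IsAddFundamentalDomain Λ (domain Λ) :=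
  ZLattice.isAddFundamentalDomain _ _

theorem measurableSet_domain : MeasurableSet (domain Λ) := ZSpan.fundamentalDomain_measurableSet _

theorem isBounded_domain : Bornology.IsBounded (domain Λ) := ZSpan.fundamentalDomain_isBounded _

/-- The Fourier coefficient of a section along `q = 0`, relative to a theta term. -/
def coeff (k : ℕ) (τ : ℍ) (γ : 𝔱) (F : 𝔱 × 𝔱 → ℂ) : ℂ :=
  ((ZLattice.covolume Λ : ℝ) : ℂ)⁻¹ * ∫ p in domain Λ, thetaQuot k τ γ F (p, 0)

theorem integrableOn_domain {f : 𝔱 → ℂ} (hf : Continuous f) : IntegrableOn f (domain Λ) :=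
  (hf.continuousOn.integrableOn_compact (isBounded_domain Λ).isCompact_closure).mono_set
    subset_closure

theorem continuous_thetaQuot {τ : ℍ} {F : 𝔱 × 𝔱 → ℂ} (hF : Continuous F) (γ : 𝔱) :
    Continuous (thetaQuot k τ γ F) :=
  hF.mul ((continuous_thetaTerm k τ γ).inv₀ (thetaTerm_ne_zero k τ γ))

theorem coeff_add {τ : ℍ} (γ : 𝔱) {F G : 𝔱 × 𝔱 → ℂ} (hF : Continuous F) (hG : Continuous G) :
    coeff Λ k τ γ (F + G) = coeff Λ k τ γ F + coeff Λ k τ γ G := by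
  have hp : Continuous fun p : 𝔱 => (p, (0 : 𝔱)) := continuous_id.prodMk continuous_const
  have h := integral_add
    (integrableOn_domain Λ ((continuous_thetaQuot (k := k) (τ := τ) hF γ).comp hp))
    (integrableOn_domain Λ ((continuous_thetaQuot (k := k) (τ := τ) hG γ).comp hp))
  simp only [Function.comp_apply] at h
  rw [coeff, coeff, coeff, ← mul_add, ← h]
  simp [thetaQuot, add_mul]

theorem coeff_smul {τ : ℍ} (γ : 𝔱) (c : ℂ) (F : 𝔱 × 𝔱 → ℂ) :
    coeff Λ k τ γ (c • F) = c * coeff Λ k τ γ F := by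
  rw [coeff, coeff, mul_left_comm, ← integral_const_mul c]
  simp only [thetaQuot, mul_assoc, Pi.smul_apply, smul_eq_mul]

variable {Λ}

theorem integral_thetaQuot_slice {τ : ℍ} {F : 𝔱 × 𝔱 → ℂ} (hF : F ∈ H ℂ Λ k τ) {γ : 𝔱}
    (hγ : γ ∈ scaledDual Λ k) (q : 𝔱) :
    ∫ p in domain Λ, thetaQuot k τ γ F (p, q) = ∫ p in domain Λ, thetaQuot k τ γ F (p, 0) := by
  obtain ⟨hd, hh⟩ := differentiable_thetaQuot hF.2 γ
  refine setIntegral_slice (isAddFundamentalDomain_domain Λ) (isBounded_domain Λ)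
    (measurableSet_domain Λ) hd hh (fun l hl p q => ?_) q
  have := thetaQuot_add (τ := τ) hF.1 hγ hl Λ.zero_mem (p, q)
  rw [sub_zero] at this
  rw [← this]
  simp [add_comm]

/-- Shifting the index by `l` is the same as moving to the slice `q = l`, and the integral does not
depend on the slice. -/
theorem coeff_sub_mem {τ : ℍ} {F : 𝔱 × 𝔱 → ℂ} (hF : F ∈ H ℂ Λ k τ) {γ : 𝔱}
    (hγ : γ ∈ scaledDual Λ k) {l : 𝔱} (hl : l ∈ Λ) :
    coeff Λ k τ (γ - l) F = coeff Λ k τ γ F := by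
  rw [coeff, coeff, ← integral_thetaQuot_slice hF hγ l]
  congr 1
  refine setIntegral_congr_fun (measurableSet_domain Λ) fun p _ => ?_
  have := thetaQuot_add (τ := τ) hF.1 hγ Λ.zero_mem hl (p, 0)
  simpa using this.symm

/-- On each slice `q` constant, the Fourier coefficients of the periodic function `thetaQuot k τ 0
F` are constant multiples of the coefficients of `F`, so the function vanishes slice by slice. -/
theorem eq_zero_of_coeff_eq_zero (hk : 0 < k) {τ : ℍ} {F : 𝔱 × 𝔱 → ℂ} (hF : F ∈ H ℂ Λ k τ)
    (h : ∀ γ ∈ scaledDual Λ k, coeff Λ k τ γ F = 0) : F = 0 := by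
  have hV : ((ZLattice.covolume Λ : ℝ) : ℂ)⁻¹ ≠ 0 := by
    exact_mod_cast inv_ne_zero (ZLattice.covolume_ne_zero Λ volume)
  have hk' : (k : ℝ) ≠ 0 := by exact_mod_cast hk.ne'
  have hcont : Continuous (thetaQuot k τ 0 F) := continuous_thetaQuot hF.2.1.continuous 0
  set b := (Module.Free.chooseBasis ℤ Λ).ofZLatticeBasis ℝ Λ with hb
  have hbΛ : Submodule.span ℤ (Set.range b) = Λ := Module.Basis.ofZLatticeBasis_span _ _ _
  have hmain : ∀ q, (fun p => thetaQuot k τ 0 F (p, q)) = 0 := by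
    intro q
    refine eq_zero_of_fourier_eq_zero b (hcont.comp (continuous_id.prodMk continuous_const))
      (fun i p => ?_) fun γ hγ => ?_
    · have hi : b i ∈ Λ := hbΛ.le (Submodule.subset_span ⟨i, rfl⟩)
      have := thetaQuot_add (τ := τ) hF.1 (scaledDual Λ k).zero_mem hi Λ.zero_mem (p, q)
      rw [sub_zero] at this
      rw [← this]
      simp [add_comm]
    · have hmem : (k : ℝ)⁻¹ • γ ∈ scaledDual Λ k := by
        intro l hl
        rw [smul_inv_smul₀ hk']
        replace hl := hbΛ.ge hl
        induction hl using Submodule.span_induction with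
        | mem x hx =>
          obtain ⟨i, rfl⟩ := hx
          exact hγ i
        | zero => exact ⟨0, by simp⟩
        | add x y _ _ hx hy =>
          obtain ⟨m, hm⟩ := hx
          obtain ⟨m', hm'⟩ := hy
          exact ⟨m + m', by rw [inner_add_right, hm, hm']; push_cast; ring⟩
        | smul c x _ hx =>
          obtain ⟨m, hm⟩ := hx
          exact ⟨c * m, by rw [← Int.cast_smul_eq_zsmul ℝ, inner_smul_right, hm]; push_cast; ring⟩
      have h1 := h _ hmem
      rw [coeff, ← integral_thetaQuot_slice hF hmem q] at h1
      have h2 := (mul_eq_zero.mp h1).resolve_left hV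
      have hk'' : (k : ℂ) ≠ 0 := by exact_mod_cast hk'
      -- With `q` fixed, the theta terms of indices `γ / k` and `0` differ by a character of `p` and
      -- this factor independent of `p`.
      set c := Complex.exp (Complex.I * Real.pi * k * (τ * ((⟪(k : ℝ)⁻¹ • γ - q, (k : ℝ)⁻¹ • γ - q⟫ : ℝ)
        - (⟪q, q⟫ : ℝ)))) with hc
      have h3 : ∀ p, thetaQuot k τ 0 F (p, q) *
          Complex.exp (2 * Real.pi * Complex.I * (⟪γ, p⟫ : ℝ)) =
          c * thetaQuot k τ ((k : ℝ)⁻¹ • γ) F (p, q) := fun p => by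
        rw [thetaQuot, thetaQuot, mul_left_comm, mul_assoc]
        congr 1
        rw [thetaTerm, thetaTerm, hc, ← Complex.exp_neg, ← Complex.exp_neg, ← Complex.exp_add,
          ← Complex.exp_add]
        congr 1
        simp only [inner_smul_right, inner_zero_right, real_inner_comm p γ, zero_sub, inner_neg_neg]
        push_cast
        field_simp
        ring
      change ∫ p in domain Λ, _ = 0
      simp only [h3]
      rw [integral_const_mul, h2, mul_zero]
  funext x
  have := congrFun (hmain x.2) x.1
  simp only [Pi.zero_apply, thetaQuot] at this
  exact (mul_eq_zero.mp this).resolve_right (inv_ne_zero (thetaTerm_ne_zero _ _ _ _))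

theorem integral_character (hk : 0 < k) {ν : 𝔱} (hν : ν ∈ scaledDual Λ k) (h0 : ν ≠ 0) :
    ∫ p in domain Λ, Complex.exp (2 * Real.pi * Complex.I * k * (⟪ν, p⟫ : ℝ)) = 0 := by
  have hk' : (k : ℝ) ≠ 0 := by exact_mod_cast hk.ne'
  have hk'' : (k : ℂ) ≠ 0 := by exact_mod_cast hk'
  have hn : ⟪ν, ν⟫ ≠ 0 := inner_self_ne_zero.mpr h0
  -- Half a period: `k ⟪ν, a⟫ = 1/2`, so translation by `a` changes the sign of the character.
  set a : 𝔱 := (2 * k * ⟪ν, ν⟫ : ℝ)⁻¹ • ν with ha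
  have h1 := setIntegral_add_of_periodic (isAddFundamentalDomain_domain Λ)
    (f := fun p => Complex.exp (2 * Real.pi * Complex.I * k * (⟪ν, p⟫ : ℝ))) (fun l hl p => ?_) a
  · have h2 : ∀ p, Complex.exp (2 * Real.pi * Complex.I * k * (⟪ν, p + a⟫ : ℝ)) =
        -1 * Complex.exp (2 * Real.pi * Complex.I * k * (⟪ν, p⟫ : ℝ)) := fun p => by
      rw [← Complex.exp_pi_mul_I, ← Complex.exp_add]
      congr 1
      rw [inner_add_right, ha, inner_smul_right]
      have : ((2 * k * ⟪ν, ν⟫ : ℝ)⁻¹ * ⟪ν, ν⟫ : ℝ) = (2 * k : ℝ)⁻¹ := by field_simp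
      rw [this]
      push_cast
      field_simp
      ring
    simp only [h2] at h1
    rw [integral_const_mul] at h1
    linear_combination (-1 / 2 : ℂ) * h1
  · obtain ⟨m, hm⟩ := hν l hl
    rw [inner_smul_left, RCLike.conj_to_real] at hm
    rw [Complex.exp_eq_exp_iff_exists_int]
    refine ⟨m, ?_⟩
    have hm' : (k : ℂ) * (⟪ν, l⟫ : ℝ) = m := by exact_mod_cast hm
    rw [inner_add_right]
    push_cast
    linear_combination (2 * Real.pi * Complex.I) * hm'

theorem coeff_thetaTerm (hk : 0 < k) (τ : ℍ) {γ ν : 𝔱} (h : ν - γ ∈ scaledDual Λ k) [Decidable (ν = γ)] :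
    coeff Λ k τ γ (thetaTerm k τ ν) = if ν = γ then 1 else 0 := by
  have hV : ((ZLattice.covolume Λ : ℝ) : ℂ) ≠ 0 := by
    exact_mod_cast ZLattice.covolume_ne_zero Λ volume
  rw [coeff]
  split_ifs with he
  · subst he
    have : ∀ p : 𝔱, thetaQuot k τ ν (thetaTerm k τ ν) (p, 0) = 1 := fun p =>
      mul_inv_cancel₀ (thetaTerm_ne_zero _ _ _ _)
    simp only [this]
    rw [integral_const, ZLattice.covolume_eq_measure_fundamentalDomain Λ volume
      (isAddFundamentalDomain_domain Λ)] at *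
    simpa using inv_mul_cancel₀ hV
  · have h' : γ - ν ∈ scaledDual Λ k := by simpa using neg_mem h
    have h1 := integral_character hk h' (sub_ne_zero.mpr (Ne.symm he))
    have h2 : ∀ p : 𝔱, thetaQuot k τ γ (thetaTerm k τ ν) (p, 0) =
        Complex.exp (Complex.I * Real.pi * k * (τ * ((⟪ν, ν⟫ : ℝ) - (⟪γ, γ⟫ : ℝ)))) *
          Complex.exp (2 * Real.pi * Complex.I * k * (⟪γ - ν, p⟫ : ℝ)) := fun p => by
      rw [thetaQuot, thetaTerm, thetaTerm, ← Complex.exp_neg, ← Complex.exp_add, ← Complex.exp_add]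
      congr 1
      simp only [sub_zero, inner_sub_left, inner_zero_right, real_inner_comm p ν, real_inner_comm p γ]
      push_cast
      ring
    simp only [h2]
    rw [integral_const_mul, h1, mul_zero, mul_zero]

theorem coeff_thetaSec (hk : 0 < k) (hint : ∀ l ∈ Λ, ∀ l' ∈ Λ, ∃ m : ℤ, ⟪l, l'⟫ = m) (τ : ℍ)
    {γ μ : 𝔱} (hγ : γ ∈ scaledDual Λ k) (hμ : μ ∈ scaledDual Λ k) [Decidable (γ - μ ∈ Λ)] :
    coeff Λ k τ γ (thetaSec Λ k τ μ) = if γ - μ ∈ Λ then 1 else 0 := by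
  classical
  have hp : Continuous fun p : 𝔱 => (p, (0 : 𝔱)) := continuous_id.prodMk continuous_const
  have hΛ : ∀ l ∈ Λ, l ∈ scaledDual Λ k := fun l hl l' hl' => by
    obtain ⟨m, hm⟩ := hint l hl l' hl'
    exact ⟨k * m, by rw [inner_smul_left, hm]; simp⟩
  have hterm : ∀ l : Λ, coeff Λ k τ γ (thetaTerm k τ (μ + l)) = if μ + l = γ then 1 else 0 :=
    fun l => coeff_thetaTerm hk τ (sub_mem (add_mem hμ (hΛ l l.2)) hγ)
  have hsum : HasSum (fun l : Λ => coeff Λ k τ γ (thetaTerm k τ (μ + l)))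
      (coeff Λ k τ γ (thetaSec Λ k τ μ)) := by
    have h1 := hasSum_integral_of_summable_integral_norm
      (μ := volume.restrict (domain Λ))
      (F := fun (l : Λ) p => thetaQuot k τ γ (thetaTerm k τ (μ + l)) (p, 0))
      (fun l => integrableOn_domain Λ
        ((continuous_thetaQuot (continuous_thetaTerm k τ _) γ).comp hp)) ?_
    · have h2 := h1.mul_left ((ZLattice.covolume Λ : ℝ) : ℂ)⁻¹
      refine Eq.subst (motive := HasSum _) ?_ h2
      refine congrArg _ (integral_congr_ae (Filter.Eventually.of_forall fun p => ?_))
      simp only [thetaQuot]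
      rw [thetaSec_eq_tsum, tsum_mul_right]
    · have hn : ∀ (l : Λ) (p : 𝔱), ‖thetaQuot k τ γ (thetaTerm k τ (μ + l)) (p, 0)‖ =
          Real.exp (-(Real.pi * k * τ.im) * ‖μ + l‖ ^ 2) *
            (Real.exp (-(Real.pi * k * τ.im) * ‖γ‖ ^ 2))⁻¹ := fun l p => by
        rw [thetaQuot, norm_mul, norm_inv, norm_thetaTerm, norm_thetaTerm, sub_zero, sub_zero]
      simp only [hn, integral_const]
      have hc : 0 < Real.pi * k * τ.im := by
        have := τ.im_pos
        have := Real.pi_pos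
        positivity
      exact ((summable_gaussian Λ hc μ).mul_right _).const_smul _
  simp only [hterm] at hsum
  refine hsum.unique ?_
  split_ifs with h
  · have e : ∀ l : Λ, (μ + l = γ) ↔ l = ⟨γ - μ, h⟩ := fun l => by
      rw [Subtype.ext_iff, eq_sub_iff_add_eq, add_comm]
    simp only [e]
    exact hasSum_ite_eq _ _
  · have e : ∀ l : Λ, ¬ (μ + l = γ) := fun l hl => h (by rw [← hl]; simp)
    simp only [e, if_false]
    exact hasSum_zero

end Coefficients

/-! ## Theta functions form bases of the spaces of holomorphic sections -/

section ThetaBasis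

open MeasureTheory

variable {𝔱 : Type*} [NormedAddCommGroup 𝔱] [InnerProductSpace ℝ 𝔱]

open scoped RealInnerProductSpace

/-- A lattice whose vectors have even square lengths. -/
def IsEvenLattice (Λ : Submodule ℤ 𝔱) : Prop := ∀ l ∈ Λ, ∃ m : ℤ, ⟪l, l⟫ = 2 * (m : ℝ)

theorem IsEvenLattice.integral {Λ : Submodule ℤ 𝔱} (h : IsEvenLattice Λ) :
    ∀ l ∈ Λ, ∀ l' ∈ Λ, ∃ m : ℤ, ⟪l, l'⟫ = m := by
  intro l hl l' hl'
  obtain ⟨a, ha⟩ := h l hl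
  obtain ⟨b, hb⟩ := h l' hl'
  obtain ⟨c, hc⟩ := h (l + l') (add_mem hl hl')
  refine ⟨c - a - b, ?_⟩
  rw [inner_add_left, inner_add_right, inner_add_right, ha, hb, real_inner_comm l l'] at hc
  push_cast
  linarith

theorem IsEvenLattice.le_scaledDual {Λ : Submodule ℤ 𝔱} (h : IsEvenLattice Λ) (k : ℕ) :
    Λ ≤ scaledDual Λ k := fun l hl l' hl' => by
  obtain ⟨m, hm⟩ := h.integral l hl l' hl'
  exact ⟨k * m, by rw [inner_smul_left, hm]; simp⟩

section Values

variable {δ δ' : Type*} [NormedAddCommGroup δ] [NormedSpace ℂ δ] [NormedAddCommGroup δ']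
  [NormedSpace ℂ δ']

theorem covDeriv_comp {k : ℕ} {F : 𝔱 × 𝔱 → δ} (hF : Differentiable ℝ F) (u : δ →L[ℂ] δ')
    (x v : 𝔱 × 𝔱) : covDeriv k (u ∘ F) x v = u (covDeriv k F x v) := by
  have h1 : HasFDerivAt (u ∘ F) ((u.restrictScalars ℝ) ∘L fderiv ℝ F x) x :=
    ((u.restrictScalars ℝ).hasFDerivAt).comp x (hF x).hasFDerivAt
  rw [covDeriv, covDeriv, h1.fderiv, map_add, map_smul]
  rfl

theorem comp_mem_H {Λ : Submodule ℤ 𝔱} {k : ℕ} {τ : ℍ} {F : 𝔱 × 𝔱 → δ} (hF : F ∈ H δ Λ k τ)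
    (u : δ →L[ℂ] δ') : u ∘ F ∈ H δ' Λ k τ := by
  refine ⟨fun p hp q hq x => ?_, ?_, fun x w => ?_⟩
  · simp only [Function.comp_apply]
    rw [hF.1 p hp q hq x, map_smul]
  · exact (u.restrictScalars ℝ).differentiable.comp hF.2.1
  · rw [covDeriv_comp hF.2.1, covDeriv_comp hF.2.1, ← map_smul, ← map_neg, ← map_add, hF.2.2,
      map_zero]

/-- Multiplication by a generator of the line `δ` identifies sections of `L^k` with sections of
`L^k ⊗ δ`. -/
def valueEquiv (Λ : Submodule ℤ 𝔱) (k : ℕ) (τ : ℍ) (u : ℂ ≃L[ℂ] δ) : H ℂ Λ k τ ≃ₗ[ℂ] H δ Λ k τ where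
  toFun F := ⟨u ∘ F, comp_mem_H F.2 (u : ℂ →L[ℂ] δ)⟩
  invFun F := ⟨u.symm ∘ F, comp_mem_H F.2 (u.symm : δ →L[ℂ] ℂ)⟩
  left_inv F := by ext; simp
  right_inv F := by ext; simp
  map_add' F G := by ext; simp
  map_smul' c F := by
    ext x
    simp only [Function.comp_apply, Submodule.coe_smul, Pi.smul_apply, smul_eq_mul, RingHom.id_apply]
    rw [← smul_eq_mul, map_smul]

end Values

theorem thetaIndex_mk_eq {Λ : Submodule ℤ 𝔱} {k : ℕ} {μ ν : scaledDual Λ k} :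
    (Submodule.Quotient.mk μ : ThetaIndex Λ k) = Submodule.Quotient.mk ν ↔ (μ : 𝔱) - ν ∈ Λ := by
  rw [Submodule.Quotient.eq]
  rfl

theorem mk_out {Λ : Submodule ℤ 𝔱} {k : ℕ} (i : ThetaIndex Λ k) : (Submodule.Quotient.mk (Quotient.out i) : ThetaIndex Λ k) = i :=
  Quotient.out_eq i

/-- The pairings of `k γ` with the basis vectors are bounded integers, and they determine `γ`. -/
theorem finite_scaledDual_of_bounded [FiniteDimensional ℝ 𝔱] {ι : Type*} [Finite ι] (b : Module.Basis ι ℝ 𝔱)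
    {Λ : Submodule ℤ 𝔱} (hb : ∀ i, b i ∈ Λ) {k : ℕ} (hk : 0 < k) (R : ℝ) :
    {γ : 𝔱 | γ ∈ scaledDual Λ k ∧ ‖γ‖ ≤ R}.Finite := by
  have hk' : (k : ℝ) ≠ 0 := by exact_mod_cast hk.ne'
  have hdual : ∀ (γ : 𝔱) i, ∃ m : ℤ, γ ∈ scaledDual Λ k → ⟪(k : ℝ) • γ, b i⟫ = (m : ℝ) :=
    fun γ i => by
      by_cases h : γ ∈ scaledDual Λ k
      · obtain ⟨m, hm⟩ := h (b i) (hb i)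
        exact ⟨m, fun _ => hm⟩
      · exact ⟨0, fun h' => absurd h' h⟩
  choose z hz using hdual
  obtain ⟨M, hM⟩ := (Set.finite_range fun i => k * R * ‖b i‖).bddAbove
  have hN : ∀ i, k * R * ‖b i‖ ≤ (⌈M⌉ : ℤ) := fun i => (hM ⟨i, rfl⟩).trans (Int.le_ceil M)
  refine Set.Finite.of_finite_image (f := z) ((Set.Finite.pi' fun _ =>
    Set.finite_Icc (-⌈M⌉) ⌈M⌉).subset ?_) ?_
  · rintro _ ⟨γ, hγ, rfl⟩ i
    have h1 : |(z γ i : ℝ)| ≤ (⌈M⌉ : ℤ) := by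
      rw [← hz γ i hγ.1]
      refine (abs_real_inner_le_norm _ _).trans (le_trans ?_ (hN i))
      rw [norm_smul, Real.norm_of_nonneg (by positivity)]
      gcongr
      exact hγ.2
    rw [Set.mem_Icc]
    exact abs_le.mp (by exact_mod_cast h1)
  · intro γ hγ γ' hγ' h
    refine InnerProductSpace.ext_inner_left_basis b fun i => ?_
    have h2 : ⟪(k : ℝ) • γ, b i⟫ = ⟪(k : ℝ) • γ', b i⟫ := by
      rw [hz γ i hγ.1, hz γ' i hγ'.1, congrFun h i]
    rw [inner_smul_left, inner_smul_left] at h2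
    rw [real_inner_comm, real_inner_comm _ (b i)]
    exact mul_left_cancel₀ hk' h2

theorem exists_basis_mem [FiniteDimensional ℝ 𝔱] (Λ : Submodule ℤ 𝔱) [DiscreteTopology Λ]
    [IsZLattice ℝ Λ] :
    ∃ b : Module.Basis (Module.Free.ChooseBasisIndex ℤ Λ) ℝ 𝔱, ∀ i, b i ∈ Λ :=
  ⟨(Module.Free.chooseBasis ℤ Λ).ofZLatticeBasis ℝ Λ, fun i =>
    (Module.Basis.ofZLatticeBasis_span _ _ _).le (Submodule.subset_span ⟨i, rfl⟩)⟩

variable [FiniteDimensional ℝ 𝔱] [MeasurableSpace 𝔱] [BorelSpace 𝔱]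
variable {Λ : Submodule ℤ 𝔱} [DiscreteTopology Λ] [IsZLattice ℝ Λ] {k : ℕ}

theorem exists_mem_domain_sub_mem (x : 𝔱) : ∃ y ∈ domain Λ, x - y ∈ Λ := by
  generalize hb : (Module.Free.chooseBasis ℤ Λ).ofZLatticeBasis ℝ Λ = b
  have hbΛ : Submodule.span ℤ (Set.range b) = Λ := by
    rw [← hb]
    exact Module.Basis.ofZLatticeBasis_span _ _ _
  rw [domain, hb]
  refine ⟨ZSpan.fract b x, ZSpan.fract_mem_fundamentalDomain b _, ?_⟩
  rw [ZSpan.fract_apply, sub_sub_cancel]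
  exact hbΛ.le (ZSpan.floor b x).2

theorem finite_thetaIndex (hk : 0 < k) (hev : IsEvenLattice Λ) : Finite (ThetaIndex Λ k) := by
  obtain ⟨b, hb⟩ := exists_basis_mem Λ
  obtain ⟨R, hR⟩ := (isBounded_domain Λ).exists_norm_le
  have hS : {γ : scaledDual Λ k | ‖(γ : 𝔱)‖ ≤ R}.Finite :=
    Set.Finite.of_finite_image ((finite_scaledDual_of_bounded b hb hk R).subset
      (by rintro _ ⟨γ, hγ, rfl⟩; exact ⟨γ.2, hγ⟩)) Subtype.val_injective.injOn
  refine Set.finite_univ_iff.mp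
    ((hS.image (Submodule.Quotient.mk : scaledDual Λ k → ThetaIndex Λ k)).subset ?_)
  rintro x -
  obtain ⟨γ, rfl⟩ := Submodule.Quotient.mk_surjective _ x
  obtain ⟨y, hy, hl⟩ := exists_mem_domain_sub_mem (Λ := Λ) (γ : 𝔱)
  have hy' : y ∈ scaledDual Λ k := by
    have := sub_mem γ.2 (hev.le_scaledDual k hl)
    rwa [sub_sub_cancel] at this
  refine ⟨⟨y, hy'⟩, hR _ hy, (thetaIndex_mk_eq.mpr ?_).symm⟩
  exact hl

/-- The theta function of a class, as a holomorphic section. -/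
def thetaH (hk : 0 < k) (hev : IsEvenLattice Λ) (τ : ℍ) (i : ThetaIndex Λ k) : H ℂ Λ k τ :=
  ⟨thetaSec Λ k τ (Quotient.out i : scaledDual Λ k),
    isLatticeInvariant_thetaSec hev.integral τ (Quotient.out i : scaledDual Λ k).2,
    isHolo_thetaSec Λ hk τ _⟩

theorem thetaH_mk (hk : 0 < k) (hev : IsEvenLattice Λ) (τ : ℍ) (μ : scaledDual Λ k) :
    (thetaH hk hev τ (Submodule.Quotient.mk μ) : 𝔱 × 𝔱 → ℂ) = thetaSec Λ k τ μ := by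
  have h : ((Quotient.out (Submodule.Quotient.mk μ : ThetaIndex Λ k) : scaledDual Λ k) : 𝔱) - μ ∈ Λ :=
    thetaIndex_mk_eq.mp (mk_out _)
  have := thetaSec_add_mem (k := k) Λ h τ μ
  rw [add_sub_cancel] at this
  exact this

theorem coeff_thetaH (hk : 0 < k) (hev : IsEvenLattice Λ) (τ : ℍ) (i : ThetaIndex Λ k)
    [DecidableEq (ThetaIndex Λ k)] (γ : scaledDual Λ k) :
    coeff Λ k τ γ (thetaH hk hev τ i) = if Submodule.Quotient.mk γ = i then 1 else 0 := by
  classical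
  rw [thetaH, coeff_thetaSec hk hev.integral τ γ.2 (Quotient.out i : scaledDual Λ k).2]
  simp only [← thetaIndex_mk_eq, mk_out]

/-- The coefficients of a section as a linear form. -/
def coeffH (τ : ℍ) (γ : 𝔱) : H ℂ Λ k τ →ₗ[ℂ] ℂ where
  toFun F := coeff Λ k τ γ F
  map_add' F G := coeff_add Λ γ F.2.2.1.continuous G.2.2.1.continuous
  map_smul' c F := coeff_smul Λ γ c F

/-- Theta functions form a basis: the coordinates of a section are its coefficients. -/
def thetaEquiv [Fintype (ThetaIndex Λ k)] (hk : 0 < k) (hev : IsEvenLattice Λ) (τ : ℍ) :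
    (ThetaIndex Λ k → ℂ) ≃ₗ[ℂ] H ℂ Λ k τ := by
  classical
  refine LinearEquiv.ofLinearMap (Fintype.linearCombination ℂ (thetaH hk hev τ))
    (LinearMap.pi fun i => coeffH τ ((Quotient.out i : scaledDual Λ k) : 𝔱)) ?_ ?_
  -- A section and the theta combination built from its coefficients have equal coefficients at the
  -- chosen representatives; `coeff_sub_mem` extends this to every index, and coefficients determine
  -- a section.
  · refine LinearMap.ext fun F => ?_
    rw [LinearMap.comp_apply, LinearMap.id_apply, ← sub_eq_zero]
    refine Subtype.ext (eq_zero_of_coeff_eq_zero hk (Subtype.property _) fun γ hγ => ?_)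
    change coeffH τ γ _ = 0
    rw [map_sub, Fintype.linearCombination_apply, map_sum, sub_eq_zero]
    simp only [map_smul]
    have h1 : ∀ i, coeffH τ γ (thetaH hk hev τ i) = if Submodule.Quotient.mk ⟨γ, hγ⟩ = i then 1 else 0 :=
      fun i => coeff_thetaH hk hev τ i ⟨γ, hγ⟩
    simp only [h1, smul_eq_mul, mul_ite, mul_one, mul_zero, Finset.sum_ite_eq, Finset.mem_univ,
      if_true, LinearMap.pi_apply]
    have h2 := thetaIndex_mk_eq.mp (mk_out (Submodule.Quotient.mk ⟨γ, hγ⟩ : ThetaIndex Λ k))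
    have h3 := coeff_sub_mem F.2 (Quotient.out (Submodule.Quotient.mk ⟨γ, hγ⟩ : ThetaIndex Λ k) : scaledDual Λ k).2 h2
    rw [sub_sub_cancel] at h3
    exact h3.symm
  · refine LinearMap.ext fun c => funext fun i => ?_
    rw [LinearMap.comp_apply, LinearMap.pi_apply, Fintype.linearCombination_apply, map_sum]
    simp only [map_smul]
    have h1 : ∀ j, coeffH τ ((Quotient.out i : scaledDual Λ k) : 𝔱) (thetaH hk hev τ j) =
        if i = j then 1 else 0 := fun j => by
      have := coeff_thetaH hk hev τ j (Quotient.out i)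
      rwa [mk_out] at this
    simp [h1]

theorem thetaEquiv_apply [Fintype (ThetaIndex Λ k)] (hk : 0 < k) (hev : IsEvenLattice Λ) (τ : ℍ)
    (c : ThetaIndex Λ k → ℂ) : thetaEquiv hk hev τ c = ∑ i, c i • thetaH hk hev τ i := rfl

theorem thetaEquiv_symm_apply [Fintype (ThetaIndex Λ k)] (hk : 0 < k) (hev : IsEvenLattice Λ) (τ : ℍ)
    (F : H ℂ Λ k τ) (i : ThetaIndex Λ k) :
    (thetaEquiv hk hev τ).symm F i = coeff Λ k τ (Quotient.out i : scaledDual Λ k) F := rfl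

end ThetaBasis

/-! ## The action of `S` and `T` on theta functions -/

section ModularGenerators

open MeasureTheory

variable {𝔱 : Type*} [NormedAddCommGroup 𝔱] [InnerProductSpace ℝ 𝔱]

open scoped RealInnerProductSpace

theorem actPair_T_inv (x : 𝔱 × 𝔱) : actPair ModularGroup.T⁻¹ x = (x.1 - x.2, x.2) := by
  rw [actPair, ModularGroup.coe_T_inv]
  simp [sub_eq_add_neg]

theorem actPair_S_inv (x : 𝔱 × 𝔱) : actPair ModularGroup.S⁻¹ x = (x.2, -x.1) := by
  have h : ((ModularGroup.S⁻¹ : SL(2, ℤ)) : Matrix (Fin 2) (Fin 2) ℤ) = !![0, 1; -1, 0] := by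
    rw [Matrix.SpecialLinearGroup.coe_inv, ModularGroup.coe_S, Matrix.adjugate_fin_two_of]
    simp
  rw [actPair, h]
  simp

theorem act_T_coe (τ : ℍ) : (act ModularGroup.T τ : ℂ) = τ - 1 := by
  rw [act_coe, ModularGroup.coe_T]
  simp

theorem act_S_coe (τ : ℍ) : (act ModularGroup.S τ : ℂ) = -1 / τ := by
  rw [act_coe, ModularGroup.coe_S]
  simp [div_neg, neg_div]

theorem modAct_T_thetaSec {Λ : Submodule ℤ 𝔱} (hev : IsEvenLattice Λ) {k : ℕ} (τ : ℍ) {μ : 𝔱}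
    (hμ : μ ∈ scaledDual Λ k) (x : 𝔱 × 𝔱) :
    modAct ModularGroup.T (thetaSec Λ k τ μ) x =
      Complex.exp (Complex.I * Real.pi * k * (⟪μ, μ⟫ : ℝ)) *
        thetaSec Λ k (act ModularGroup.T τ) μ x := by
  rw [modAct, actPair_T_inv, thetaSec_eq_tsum, thetaSec_eq_tsum, ← tsum_mul_left]
  refine tsum_congr fun l => ?_
  rw [thetaTerm_sub k τ _ (act_T_coe τ)]
  congr 1
  obtain ⟨m, hm⟩ := hμ l l.2
  obtain ⟨m', hm'⟩ := hev l l.2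
  rw [Complex.exp_eq_exp_iff_exists_int]
  refine ⟨m + k * m', ?_⟩
  rw [inner_smul_left, RCLike.conj_to_real] at hm
  have e1 : (k : ℂ) * (⟪μ, (l : 𝔱)⟫ : ℝ) = m := by exact_mod_cast hm
  have e2 : ((⟪(l : 𝔱), (l : 𝔱)⟫ : ℝ) : ℂ) = 2 * m' := by exact_mod_cast hm'
  rw [inner_add_left, inner_add_right, inner_add_right, real_inner_comm μ (l : 𝔱)]
  push_cast
  linear_combination (2 * Complex.I * Real.pi) * e1 + Complex.I * Real.pi * k * e2

/-- The substitution `(p, q) ↦ (q, -p)` preserves `omega`, and the lattice phases of a vector and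
its image differ by `exp (2 π i ⟪p, q⟫)`, which is `1` by integrality. It carries the directions of
type `(0, 1)` for `-1/τ` to multiples of those for `τ`. -/
theorem modAct_S_mem_H {Λ : Submodule ℤ 𝔱} (hev : IsEvenLattice Λ) {k : ℕ} {τ : ℍ} {F : 𝔱 × 𝔱 → ℂ}
    (hF : F ∈ H ℂ Λ k τ) : modAct ModularGroup.S F ∈ H ℂ Λ k (act ModularGroup.S τ) := by
  have hfun : modAct ModularGroup.S F = fun x => F (x.2, -x.1) := by
    funext x
    rw [modAct, actPair_S_inv]
  rw [hfun]
  let J : 𝔱 × 𝔱 →L[ℝ] 𝔱 × 𝔱 := (ContinuousLinearMap.snd ℝ 𝔱 𝔱).prod (-ContinuousLinearMap.fst ℝ 𝔱 𝔱)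
  have hder : ∀ x, HasFDerivAt (fun x : 𝔱 × 𝔱 => F (x.2, -x.1)) (fderiv ℝ F (x.2, -x.1) ∘L J) x :=
    fun x => (hF.2.1 (J x)).hasFDerivAt.comp x J.hasFDerivAt
  refine ⟨fun p hp q hq x => ?_, fun x => (hder x).differentiableAt, fun x w => ?_⟩
  · have h1 := hF.1 q hq (-p) (neg_mem hp) (x.2, -x.1)
    have h2 : (((p, q) + x).2, -((p, q) + x).1) = (q, -p) + (x.2, -x.1) := by
      simp [add_comm]
    simp only
    rw [h2, h1]
    congr 2
    rw [latticeFactor, latticeFactor, latticePhase, latticePhase, ← Complex.exp_add,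
      ← Complex.exp_add, Complex.exp_eq_exp_iff_exists_int]
    obtain ⟨m, hm⟩ := hev.integral p hp q hq
    refine ⟨-m, ?_⟩
    have hm' : ((⟪p, q⟫ : ℝ) : ℂ) = m := by exact_mod_cast hm
    simp only [omega, inner_neg_right, inner_neg_left, real_inner_comm p q]
    push_cast
    linear_combination (-2 * Real.pi * Complex.I) * hm'
  · have hne : (τ : ℂ) ≠ 0 := UpperHalfPlane.ne_zero τ
    have h1 := hF.2.2 (x.2, -x.1) w
    simp only [covDeriv, (hder _).fderiv, ContinuousLinearMap.comp_apply] at h1 ⊢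
    have e1 : J (w, 0) = -(0, w) := by simp [J]
    have e2 : J (0, w) = (w, 0) := by simp [J]
    rw [e1, e2, act_S_coe, map_neg]
    simp only [inner_zero_right, inner_neg_left, smul_eq_mul] at h1 ⊢
    field_simp
    push_cast at h1 ⊢
    field_simp at h1
    linear_combination -h1

variable [FiniteDimensional ℝ 𝔱] [MeasurableSpace 𝔱] [BorelSpace 𝔱]

/-- A positive real factor does not affect the branch of the principal power; this is how `k^(-n/2)`
is separated from `(S.τ / i)^(n/2)`. -/
theorem ofReal_inv_mul_cpow {r : ℝ} (hr : 0 < r) (z s : ℂ) (hz : z ≠ 0) :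
    (z / r) ^ s = ((r : ℂ) ^ (-s)) * z ^ s := by
  have hr' : (r : ℂ) ≠ 0 := by exact_mod_cast hr.ne'
  rw [Complex.cpow_def_of_ne_zero (div_ne_zero hz hr'), Complex.cpow_def_of_ne_zero hr',
    Complex.cpow_def_of_ne_zero hz, ← Complex.exp_add]
  congr 1
  have : z / r = ((r⁻¹ : ℝ) : ℂ) * z := by push_cast; rw [div_eq_inv_mul]
  rw [this, Complex.log_ofReal_mul (inv_pos.mpr hr) hz, Real.log_inv, Complex.ofReal_neg,
    Complex.ofReal_log hr.le]
  ring

/-- The Fourier transform of a Gaussian function. -/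
theorem integral_gaussian {k : ℕ} (hk : 0 < k) (τ : ℍ) (μ γ : 𝔱) :
    Integrable (fun p : 𝔱 => Complex.exp (Complex.I * Real.pi * k * (τ * (⟪μ + p, μ + p⟫ : ℝ) +
      2 * (⟪γ, p⟫ : ℝ)))) ∧
    ∫ p : 𝔱, Complex.exp (Complex.I * Real.pi * k * (τ * (⟪μ + p, μ + p⟫ : ℝ) +
      2 * (⟪γ, p⟫ : ℝ))) =
    (((act ModularGroup.S τ : ℂ) / Complex.I) ^ ((Module.finrank ℝ 𝔱 : ℂ) / 2) *
      ((k : ℝ) ^ (-(Module.finrank ℝ 𝔱 : ℝ) / 2) : ℝ)) *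
      Complex.exp (Complex.I * Real.pi * k * ((act ModularGroup.S τ : ℂ) * (⟪γ, γ⟫ : ℝ) -
        2 * (⟪μ, γ⟫ : ℝ))) := by
  have hk0 : (0 : ℝ) < k := by exact_mod_cast hk
  have hkc : (k : ℂ) ≠ 0 := by exact_mod_cast hk.ne'
  have hne : (τ : ℂ) ≠ 0 := UpperHalfPlane.ne_zero τ
  have hpi : (Real.pi : ℂ) ≠ 0 := by exact_mod_cast Real.pi_ne_zero
  set b : ℂ := -(Complex.I * Real.pi * k * τ) with hb
  have hbre : 0 < b.re := by
    have : b.re = Real.pi * k * τ.im := by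
      rw [hb]
      simp [Complex.mul_re, Complex.mul_im]
    rw [this]
    have := τ.im_pos
    have := Real.pi_pos
    positivity
  have hb0 : b ≠ 0 := fun h => by rw [h] at hbre; simp at hbre
  set c : ℂ := 2 * Complex.I * Real.pi * k with hc
  have hint := (GaussianFourier.integrable_cexp_neg_mul_sq_norm_add hbre c γ)
  have hval := (GaussianFourier.integral_cexp_neg_mul_sq_norm_add hbre c γ)
  set g : 𝔱 → ℂ := fun v => Complex.exp (-b * (‖v‖ : ℂ) ^ 2 + c * (⟪γ, v⟫ : ℝ)) with hg
  have hfun : (fun p : 𝔱 => Complex.exp (Complex.I * Real.pi * k * (τ * (⟪μ + p, μ + p⟫ : ℝ) +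
      2 * (⟪γ, p⟫ : ℝ)))) = fun p => Complex.exp (-(c * (⟪γ, μ⟫ : ℝ))) * g (μ + p) := by
    funext p
    rw [hg]
    simp only
    rw [← Complex.exp_add]
    congr 1
    rw [real_inner_self_eq_norm_sq, hb, hc, inner_add_right]
    push_cast
    ring
  rw [hfun]
  refine ⟨(hint.comp_add_left μ).const_mul _, ?_⟩
  rw [integral_const_mul, integral_add_left_eq_self g μ, hval]
  have hpb : (Real.pi : ℂ) / b = ((act ModularGroup.S τ : ℂ) / Complex.I) / (k : ℝ) := by
    rw [hb, act_S_coe]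
    push_cast
    field_simp
  have hS : ((act ModularGroup.S τ : ℂ) / Complex.I) ≠ 0 :=
    div_ne_zero (UpperHalfPlane.ne_zero _) Complex.I_ne_zero
  rw [hpb, ofReal_inv_mul_cpow hk0 _ _ hS]
  have h1 : (((k : ℝ) ^ (-(Module.finrank ℝ 𝔱 : ℝ) / 2) : ℝ) : ℂ) =
      ((k : ℝ) : ℂ) ^ (-((Module.finrank ℝ 𝔱 : ℂ) / 2)) := by
    rw [Complex.ofReal_cpow hk0.le]
    congr 1
    push_cast
    ring
  rw [h1]
  have h2 : Complex.exp (-(c * (⟪γ, μ⟫ : ℝ))) * Complex.exp (c ^ 2 * (‖γ‖ : ℂ) ^ 2 / (4 * b)) =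
      Complex.exp (Complex.I * Real.pi * k * ((act ModularGroup.S τ : ℂ) * (⟪γ, γ⟫ : ℝ) -
        2 * (⟪μ, γ⟫ : ℝ))) := by
    rw [← Complex.exp_add]
    congr 1
    rw [real_inner_self_eq_norm_sq, real_inner_comm γ μ, hb, hc, act_S_coe]
    push_cast
    field_simp
    ring
  rw [← h2]
  ring

variable {Λ : Submodule ℤ 𝔱} [DiscreteTopology Λ] [IsZLattice ℝ Λ] {k : ℕ}

/-- Unfolding of an integral over a fundamental domain. -/
theorem setIntegral_tsum_eq_integral {φ : 𝔱 → ℂ} (hφ : Integrable φ) :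
    ∫ p in domain Λ, ∑' l : Λ, φ (l + p) = ∫ p, φ p := by
  have : MeasurableVAdd Λ 𝔱 := (inferInstance : MeasurableVAdd Λ.toAddSubgroup 𝔱)
  have : VAddInvariantMeasure Λ 𝔱 volume :=
    (inferInstance : VAddInvariantMeasure Λ.toAddSubgroup 𝔱 volume)
  have hD := isAddFundamentalDomain_domain Λ
  rw [hD.integral_eq_tsum'' φ hφ, integral_tsum]
  · rfl
  · exact fun l => ((hφ.comp_add_left (l : 𝔱)).aestronglyMeasurable).restrict
  · have := hD.lintegral_eq_tsum'' fun p => ‖φ p‖ₑ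
    refine ne_of_eq_of_ne this.symm ?_
    exact hφ.2.ne

/-- On the slice `q = 0` the transformed theta series is a sum of Gaussians translated by `Λ`. The
integrality of `k ⟪γ, l⟫` lets the character absorb the translation, so the integral over a
fundamental domain unfolds to the Fourier transform of one Gaussian over `𝔱`. -/
theorem coeff_modAct_S (hk : 0 < k) (τ : ℍ) (μ : 𝔱) {γ : 𝔱} (hγ : γ ∈ scaledDual Λ k) :
    coeff Λ k (act ModularGroup.S τ) γ (modAct ModularGroup.S (thetaSec Λ k τ μ)) =
    (((act ModularGroup.S τ : ℂ) / Complex.I) ^ ((Module.finrank ℝ 𝔱 : ℂ) / 2) * volConst Λ k) *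
      Complex.exp (-(2 * Complex.I * Real.pi * k * (⟪μ, γ⟫ : ℝ))) := by
  obtain ⟨hint, hval⟩ := integral_gaussian hk τ μ γ
  set φ : 𝔱 → ℂ := fun p : 𝔱 => Complex.exp (Complex.I * Real.pi * k * (τ * (⟪μ + p, μ + p⟫ : ℝ) +
      2 * (⟪γ, p⟫ : ℝ))) with hφ
  have hfun : ∀ p : 𝔱, thetaQuot k (act ModularGroup.S τ) γ
      (modAct ModularGroup.S (thetaSec Λ k τ μ)) (p, 0) =
      Complex.exp (-(Complex.I * Real.pi * k * ((act ModularGroup.S τ : ℂ) * (⟪γ, γ⟫ : ℝ)))) *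
        ∑' l : Λ, φ (l + p) := fun p => by
    rw [thetaQuot, modAct, actPair_S_inv, thetaSec_eq_tsum, ← tsum_mul_right, ← tsum_mul_left]
    refine tsum_congr fun l => ?_
    rw [thetaTerm, thetaTerm, hφ, ← Complex.exp_neg, ← Complex.exp_add, ← Complex.exp_add,
      Complex.exp_eq_exp_iff_exists_int]
    obtain ⟨m, hm⟩ := hγ l l.2
    refine ⟨-m, ?_⟩
    rw [inner_smul_left, RCLike.conj_to_real] at hm
    have hm' : (k : ℂ) * (⟪γ, (l : 𝔱)⟫ : ℝ) = m := by exact_mod_cast hm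
    have e1 : μ + (l : 𝔱) - (((p, (0 : 𝔱)).2, -(p, (0 : 𝔱)).1) : 𝔱 × 𝔱).2 = μ + (l + p) := by
      simp [add_assoc]
    rw [e1]
    simp only [inner_zero_left, inner_zero_right, sub_zero]
    rw [inner_add_right γ, real_inner_comm γ p]
    push_cast
    linear_combination (-2 * Real.pi * Complex.I) * hm'
  rw [coeff]
  simp only [hfun]
  rw [integral_const_mul, setIntegral_tsum_eq_integral hint, hval, volConst]
  have h2 : Complex.exp (-(Complex.I * Real.pi * k * ((act ModularGroup.S τ : ℂ) * (⟪γ, γ⟫ : ℝ)))) *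
      Complex.exp (Complex.I * Real.pi * k * ((act ModularGroup.S τ : ℂ) * (⟪γ, γ⟫ : ℝ) -
        2 * (⟪μ, γ⟫ : ℝ))) = Complex.exp (-(2 * Complex.I * Real.pi * k * (⟪μ, γ⟫ : ℝ))) := by
    rw [← Complex.exp_add]
    congr 1
    ring
  rw [← h2]
  push_cast
  ring

/-- The action of `S` on theta functions. -/
theorem modAct_S_thetaH [Fintype (ThetaIndex Λ k)] (hk : 0 < k) (hev : IsEvenLattice Λ) (τ : ℍ)
    (i : ThetaIndex Λ k) :
    modAct ModularGroup.S (thetaH hk hev τ i : 𝔱 × 𝔱 → ℂ) =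
    ((((act ModularGroup.S τ : ℂ) / Complex.I) ^ ((Module.finrank ℝ 𝔱 : ℂ) / 2) * volConst Λ k) •
      ∑ i', Complex.exp (-(2 * Complex.I * Real.pi * k *
        (⟪((Quotient.out i : scaledDual Λ k) : 𝔱), ((Quotient.out i' : scaledDual Λ k) : 𝔱)⟫ : ℝ))) •
        thetaH hk hev (act ModularGroup.S τ) i' : H ℂ Λ k (act ModularGroup.S τ)) := by
  have h := modAct_S_mem_H hev (thetaH hk hev τ i).2
  have h1 := (thetaEquiv hk hev (act ModularGroup.S τ)).apply_symm_apply ⟨_, h⟩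
  rw [thetaEquiv_apply] at h1
  rw [Finset.smul_sum]
  refine (congrArg Subtype.val h1).symm.trans (congrArg Subtype.val ?_)
  refine Finset.sum_congr rfl fun i' _ => ?_
  rw [thetaEquiv_symm_apply, smul_smul]
  congr 1
  exact coeff_modAct_S hk τ _ (Quotient.out i' : scaledDual Λ k).2

end ModularGenerators

/-! ## The action of the metaplectic group in the theta bases -/

section Metaplectic

theorem actPair_mul {𝔱 : Type*} [NormedAddCommGroup 𝔱] [InnerProductSpace ℝ 𝔱] (A B : SL(2, ℤ))
    (x : 𝔱 × 𝔱) : actPair (A * B) x = actPair A (actPair B x) := by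
  simp only [actPair, Matrix.SpecialLinearGroup.coe_mul, Matrix.mul_apply, Fin.sum_univ_two,
    add_smul, mul_smul, smul_add]
  ext
  · simp only
    abel
  · simp only
    abel

theorem actPair_one {𝔱 : Type*} [NormedAddCommGroup 𝔱] [InnerProductSpace ℝ 𝔱]
    (x : 𝔱 × 𝔱) : actPair 1 x = x := by
  simp [actPair]

theorem metaAct_mul {𝔱 δ : Type*} [NormedAddCommGroup 𝔱] [InnerProductSpace ℝ 𝔱]
    [NormedAddCommGroup δ] [NormedSpace ℂ δ] {n : ℕ} (g h : Mo2 n) (τ : ℍ) (F : 𝔱 × 𝔱 → δ) :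
    metaAct (g * h) τ F = metaAct g (act h.A τ) (metaAct h τ F) := by
  funext x
  simp only [metaAct, modAct, Mo2.mul_e, Mo2.mul_A, mul_inv_rev, actPair_mul, mul_smul]

theorem metaAct_one {𝔱 δ : Type*} [NormedAddCommGroup 𝔱] [InnerProductSpace ℝ 𝔱]
    [NormedAddCommGroup δ] [NormedSpace ℂ δ] {n : ℕ} (τ : ℍ) (F : 𝔱 × 𝔱 → δ) :
    metaAct (1 : Mo2 n) τ F = F := by
  funext x
  simp only [metaAct, modAct, Mo2.one_e, Mo2.one_A, inv_one, actPair_one, one_smul]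

/-- The half-plane is connected, and a continuous square root of a nonzero constant cannot change
sign on it. -/
theorem eq_of_sq_const {f : ℍ → ℂ} (hf : Continuous f) {c : ℂ} (hc : c ≠ 0) (h : ∀ τ, f τ ^ 2 = c)
    (τ τ' : ℍ) : f τ = f τ' := by
  have hne : ∀ τ, f τ ≠ 0 := fun τ h0 => hc (by rw [← h τ, h0, zero_pow two_ne_zero])
  exact isPreconnected_univ.eq_of_sq_eq (f := f) (g := fun _ => f τ') hf.continuousOn
    continuousOn_const (fun x _ => by simp [h]) (fun _ => hne τ') (Set.mem_univ τ') rfl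
    (Set.mem_univ τ)

theorem act_S_div_I_re_pos (τ : ℍ) : 0 < ((act ModularGroup.S τ : ℂ) / Complex.I).re := by
  rw [Complex.div_I]
  simpa using (act ModularGroup.S τ).im_pos

theorem act_S_cpow_ne_zero (n : ℕ) (τ : ℍ) :
    ((act ModularGroup.S τ : ℂ) / Complex.I) ^ ((n : ℂ) / 2) ≠ 0 := by
  have hS : ((act ModularGroup.S τ : ℂ) / Complex.I) ≠ 0 :=
    div_ne_zero (UpperHalfPlane.ne_zero _) Complex.I_ne_zero
  rw [Complex.cpow_def_of_ne_zero hS]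
  exact Complex.exp_ne_zero _

theorem act_S_cpow_sq (n : ℕ) (τ : ℍ) :
    (((act ModularGroup.S τ : ℂ) / Complex.I) ^ ((n : ℂ) / 2)) ^ 2 =
      ((act ModularGroup.S τ : ℂ) / Complex.I) ^ n := by
  rw [← Complex.cpow_mul_ofNat, div_mul_cancel₀ _ two_ne_zero, Complex.cpow_natCast]

theorem continuous_act_S_cpow (n : ℕ) :
    Continuous fun τ : ℍ => ((act ModularGroup.S τ : ℂ) / Complex.I) ^ ((n : ℂ) / 2) :=
  ((UpperHalfPlane.continuous_coe.comp (continuous_act _)).div_const _).cpow continuous_const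
    fun τ => Or.inl (act_S_div_I_re_pos τ)

theorem cocycle_S (τ : ℍ) : cocycle ModularGroup.S τ = -τ := by
  rw [cocycle, ModularGroup.coe_S]
  simp

theorem exists_lift_S (n : ℕ) : ∃ g : Mo2 n, g.A = ModularGroup.S := by
  -- Since `(S.τ / i)⁻¹ = -i τ`, multiplying by `ζ² = -i` gives `-τ`, the cocycle of `S`.
  obtain ⟨ζ, hζ⟩ := IsAlgClosed.exists_pow_nat_eq (-Complex.I) two_pos
  refine ⟨{ A := ModularGroup.S
            e := fun τ => ζ ^ n * (((act ModularGroup.S τ : ℂ) / Complex.I) ^ ((n : ℂ) / 2))⁻¹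
            cont := continuous_const.mul ((continuous_act_S_cpow n).inv₀ (act_S_cpow_ne_zero n))
            sq := fun τ => ?_ }, rfl⟩
  rw [mul_pow, inv_pow, act_S_cpow_sq, ← pow_mul, mul_comm n 2, pow_mul, hζ, ← inv_pow, ← mul_pow,
    cocycle_S, act_S_coe]
  congr 1
  have := UpperHalfPlane.ne_zero τ
  field_simp
  simp

theorem exists_lift_T (n : ℕ) : ∃ g : Mo2 n, g.A = ModularGroup.T :=
  ⟨{ A := ModularGroup.T
     e := fun _ => 1
     cont := continuous_const
     sq := fun τ => by rw [cocycle, ModularGroup.coe_T]; simp }, rfl⟩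

/-- Every lift of `S` has the same multiplier, up to a constant. -/
theorem lift_S_e {n : ℕ} (g : Mo2 n) (hg : g.A = ModularGroup.S) (τ : ℍ) :
    g.e τ * ((act ModularGroup.S τ : ℂ) / Complex.I) ^ ((n : ℂ) / 2) = g.e UpperHalfPlane.I := by
  -- The square of the product is `(-τ)^n (i/τ)^n = (1/i)^n`. The constant is read off at `τ = i`,
  -- where `S.τ / i = 1`.
  have h := eq_of_sq_const (f := fun τ => g.e τ *
    ((act ModularGroup.S τ : ℂ) / Complex.I) ^ ((n : ℂ) / 2))
    (g.cont.mul (continuous_act_S_cpow n)) (c := (1 / Complex.I) ^ n)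
    (by simp) (fun τ => by
      have := UpperHalfPlane.ne_zero τ
      rw [mul_pow, act_S_cpow_sq, g.sq, hg, cocycle_S, act_S_coe, ← mul_pow]
      congr 1
      field_simp) τ UpperHalfPlane.I
  refine h.trans ?_
  rw [act_S_coe]
  have : (-1 : ℂ) / (UpperHalfPlane.I : ℍ) / Complex.I = 1 := by
    simp [div_div]
  rw [this, Complex.one_cpow, mul_one]

open MeasureTheory

variable {𝔱 : Type*} [NormedAddCommGroup 𝔱] [InnerProductSpace ℝ 𝔱]

open scoped RealInnerProductSpace

variable [FiniteDimensional ℝ 𝔱] [MeasurableSpace 𝔱] [BorelSpace 𝔱]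
variable {Λ : Submodule ℤ 𝔱} [DiscreteTopology Λ] [IsZLattice ℝ Λ] {k : ℕ}
variable [Fintype (ThetaIndex Λ k)]

theorem thetaEquiv_coe_apply (hk : 0 < k) (hev : IsEvenLattice Λ) (τ : ℍ)
    (c : ThetaIndex Λ k → ℂ) (x : 𝔱 × 𝔱) : (thetaEquiv hk hev τ c : 𝔱 × 𝔱 → ℂ) x =
    ∑ i, c i * (thetaH hk hev τ i : 𝔱 × 𝔱 → ℂ) x := by
  rw [thetaEquiv_apply, Submodule.coe_sum, Finset.sum_apply]
  rfl

variable (Λ k) in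
/-- The finite Fourier transform on `k⁻¹ Λ^*` modulo `Λ`. -/
def fourierMap : (ThetaIndex Λ k → ℂ) →ₗ[ℂ] (ThetaIndex Λ k → ℂ) where
  toFun c i' := ∑ i, c i * Complex.exp (-(2 * Complex.I * Real.pi * k *
        (⟪((Quotient.out i : scaledDual Λ k) : 𝔱), ((Quotient.out i' : scaledDual Λ k) : 𝔱)⟫ : ℝ)))
  map_add' c c' := by
    funext i'
    simp only [Pi.add_apply, add_mul, Finset.sum_add_distrib]
  map_smul' a c := by
    funext i'
    simp only [Pi.smul_apply, smul_eq_mul, mul_assoc, Finset.mul_sum, RingHom.id_apply]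

variable (Λ k) in
/-- Multiplication by a quadratic character on `k⁻¹ Λ^*` modulo `Λ`. -/
def twistMap : (ThetaIndex Λ k → ℂ) →ₗ[ℂ] (ThetaIndex Λ k → ℂ) where
  toFun c i := c i * Complex.exp (Complex.I * Real.pi * k *
        (⟪((Quotient.out i : scaledDual Λ k) : 𝔱), ((Quotient.out i : scaledDual Λ k) : 𝔱)⟫ : ℝ))
  map_add' c c' := by
    funext i
    simp only [Pi.add_apply, add_mul]
  map_smul' a c := by
    funext i
    simp only [Pi.smul_apply, smul_eq_mul, mul_assoc, RingHom.id_apply]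

theorem modAct_S_thetaEquiv (hk : 0 < k) (hev : IsEvenLattice Λ) (τ : ℍ) (c : ThetaIndex Λ k → ℂ)
    (x : 𝔱 × 𝔱) : modAct ModularGroup.S (thetaEquiv hk hev τ c : 𝔱 × 𝔱 → ℂ) x =
    (((act ModularGroup.S τ : ℂ) / Complex.I) ^ ((Module.finrank ℝ 𝔱 : ℂ) / 2) * volConst Λ k) *
      (thetaEquiv hk hev (act ModularGroup.S τ) (fourierMap Λ k c) : 𝔱 × 𝔱 → ℂ) x := by
  have h : ∀ i, (thetaH hk hev τ i : 𝔱 × 𝔱 → ℂ) (actPair ModularGroup.S⁻¹ x) = _ :=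
    fun i => congrFun (modAct_S_thetaH hk hev τ i) x
  rw [modAct, thetaEquiv_coe_apply, thetaEquiv_coe_apply]
  simp only [h, Submodule.coe_smul, Submodule.coe_sum, Pi.smul_apply, Finset.sum_apply, smul_eq_mul,
    fourierMap, LinearMap.coe_mk, AddHom.coe_mk, Finset.sum_mul, Finset.mul_sum]
  rw [Finset.sum_comm]
  refine Finset.sum_congr rfl fun i' _ => Finset.sum_congr rfl fun i _ => ?_
  ring

theorem modAct_T_thetaEquiv (hk : 0 < k) (hev : IsEvenLattice Λ) (τ : ℍ) (c : ThetaIndex Λ k → ℂ)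
    (x : 𝔱 × 𝔱) : modAct ModularGroup.T (thetaEquiv hk hev τ c : 𝔱 × 𝔱 → ℂ) x =
      (thetaEquiv hk hev (act ModularGroup.T τ) (twistMap Λ k c) : 𝔱 × 𝔱 → ℂ) x := by
  have h : ∀ i : ThetaIndex Λ k, (thetaH hk hev τ i : 𝔱 × 𝔱 → ℂ) (actPair ModularGroup.T⁻¹ x) = _ :=
    fun i => modAct_T_thetaSec hev τ (Quotient.out i : scaledDual Λ k).2 x
  rw [modAct, thetaEquiv_coe_apply, thetaEquiv_coe_apply]
  simp only [h]
  refine Finset.sum_congr rfl fun i _ => ?_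
  simp only [twistMap, LinearMap.coe_mk, AddHom.coe_mk, mul_assoc]
  rfl

/-- The matrix of `g` in the theta bases is `M`. -/
def HasMatrix {n : ℕ} (hk : 0 < k) (hev : IsEvenLattice Λ) (g : Mo2 n)
    (M : (ThetaIndex Λ k → ℂ) →ₗ[ℂ] (ThetaIndex Λ k → ℂ)) : Prop :=
  ∀ (τ : ℍ) (c : ThetaIndex Λ k → ℂ), metaAct g τ (thetaEquiv hk hev τ c : 𝔱 × 𝔱 → ℂ) =
    (thetaEquiv hk hev (act g.A τ) (M c) : 𝔱 × 𝔱 → ℂ)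

variable {n : ℕ} {hk : 0 < k} {hev : IsEvenLattice Λ}

/-- Uniqueness of the matrix, tested at a single `τ`; this makes a family of chosen matrices
multiplicative. -/
theorem HasMatrix.ext {g : Mo2 n} {M M' : (ThetaIndex Λ k → ℂ) →ₗ[ℂ] (ThetaIndex Λ k → ℂ)}
    (h : HasMatrix hk hev g M) (h' : HasMatrix hk hev g M') : M = M' := by
  refine LinearMap.ext fun c => ?_
  have := (h UpperHalfPlane.I c).symm.trans (h' UpperHalfPlane.I c)
  exact (thetaEquiv hk hev _).injective (Subtype.ext this)

theorem HasMatrix.mul {g g' : Mo2 n} {M M' : (ThetaIndex Λ k → ℂ) →ₗ[ℂ] (ThetaIndex Λ k → ℂ)}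
    (h : HasMatrix hk hev g M) (h' : HasMatrix hk hev g' M') : HasMatrix hk hev (g * g') (M * M') := by
  intro τ c
  rw [metaAct_mul, h', h, Mo2.mul_A, act_mul]
  rfl

theorem HasMatrix.one : HasMatrix hk hev (1 : Mo2 n) 1 := by
  intro τ c
  rw [metaAct_one, Mo2.one_A, act_one]
  rfl

theorem HasMatrix.exists_inv {g : Mo2 n} {M : (ThetaIndex Λ k → ℂ) →ₗ[ℂ] (ThetaIndex Λ k → ℂ)}
    (h : HasMatrix hk hev g M) : ∃ M', HasMatrix hk hev g⁻¹ M' := by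
  have hinj : Function.Injective M := by
    intro c c' hcc
    have h1 := h UpperHalfPlane.I c
    have h2 := h UpperHalfPlane.I c'
    rw [hcc, ← h2] at h1
    have h3 := congrArg (metaAct g⁻¹ (act g.A UpperHalfPlane.I)) h1
    rw [← metaAct_mul, ← metaAct_mul, inv_mul_cancel, metaAct_one, metaAct_one] at h3
    exact (thetaEquiv hk hev _).injective (Subtype.ext h3)
  let e := LinearEquiv.ofInjectiveEndo M hinj
  refine ⟨e.symm, fun τ c => ?_⟩
  have h1 := h (act g.A⁻¹ τ) (e.symm c)
  have h2 : M (e.symm c) = c := e.apply_symm_apply c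
  rw [h2] at h1
  have h3 : act g.A (act g.A⁻¹ τ) = τ := by rw [← act_mul, mul_inv_cancel, act_one]
  have h4 := congrArg (metaAct g⁻¹ (act g.A (act g.A⁻¹ τ))) h1
  rw [← metaAct_mul, inv_mul_cancel, metaAct_one, h3] at h4
  exact h4.symm

theorem hasMatrix_S (hn : n = Module.finrank ℝ 𝔱) {g : Mo2 n} (hg : g.A = ModularGroup.S) :
    HasMatrix hk hev g ((g.e UpperHalfPlane.I * volConst Λ k) • fourierMap Λ k) := by
  intro τ c
  funext x
  rw [metaAct, hg, modAct_S_thetaEquiv, ← hn, smul_eq_mul, ← mul_assoc, ← mul_assoc, lift_S_e g hg,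
    LinearMap.smul_apply, map_smul]
  rfl

theorem exists_hasMatrix_T {g : Mo2 n} (hg : g.A = ModularGroup.T) :
    HasMatrix hk hev g (g.e UpperHalfPlane.I • twistMap Λ k) := by
  intro τ c
  have he : g.e τ = g.e UpperHalfPlane.I := eq_of_sq_const g.cont one_ne_zero (fun τ => by
    rw [g.sq, hg, cocycle, ModularGroup.coe_T]; simp) _ _
  funext x
  rw [metaAct, hg, modAct_T_thetaEquiv, he, LinearMap.smul_apply, map_smul]
  rfl

/-- Induction on words in `S` and `T`. The statement carried along concerns all lifts of `A`
together with the existence of one: a lift `g` of a product factors as `(g g₂⁻¹) g₂` with `g₂` a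
known lift of the second factor. -/
theorem exists_hasMatrix (hk : 0 < k) (hev : IsEvenLattice Λ) (hn : n = Module.finrank ℝ 𝔱)
    (g : Mo2 n) : ∃ M, HasMatrix hk hev g M := by
  have key : ∀ A : SL(2, ℤ), (∃ g : Mo2 n, g.A = A) ∧
      ∀ g : Mo2 n, g.A = A → ∃ M, HasMatrix hk hev g M := by
    intro A
    have hA : A ∈ Subgroup.closure {ModularGroup.S, ModularGroup.T} := by
      rw [SpecialLinearGroup.SL2Z_generators]
      exact Subgroup.mem_top A
    induction hA using Subgroup.closure_induction with
    | mem A hA =>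
      rcases hA with rfl | rfl
      · exact ⟨exists_lift_S n, fun g hg => ⟨_, hasMatrix_S hn hg⟩⟩
      · exact ⟨exists_lift_T n, fun g hg => ⟨_, exists_hasMatrix_T hg⟩⟩
    | one =>
      refine ⟨⟨1, rfl⟩, fun g hg => ⟨g.e UpperHalfPlane.I • LinearMap.id, fun τ c => ?_⟩⟩
      have he : g.e τ = g.e UpperHalfPlane.I := eq_of_sq_const g.cont one_ne_zero (fun τ => by
        rw [g.sq, hg, cocycle]; simp) _ _
      funext x
      rw [metaAct, hg, modAct, inv_one, actPair_one, he, LinearMap.smul_apply, map_smul, act_one]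
      rfl
    | mul A A' _ _ hA hA' =>
      obtain ⟨⟨g₁, h₁⟩, hm₁⟩ := hA
      obtain ⟨⟨g₂, h₂⟩, hm⟩ := hA'
      refine ⟨⟨g₁ * g₂, by rw [Mo2.mul_A, h₁, h₂]⟩, fun g hg => ?_⟩
      obtain ⟨M, hM⟩ := hm₁ (g * g₂⁻¹) (by rw [Mo2.mul_A, Mo2.inv_A, hg, h₂, mul_inv_cancel_right])
      obtain ⟨M', hM'⟩ := hm g₂ h₂
      have := hM.mul hM'
      rw [inv_mul_cancel_right] at this
      exact ⟨_, this⟩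
    | inv A _ hA =>
      obtain ⟨⟨g₁, h₁⟩, hm⟩ := hA
      refine ⟨⟨g₁⁻¹, by rw [Mo2.inv_A, h₁]⟩, fun g hg => ?_⟩
      obtain ⟨M, hM⟩ := hm g⁻¹ (by rw [Mo2.inv_A, hg, inv_inv])
      have := hM.exists_inv
      rwa [inv_inv] at this
  exact (key g.A).2 g rfl

/-- The representation of the extension of the modular group in the theta bases. -/
def metaRep (hk : 0 < k) (hev : IsEvenLattice Λ) (hn : n = Module.finrank ℝ 𝔱) :
    Representation ℂ (Mo2 n) (ThetaIndex Λ k → ℂ) where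
  toFun g := (exists_hasMatrix hk hev hn g).choose
  map_one' := (exists_hasMatrix hk hev hn 1).choose_spec.ext HasMatrix.one
  map_mul' g g' := (exists_hasMatrix hk hev hn (g * g')).choose_spec.ext
    ((exists_hasMatrix hk hev hn g).choose_spec.mul (exists_hasMatrix hk hev hn g').choose_spec)

theorem hasMatrix_metaRep (hk : 0 < k) (hev : IsEvenLattice Λ) (hn : n = Module.finrank ℝ 𝔱)
    (g : Mo2 n) : HasMatrix hk hev g (metaRep hk hev hn g) :=
  (exists_hasMatrix hk hev hn g).choose_spec

end Metaplectic

/-! ## Alternating sections -/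

section Alternating

open MeasureTheory

variable {𝔱 : Type*} [NormedAddCommGroup 𝔱] [InnerProductSpace ℝ 𝔱]

open scoped RealInnerProductSpace

theorem exp_inner_congr {Λ : Submodule ℤ 𝔱} (hev : IsEvenLattice Λ) {k : ℕ} {μ ν μ' ν' : 𝔱}
    (hμ : μ ∈ scaledDual Λ k) (hν' : ν' ∈ scaledDual Λ k) (h : μ - ν ∈ Λ) (h' : μ' - ν' ∈ Λ) :
    Complex.exp (-(2 * Complex.I * Real.pi * k * (⟪μ, μ'⟫ : ℝ))) =
      Complex.exp (-(2 * Complex.I * Real.pi * k * (⟪ν, ν'⟫ : ℝ))) := by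
  obtain ⟨m, hm⟩ := hμ _ h'
  obtain ⟨m', hm'⟩ := hν' _ h
  rw [inner_smul_left, RCLike.conj_to_real] at hm hm'
  have e1 : (k : ℂ) * (⟪μ, μ' - ν'⟫ : ℝ) = m := by exact_mod_cast hm
  have e2 : (k : ℂ) * (⟪ν', μ - ν⟫ : ℝ) = m' := by exact_mod_cast hm'
  rw [Complex.exp_eq_exp_iff_exists_int]
  refine ⟨-(m + m'), ?_⟩
  rw [inner_sub_right] at e1 e2
  rw [real_inner_comm μ ν', real_inner_comm ν ν'] at e2
  push_cast at e1 e2 ⊢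
  linear_combination (-2 * Complex.I * Real.pi) * (e1 + e2)

/-- The cross term contributes an integer multiple of `2 π i` by duality; the square of the lattice
vector does so only because it is even. -/
theorem exp_inner_self_congr {Λ : Submodule ℤ 𝔱} (hev : IsEvenLattice Λ) {k : ℕ} {μ ν : 𝔱}
    (hν : ν ∈ scaledDual Λ k) (h : μ - ν ∈ Λ) :
    Complex.exp (Complex.I * Real.pi * k * (⟪μ, μ⟫ : ℝ)) =
      Complex.exp (Complex.I * Real.pi * k * (⟪ν, ν⟫ : ℝ)) := by
  obtain ⟨m, hm⟩ := hν _ h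
  obtain ⟨m', hm'⟩ := hev _ h
  rw [inner_smul_left, RCLike.conj_to_real] at hm
  have e1 : (k : ℂ) * (⟪ν, μ - ν⟫ : ℝ) = m := by exact_mod_cast hm
  have e2 : ((⟪μ - ν, μ - ν⟫ : ℝ) : ℂ) = 2 * m' := by exact_mod_cast hm'
  rw [Complex.exp_eq_exp_iff_exists_int]
  refine ⟨m + k * m', ?_⟩
  have e3 : ⟪μ, μ⟫ = ⟪μ - ν, μ - ν⟫ + 2 * ⟪ν, μ - ν⟫ + ⟪ν, ν⟫ := by
    simp only [inner_sub_left, inner_sub_right, real_inner_comm μ ν]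
    ring
  rw [e3]
  push_cast
  linear_combination (2 * Complex.I * Real.pi) * e1 + Complex.I * Real.pi * k * e2

variable {Φ P : Set 𝔱} {a₀ : 𝔱} {k : ℕ}

theorem IsBasedRootSet.isEvenLattice (h : IsBasedRootSet Φ P a₀) :
    IsEvenLattice (integralLattice Φ) := fun _ hl => h.lattice_even hl

theorem IsBasedRootSet.map_scaledDual (h : IsBasedRootSet Φ P a₀) (w : weylGroup Φ) {μ : 𝔱}
    (hμ : μ ∈ scaledDual (integralLattice Φ) k) : w.1 μ ∈ scaledDual (integralLattice Φ) k := by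
  intro l hl
  obtain ⟨m, hm⟩ := hμ _ (h.map_lattice w⁻¹ hl)
  have h4 : w.1 ((w⁻¹ : weylGroup Φ).1 l) = l := w.1.apply_symm_apply l
  refine ⟨m, ?_⟩
  rw [← hm, ← h4, ← map_smul, LinearIsometryEquiv.inner_map_map, h4]

/-- The action of the Weyl group on `k⁻¹ Λ^*` modulo `Λ`. -/
def weylIndex (h : IsBasedRootSet Φ P a₀) (w : weylGroup Φ) (i : ThetaIndex (integralLattice Φ) k) :
    ThetaIndex (integralLattice Φ) k :=
  Submodule.Quotient.mk ⟨w.1 (Quotient.out i : scaledDual (integralLattice Φ) k),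
    h.map_scaledDual w (Quotient.out i : scaledDual (integralLattice Φ) k).2⟩

theorem weylIndex_mk (h : IsBasedRootSet Φ P a₀) (w : weylGroup Φ)
    (μ : scaledDual (integralLattice Φ) k) :
    weylIndex h w (Submodule.Quotient.mk μ) =
      Submodule.Quotient.mk ⟨w.1 μ, h.map_scaledDual w μ.2⟩ := by
  rw [weylIndex, thetaIndex_mk_eq]
  simp only
  rw [← map_sub]
  exact h.map_lattice w (thetaIndex_mk_eq.mp (mk_out _))

theorem weylIndex_mul (h : IsBasedRootSet Φ P a₀) (w w' : weylGroup Φ)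
    (i : ThetaIndex (integralLattice Φ) k) :
    weylIndex h (w * w') i = weylIndex h w (weylIndex h w' i) := by
  obtain ⟨μ, rfl⟩ := Submodule.Quotient.mk_surjective _ i
  rw [weylIndex_mk, weylIndex_mk, weylIndex_mk]
  rfl

theorem weylIndex_one (h : IsBasedRootSet Φ P a₀) (i : ThetaIndex (integralLattice Φ) k) :
    weylIndex h 1 i = i := by
  obtain ⟨μ, rfl⟩ := Submodule.Quotient.mk_surjective _ i
  rw [weylIndex_mk]
  rfl

/-- The permutation of `k⁻¹ Λ^*` modulo `Λ` defined by an element of the Weyl group. -/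
def weylPerm (h : IsBasedRootSet Φ P a₀) (w : weylGroup Φ) :
    Equiv.Perm (ThetaIndex (integralLattice Φ) k) where
  toFun := weylIndex h w
  invFun := weylIndex h w⁻¹
  left_inv i := by rw [← weylIndex_mul, inv_mul_cancel, weylIndex_one]
  right_inv i := by rw [← weylIndex_mul, mul_inv_cancel, weylIndex_one]

/-- The coordinate vectors of the alternating sections. -/
def altCoord (h : IsBasedRootSet Φ P a₀) (k : ℕ) :
    Submodule ℂ (ThetaIndex (integralLattice Φ) k → ℂ) where
  carrier := {c | ∀ w i, c (weylIndex h w i) = weylSign w * c i}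
  zero_mem' := fun w i => by simp
  add_mem' := fun {c c'} hc hc' w i => by
    rw [Pi.add_apply, Pi.add_apply, hc, hc', mul_add]
  smul_mem' := fun a c hc w i => by
    rw [Pi.smul_apply, Pi.smul_apply, hc, smul_eq_mul, smul_eq_mul, mul_left_comm]

variable [FiniteDimensional ℝ 𝔱]

/-- The Weyl group and translations by `Λ` bring any index to the closed alcove, changing the value
by a sign. On the boundary an element of determinant `-1` fixes the class, so the value equals its
opposite. -/
theorem eq_zero_of_mem_altCoord [DiscreteTopology (integralLattice Φ)]
    [IsZLattice ℝ (integralLattice Φ)] (h : IsBasedRootSet Φ P a₀)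
    {c : ThetaIndex (integralLattice Φ) k → ℂ} (hc : c ∈ altCoord h k)
    (h0 : ∀ μ : scaledDual (integralLattice Φ) k, (μ : 𝔱) ∈ alcove P a₀ →
      c (Submodule.Quotient.mk μ) = 0) : c = 0 := by
  funext i
  obtain ⟨γ, rfl⟩ := Submodule.Quotient.mk_surjective _ i
  have hev := h.isEvenLattice
  obtain ⟨b, hb⟩ := exists_basis_mem (integralLattice Φ)
  have hfin : ∀ r : ℝ, {l : 𝔱 | l ∈ integralLattice Φ ∧ ‖l‖ ≤ r}.Finite := fun r =>
    (finite_scaledDual_of_bounded b hb one_pos r).subset fun l hl => ⟨hev.le_scaledDual 1 hl.1, hl.2⟩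
  obtain ⟨w, l, hl, h1, h2⟩ := h.exists_mem_closed_alcove hfin (γ : 𝔱)
  set y : scaledDual (integralLattice Φ) k := ⟨w.1 γ + l, add_mem (h.map_scaledDual w γ.2)
    (hev.le_scaledDual k hl)⟩ with hy
  have hwy : weylIndex h w (Submodule.Quotient.mk γ) = Submodule.Quotient.mk y := by
    rw [weylIndex_mk, thetaIndex_mk_eq]
    simpa [hy] using hl
  have hcy := hc w (Submodule.Quotient.mk γ)
  rw [hwy] at hcy
  have hne : weylSign w ≠ 0 := fun h' => by
    have := weylSign_mul_self h.toIsRootSet w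
    simp [h'] at this
  suffices c (Submodule.Quotient.mk y) = 0 by
    rw [this] at hcy
    exact (mul_eq_zero.mp hcy.symm).resolve_left hne
  by_cases hal : (y : 𝔱) ∈ alcove P a₀
  · exact h0 y hal
  · obtain ⟨v, hv, l', hl', he⟩ := h.exists_reflection_fixing (y := y) h1 h2 hal
    have hvy : weylIndex h v (Submodule.Quotient.mk y) = Submodule.Quotient.mk y := by
      rw [weylIndex_mk, thetaIndex_mk_eq]
      simp only
      rw [← neg_mem_iff, neg_sub, sub_eq_of_eq_add' he.symm]
      exact hl'
    have := hc v (Submodule.Quotient.mk y)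
    rw [hvy, hv] at this
    linear_combination (1 / 2 : ℂ) * this

/-- A weight in the alcove, as an element of `k⁻¹ Λ^*`. -/
def alcoveIndex {Λ : Submodule ℤ 𝔱} (μ : alcoveWeights Λ P a₀ k) : scaledDual Λ k := ⟨μ, μ.2.2⟩

theorem alcoveIndex_mem {Λ : Submodule ℤ 𝔱} (μ : alcoveWeights Λ P a₀ k) :
    (alcoveIndex μ : 𝔱) ∈ alcove P a₀ := μ.2.1

theorem alcoveIndex_inj {Λ : Submodule ℤ 𝔱} {μ ν : alcoveWeights Λ P a₀ k} :
    alcoveIndex μ = alcoveIndex ν ↔ μ = ν :=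
  ⟨fun h => Subtype.ext (by
    have h' := congrArg (fun m : scaledDual Λ k => (m : 𝔱)) h
    exact h'), fun h => by rw [h]⟩

variable [Fintype (weylGroup Φ)]

open Classical in
/-- The coordinates of `χ_μ`. -/
def chiCoord (h : IsBasedRootSet Φ P a₀) (μ : scaledDual (integralLattice Φ) k)
    (i : ThetaIndex (integralLattice Φ) k) : ℂ :=
  ∑ w : weylGroup Φ, weylSign w * if weylIndex h w (Submodule.Quotient.mk μ) = i then 1 else 0

theorem chiCoord_mem (h : IsBasedRootSet Φ P a₀) (μ : scaledDual (integralLattice Φ) k) :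
    chiCoord h μ ∈ altCoord h k := by
  intro v i
  rw [chiCoord, chiCoord, ← Equiv.sum_comp (Equiv.mulLeft v), Finset.mul_sum]
  refine Finset.sum_congr rfl fun w _ => ?_
  rw [Equiv.coe_mulLeft, weylSign_mul, weylIndex_mul, mul_assoc]
  congr 3
  exact propext (weylPerm h v).apply_eq_iff_eq

/-- Two alcove points are related by the affine Weyl group only through the identity, so at most the
term `w = 1` survives. -/
theorem chiCoord_mk (h : IsBasedRootSet Φ P a₀) {μ μ' : scaledDual (integralLattice Φ) k}
    (hμ : (μ : 𝔱) ∈ alcove P a₀) (hμ' : (μ' : 𝔱) ∈ alcove P a₀) [Decidable (μ = μ')] :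
    chiCoord h μ (Submodule.Quotient.mk μ') = if μ = μ' then 1 else 0 := by
  classical
  have key : ∀ w : weylGroup Φ,
      weylIndex h w (Submodule.Quotient.mk μ) = Submodule.Quotient.mk μ' ↔ w = 1 ∧ μ = μ' := by
    intro w
    constructor
    · intro he
      rw [weylIndex_mk, thetaIndex_mk_eq] at he
      obtain ⟨h1, h2⟩ := h.alcove_unique hμ hμ' w (neg_mem he) (by simp)
      refine ⟨h1, ?_⟩
      subst h1
      exact Subtype.ext (sub_eq_zero.mp (neg_eq_zero.mp h2))
    · rintro ⟨rfl, rfl⟩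
      exact weylIndex_one h _
  rw [chiCoord]
  simp only [key]
  rw [Finset.sum_eq_single 1]
  · simp [weylSign_one]
  · intro w _ hw
    simp [hw]
  · simp

theorem eq_sum_chiCoord [DiscreteTopology (integralLattice Φ)] [IsZLattice ℝ (integralLattice Φ)]
    (h : IsBasedRootSet Φ P a₀) [Fintype (alcoveWeights (integralLattice Φ) P a₀ k)]
    {c : ThetaIndex (integralLattice Φ) k → ℂ} (hc : c ∈ altCoord h k) :
    c = ∑ μ : alcoveWeights (integralLattice Φ) P a₀ k,
      c (Submodule.Quotient.mk (alcoveIndex μ)) • chiCoord h (alcoveIndex μ) := by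
  classical
  rw [← sub_eq_zero]
  refine eq_zero_of_mem_altCoord h (sub_mem hc (Submodule.sum_mem _ fun μ _ =>
    Submodule.smul_mem _ _ (chiCoord_mem h _))) fun ν hν => ?_
  obtain ⟨ν, rfl⟩ : ∃ μ : alcoveWeights (integralLattice Φ) P a₀ k, alcoveIndex μ = ν :=
    ⟨⟨ν, hν, ν.2⟩, rfl⟩
  rw [Pi.sub_apply, Finset.sum_apply, Finset.sum_eq_single ν]
  · rw [Pi.smul_apply, chiCoord_mk h hν hν, if_pos rfl]
    simp
  · intro μ _ hμ
    rw [Pi.smul_apply, chiCoord_mk h (alcoveIndex_mem μ) hν, if_neg, smul_zero]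
    exact fun he => hμ (alcoveIndex_inj.mp he)
  · simp

/-- The coordinate vectors of the `χ_μ`, `μ` in the alcove, form a basis of the space of
coordinate vectors of alternating sections. -/
def chiBasis [DiscreteTopology (integralLattice Φ)] [IsZLattice ℝ (integralLattice Φ)]
    (h : IsBasedRootSet Φ P a₀) [Fintype (alcoveWeights (integralLattice Φ) P a₀ k)] :
    Module.Basis (alcoveWeights (integralLattice Φ) P a₀ k) ℂ (altCoord h k) := by
  classical
  exact Module.Basis.ofEquivFun
    { toFun := fun c μ => c.1 (Submodule.Quotient.mk (alcoveIndex μ))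
      map_add' := fun c c' => rfl
      map_smul' := fun a c => rfl
      invFun := fun a => ∑ μ, a μ • ⟨chiCoord h (alcoveIndex μ), chiCoord_mem h _⟩
      left_inv := fun c => by
        refine Subtype.ext ?_
        rw [Submodule.coe_sum]
        exact (eq_sum_chiCoord h c.2).symm
      right_inv := fun a => by
        funext ν
        change ((∑ μ, a μ • (⟨chiCoord h (alcoveIndex μ), chiCoord_mem h _⟩ : altCoord h k) :
          altCoord h k) : ThetaIndex (integralLattice Φ) k → ℂ) _ = _
        rw [Submodule.coe_sum, Finset.sum_apply, Finset.sum_eq_single ν]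
        · change a ν • chiCoord h (alcoveIndex ν) (Submodule.Quotient.mk (alcoveIndex ν)) = a ν
          rw [chiCoord_mk h (alcoveIndex_mem ν) (alcoveIndex_mem ν), if_pos rfl]
          simp
        · intro μ _ hμ
          change a μ • chiCoord h (alcoveIndex μ) (Submodule.Quotient.mk (alcoveIndex ν)) = 0
          rw [chiCoord_mk h (alcoveIndex_mem μ) (alcoveIndex_mem ν), if_neg, smul_zero]
          exact fun he => hμ (alcoveIndex_inj.mp he)
        · simp }

theorem chiBasis_repr [DiscreteTopology (integralLattice Φ)] [IsZLattice ℝ (integralLattice Φ)]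
    (h : IsBasedRootSet Φ P a₀) [Fintype (alcoveWeights (integralLattice Φ) P a₀ k)]
    (c : altCoord h k) (μ : alcoveWeights (integralLattice Φ) P a₀ k) :
    (chiBasis h).repr c μ = c.1 (Submodule.Quotient.mk (alcoveIndex μ)) := by
  rw [chiBasis, ← Module.Basis.equivFun_apply, Module.Basis.equivFun_ofEquivFun]
  rfl

theorem chiBasis_apply [DiscreteTopology (integralLattice Φ)] [IsZLattice ℝ (integralLattice Φ)]
    (h : IsBasedRootSet Φ P a₀) [Fintype (alcoveWeights (integralLattice Φ) P a₀ k)]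
    (μ : alcoveWeights (integralLattice Φ) P a₀ k) :
    (chiBasis h μ : altCoord h k).1 = chiCoord h (alcoveIndex μ) := by
  classical
  have : chiBasis h μ = ⟨chiCoord h (alcoveIndex μ), chiCoord_mem h _⟩ := by
    refine (chiBasis h).repr.injective (Finsupp.ext fun ν => ?_)
    rw [Module.Basis.repr_self, chiBasis_repr]
    change _ = chiCoord h (alcoveIndex μ) (Submodule.Quotient.mk (alcoveIndex ν))
    rw [chiCoord_mk h (alcoveIndex_mem μ) (alcoveIndex_mem ν), Finsupp.single_apply]
    simp only [alcoveIndex_inj]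
  rw [this]

theorem finite_alcoveWeights [Finite (ThetaIndex (integralLattice Φ) k)]
    (h : IsBasedRootSet Φ P a₀) : Finite (alcoveWeights (integralLattice Φ) P a₀ k) := by
  refine Finite.of_injective (β := ThetaIndex (integralLattice Φ) k)
    (fun μ => Submodule.Quotient.mk (alcoveIndex μ)) fun μ ν he => ?_
  have h1 := thetaIndex_mk_eq.mp he
  obtain ⟨-, h2⟩ := h.alcove_unique μ.2.1 ν.2.1 1 (neg_mem h1)
    (by simp [alcoveIndex])
  exact Subtype.ext (sub_eq_zero.mp (neg_eq_zero.mp h2))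

variable [MeasurableSpace 𝔱] [BorelSpace 𝔱] [DiscreteTopology (integralLattice Φ)]
  [IsZLattice ℝ (integralLattice Φ)] [Fintype (ThetaIndex (integralLattice Φ) k)]

theorem chi_eq_thetaEquiv (hk : 0 < k) (hev : IsEvenLattice (integralLattice Φ))
    (h : IsBasedRootSet Φ P a₀) (τ : ℍ) (μ : scaledDual (integralLattice Φ) k) (x : 𝔱 × 𝔱) :
    chi (integralLattice Φ) Φ k τ μ x =
      (thetaEquiv hk hev τ (chiCoord h μ) : 𝔱 × 𝔱 → ℂ) x := by
  classical
  rw [chi, finsum_eq_sum_of_fintype, thetaEquiv_coe_apply]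
  simp only [chiCoord, Finset.sum_mul]
  rw [Finset.sum_comm]
  refine Finset.sum_congr rfl fun w _ => ?_
  simp only [mul_assoc, ite_mul, one_mul, zero_mul, mul_ite, mul_zero, Finset.sum_ite_eq,
    Finset.mem_univ, if_true]
  rw [weylIndex_mk, thetaH_mk]

theorem thetaEquiv_weyl (hk : 0 < k) (hev : IsEvenLattice (integralLattice Φ))
    (h : IsBasedRootSet Φ P a₀) (τ : ℍ) (c : ThetaIndex (integralLattice Φ) k → ℂ)
    (w : weylGroup Φ) (x : 𝔱 × 𝔱) :
    (thetaEquiv hk hev τ c : 𝔱 × 𝔱 → ℂ) ((w⁻¹ : weylGroup Φ).1 x.1, (w⁻¹ : weylGroup Φ).1 x.2) =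
      (thetaEquiv hk hev τ (c ∘ weylIndex h w⁻¹) : 𝔱 × 𝔱 → ℂ) x := by
  rw [thetaEquiv_coe_apply, thetaEquiv_coe_apply]
  refine Eq.trans ?_ (Equiv.sum_comp (weylPerm h w) _)
  refine Finset.sum_congr rfl fun i _ => ?_
  have h1 : weylIndex h w⁻¹ (weylPerm h w i) = i := (weylPerm h w).symm_apply_apply i
  rw [Function.comp_apply, h1]
  congr 1
  have h2 : (thetaH hk hev τ (weylPerm h w i) : 𝔱 × 𝔱 → ℂ) = thetaSec (integralLattice Φ) k τ
      (w.1 (Quotient.out i : scaledDual (integralLattice Φ) k)) := thetaH_mk hk hev τ _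
  rw [h2]
  have h3 := thetaSec_isometry (integralLattice Φ) (k := k) τ
    ((Quotient.out i : scaledDual (integralLattice Φ) k) : 𝔱) w.1
    (fun l hl => h.map_lattice w hl) (fun l hl => h.map_lattice w⁻¹ hl)
    ((w⁻¹ : weylGroup Φ).1 x.1, (w⁻¹ : weylGroup Φ).1 x.2)
  have h4 : ∀ y : 𝔱, w.1 ((w⁻¹ : weylGroup Φ).1 y) = y := fun y => w.1.apply_symm_apply y
  simp only [h4] at h3
  exact h3.symm

theorem thetaEquiv_mem_alternating (hk : 0 < k) (hev : IsEvenLattice (integralLattice Φ))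
    (h : IsBasedRootSet Φ P a₀) (τ : ℍ) (c : ThetaIndex (integralLattice Φ) k → ℂ) :
    thetaEquiv hk hev τ c ∈ alternating ℂ (integralLattice Φ) Φ k τ ↔ c ∈ altCoord h k := by
  have key : ∀ w : weylGroup Φ, (∀ x : 𝔱 × 𝔱, (thetaEquiv hk hev τ c : 𝔱 × 𝔱 → ℂ)
      ((w⁻¹ : weylGroup Φ).1 x.1, (w⁻¹ : weylGroup Φ).1 x.2) =
        weylSign w • (thetaEquiv hk hev τ c : 𝔱 × 𝔱 → ℂ) x) ↔
      c ∘ weylIndex h w⁻¹ = weylSign w • c := by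
    intro w
    rw [← (thetaEquiv hk hev τ).injective.eq_iff, map_smul, Subtype.ext_iff, funext_iff]
    simp only [thetaEquiv_weyl hk hev h]
    rfl
  constructor
  · intro hc w i
    have := congrFun ((key w⁻¹).mp (hc w⁻¹)) i
    rwa [inv_inv, weylSign_inv h.toIsRootSet] at this
  · intro hc w
    refine (key w).mpr (funext fun i => ?_)
    rw [Function.comp_apply, hc, weylSign_inv h.toIsRootSet]
    rfl

/-- The kernel of the finite Fourier transform is invariant under the simultaneous action of the
Weyl group on both indices. -/
theorem fourierMap_mem_altCoord (hev : IsEvenLattice (integralLattice Φ))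
    (h : IsBasedRootSet Φ P a₀) {c : ThetaIndex (integralLattice Φ) k → ℂ} (hc : c ∈ altCoord h k) :
    fourierMap (integralLattice Φ) k c ∈ altCoord h k := by
  intro v i'
  change ∑ i, _ = _ * ∑ i, _
  rw [← Equiv.sum_comp (weylPerm h v), Finset.mul_sum]
  refine Finset.sum_congr rfl fun i _ => ?_
  have h1 : c (weylPerm h v i) = weylSign v * c i := hc v i
  rw [h1, mul_assoc]
  congr 2
  rw [← LinearIsometryEquiv.inner_map_map v.1 ((Quotient.out i : scaledDual (integralLattice Φ) k) : 𝔱)]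
  exact exp_inner_congr hev (Subtype.property _)
    (h.map_scaledDual v (Quotient.out i' : scaledDual (integralLattice Φ) k).2)
    (thetaIndex_mk_eq.mp (mk_out (weylIndex h v i))) (thetaIndex_mk_eq.mp (mk_out (weylIndex h v i')))

theorem fourierMap_chiCoord (hev : IsEvenLattice (integralLattice Φ))
    (h : IsBasedRootSet Φ P a₀) (μ μ' : scaledDual (integralLattice Φ) k) :
    fourierMap (integralLattice Φ) k (chiCoord h μ) (Submodule.Quotient.mk μ') =
      weylSum Φ k μ μ' := by
  classical
  change ∑ i, _ = _
  rw [weylSum, finsum_eq_sum_of_fintype, ← Equiv.sum_comp (Equiv.inv (weylGroup Φ))]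
  simp only [chiCoord, Finset.sum_mul]
  rw [Finset.sum_comm]
  refine Finset.sum_congr rfl fun w _ => ?_
  simp only [mul_assoc, ite_mul, one_mul, zero_mul, mul_ite, mul_zero, Finset.sum_ite_eq,
    Finset.mem_univ, if_true]
  rw [Equiv.inv_apply, weylSign_inv h.toIsRootSet]
  congr 1
  rw [← LinearIsometryEquiv.inner_map_map w.1 (μ : 𝔱)]
  have h4 : w.1 ((w⁻¹ : weylGroup Φ).1 (μ' : 𝔱)) = μ' := w.1.apply_symm_apply _
  rw [h4]
  have := exp_inner_congr hev (Subtype.property _) μ'.2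
    (thetaIndex_mk_eq.mp ((mk_out (weylIndex h w (Submodule.Quotient.mk μ))).trans
      (weylIndex_mk h w μ))) (thetaIndex_mk_eq.mp (mk_out (Submodule.Quotient.mk μ')))
  simpa only [mul_assoc] using this

theorem twistMap_chiCoord (hev : IsEvenLattice (integralLattice Φ))
    (h : IsBasedRootSet Φ P a₀) (μ : scaledDual (integralLattice Φ) k) :
    twistMap (integralLattice Φ) k (chiCoord h μ) =
      Complex.exp (Complex.I * Real.pi * k * (⟪(μ : 𝔱), (μ : 𝔱)⟫ : ℝ)) • chiCoord h μ := by
  classical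
  funext i
  simp only [twistMap, LinearMap.coe_mk, AddHom.coe_mk, Pi.smul_apply, smul_eq_mul, chiCoord,
    Finset.sum_mul, Finset.mul_sum]
  refine Finset.sum_congr rfl fun w _ => ?_
  by_cases hw : weylIndex h w (Submodule.Quotient.mk μ) = i
  · subst hw
    have := exp_inner_self_congr hev (h.map_scaledDual w μ.2)
      (thetaIndex_mk_eq.mp ((mk_out (weylIndex h w (Submodule.Quotient.mk μ))).trans
        (weylIndex_mk h w μ)))
    rw [LinearIsometryEquiv.inner_map_map] at this
    rw [this]
    ring
  · simp [hw]

end Alternating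

/-! ## The representations on holomorphic and on alternating sections -/

section Representations

variable {𝔱 : Type*} [NormedAddCommGroup 𝔱] [InnerProductSpace ℝ 𝔱]

open scoped RealInnerProductSpace

/-! ### The coroot lattice as a full discrete lattice. -/

section Lattice

variable {Φ P : Set 𝔱} {a₀ : 𝔱}

theorem span_integralLattice_eq_top (h : IsRootSet Φ) :
    Submodule.span ℝ (integralLattice Φ : Set 𝔱) = ⊤ := by
  rw [eq_top_iff, ← h.span, Submodule.span_le]
  intro a ha
  have h1 : a = (⟪a, a⟫ / 2) • coroot a := by
    have := (h.inner_self_pos ha).ne'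
    rw [coroot, smul_smul]
    field_simp
    rw [one_smul]
  rw [h1]
  exact Submodule.smul_mem _ _ (Submodule.subset_span (Submodule.subset_span ⟨a, ha, rfl⟩))

/-- The `dim 𝔱` elements of an integral basis span `𝔱` over the reals, so they form a real basis,
and the integral span of a real basis is discrete. -/
theorem isZLattice_of_basis [FiniteDimensional ℝ 𝔱] {Λ : Submodule ℤ 𝔱}
    (hspan : Submodule.span ℝ (Λ : Set 𝔱) = ⊤)
    (γ : Module.Basis (Fin (Module.finrank ℝ 𝔱)) ℤ Λ) :
    DiscreteTopology Λ ∧ ∃ _ : DiscreteTopology Λ, IsZLattice ℝ Λ := by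
  have h1 : Submodule.span ℤ (Set.range fun i => (γ i : 𝔱)) = Λ := by
    have h2 := congrArg (Submodule.map Λ.subtype) γ.span_eq
    rw [Submodule.map_span, ← Set.range_comp, Submodule.map_top, Submodule.range_subtype] at h2
    exact h2
  have h3 : ⊤ ≤ Submodule.span ℝ (Set.range fun i => (γ i : 𝔱)) := by
    rw [← hspan, Submodule.span_le]
    intro x hx
    have hx' : x ∈ Submodule.span ℤ (Set.range fun i => (γ i : 𝔱)) := h1.ge hx
    exact Submodule.span_subset_span ℤ ℝ _ hx'
  let b := basisOfTopLeSpanOfCardEqFinrank (fun i => (γ i : 𝔱)) h3 (by simp)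
  have hb : Submodule.span ℤ (Set.range b) = Λ := by
    rw [coe_basisOfTopLeSpanOfCardEqFinrank, h1]
  have hd : DiscreteTopology Λ := by
    rw [← hb]
    infer_instance
  exact ⟨hd, hd, ⟨hspan⟩⟩

end Lattice

/-! ### Values in the line `δ` and compatibility with the group actions. -/

section Line

variable {δ : Type*} [NormedAddCommGroup δ] [NormedSpace ℂ δ]

theorem exists_lineEquiv (hδ : Module.finrank ℂ δ = 1) {Ωh : δ} (h0 : Ωh ≠ 0) :
    ∃ u : ℂ ≃L[ℂ] δ, ∀ z, u z = z • Ωh := by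
  have : FiniteDimensional ℂ δ := Module.finite_of_finrank_pos (by rw [hδ]; exact one_pos)
  let e : ℂ ≃ₗ[ℂ] δ := LinearEquiv.ofBijective (LinearMap.toSpanSingleton ℂ δ Ωh)
    ⟨fun z z' hz => smul_left_injective ℂ h0 hz,
      fun w => (finrank_eq_one_iff_of_nonzero' Ωh h0).mp hδ w⟩
  exact ⟨e.toContinuousLinearEquiv, fun z => rfl⟩

theorem valueEquiv_mem_alternating (Λ : Submodule ℤ 𝔱) (Φ : Set 𝔱) (k : ℕ) (τ : ℍ) (u : ℂ ≃L[ℂ] δ)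
    (F : H ℂ Λ k τ) :
    valueEquiv Λ k τ u F ∈ alternating δ Λ Φ k τ ↔ F ∈ alternating ℂ Λ Φ k τ := by
  refine forall_congr' fun w => forall_congr' fun x => ?_
  change u _ = weylSign w • u _ ↔ _
  rw [← map_smul, u.injective.eq_iff]

theorem metaAct_valueEquiv {Λ : Submodule ℤ 𝔱} {k n : ℕ} (g : Mo2 n) (τ : ℍ) (u : ℂ ≃L[ℂ] δ)
    (F : H ℂ Λ k τ) : metaAct g τ (valueEquiv Λ k τ u F : 𝔱 × 𝔱 → δ) =
      u ∘ metaAct g τ (F : 𝔱 × 𝔱 → ℂ) := by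
  funext x
  rw [metaAct, Function.comp_apply, metaAct, map_smul]
  rfl

theorem metaAct_alternating {Φ : Set 𝔱} {n : ℕ} (g : Mo2 n) (τ : ℍ) {F : 𝔱 × 𝔱 → δ}
    (hF : ∀ (w : weylGroup Φ) (x : 𝔱 × 𝔱),
      F ((w⁻¹ : weylGroup Φ).1 x.1, (w⁻¹ : weylGroup Φ).1 x.2) = weylSign w • F x)
    (w : weylGroup Φ) (x : 𝔱 × 𝔱) :
    metaAct g τ F ((w⁻¹ : weylGroup Φ).1 x.1, (w⁻¹ : weylGroup Φ).1 x.2) =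
      weylSign w • metaAct g τ F x := by
  have h1 : actPair g.A⁻¹ ((w⁻¹ : weylGroup Φ).1 x.1, (w⁻¹ : weylGroup Φ).1 x.2) =
      ((w⁻¹ : weylGroup Φ).1 (actPair g.A⁻¹ x).1, (w⁻¹ : weylGroup Φ).1 (actPair g.A⁻¹ x).2) := by
    simp only [actPair, map_add, map_zsmul]
  rw [metaAct, metaAct, modAct, modAct, h1, hF, smul_comm]

end Line

variable [FiniteDimensional ℝ 𝔱] [MeasurableSpace 𝔱] [BorelSpace 𝔱]
variable {Φ P : Set 𝔱} {a₀ : 𝔱} {k n : ℕ}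

theorem exists_representations [DiscreteTopology (integralLattice Φ)]
    [IsZLattice ℝ (integralLattice Φ)] [Fintype (ThetaIndex (integralLattice Φ) k)]
    [Fintype (weylGroup Φ)] [Fintype (alcoveWeights (integralLattice Φ) P a₀ k)]
    {δ : Type*} [NormedAddCommGroup δ] [NormedSpace ℂ δ] (hk : 0 < k)
    (hn : n = Module.finrank ℝ 𝔱) (h : IsBasedRootSet Φ P a₀) (u : ℂ ≃L[ℂ] δ) {Ωh : δ}
    (hu : ∀ z, u z = z • Ωh) :
    ∃ θ : ∀ τ : ℍ, Module.Basis (ThetaIndex (integralLattice Φ) k) ℂ (H δ (integralLattice Φ) k τ),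
      (∀ (τ : ℍ) (μ : scaledDual (integralLattice Φ) k),
        (θ τ (Submodule.Quotient.mk μ) : 𝔱 × 𝔱 → δ) =
          fun x => thetaSec (integralLattice Φ) k τ μ x • Ωh) ∧
      ∀ τ : ℍ, ∃ R₂ : Representation ℂ (Mo2 n) (H δ (integralLattice Φ) k τ),
        (∀ (g : Mo2 n) (F : H δ (integralLattice Φ) k τ),
          (R₂ g F : 𝔱 × 𝔱 → δ) = metaAct g (act g.A⁻¹ τ)
            ((θ τ).equiv (θ (act g.A⁻¹ τ)) (Equiv.refl _) F : 𝔱 × 𝔱 → δ)) ∧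
        ∃ R₂alt : Representation ℂ (Mo2 n) (alternating δ (integralLattice Φ) Φ k τ),
          (∀ (g : Mo2 n) (F : alternating δ (integralLattice Φ) Φ k τ),
            (R₂alt g F : H δ (integralLattice Φ) k τ) = R₂ g F) ∧
          ∃ b : Module.Basis (alcoveWeights (integralLattice Φ) P a₀ k) ℂ
              (alternating δ (integralLattice Φ) Φ k τ),
            (∀ μ : alcoveWeights (integralLattice Φ) P a₀ k,
              ((b μ : H δ (integralLattice Φ) k τ) : 𝔱 × 𝔱 → δ) =
                fun x => chi (integralLattice Φ) Φ k τ μ x • Ωh) ∧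
            (∀ g : Mo2 n, g.A = ModularGroup.S →
              ∀ μ μ' : alcoveWeights (integralLattice Φ) P a₀ k,
                b.repr (R₂alt g (b μ)) μ' =
                  g.e UpperHalfPlane.I * volConst (integralLattice Φ) k * weylSum Φ k μ μ') ∧
            (∀ g : Mo2 n, g.A = ModularGroup.T → (∀ τ' : ℍ, g.e τ' = 1) →
              ∀ μ μ' : alcoveWeights (integralLattice Φ) P a₀ k,
                b.repr (R₂alt g (b μ)) μ' =
                  Set.indicator {μ} (fun _ => Complex.exp
                    (Complex.I * Real.pi * k * (inner ℝ (μ : 𝔱) μ : ℝ))) μ') := by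
  classical
  have hev := h.isEvenLattice
  set Λ := integralLattice Φ with hΛ
  -- Coordinates in the basis `Θ ⊗ Ω^{1/2}`. The identification of the spaces at two points of the
  -- half-plane is one such map composed with the inverse of the other.
  let E : ∀ τ : ℍ, (ThetaIndex Λ k → ℂ) ≃ₗ[ℂ] H δ Λ k τ := fun τ =>
    (thetaEquiv hk hev τ).trans (valueEquiv Λ k τ u)
  let M := metaRep hk hev hn
  have hM : ∀ (g : Mo2 n) (τ : ℍ) (c : ThetaIndex Λ k → ℂ),
      metaAct g τ (E τ c : 𝔱 × 𝔱 → δ) = (E (act g.A τ) (M g c) : 𝔱 × 𝔱 → δ) := fun g τ c => by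
    change metaAct g τ (valueEquiv Λ k τ u (thetaEquiv hk hev τ c) : 𝔱 × 𝔱 → δ) = _
    rw [metaAct_valueEquiv, hasMatrix_metaRep hk hev hn g]
    rfl
  have halt : ∀ (τ : ℍ) (c : ThetaIndex Λ k → ℂ),
      E τ c ∈ alternating δ Λ Φ k τ ↔ c ∈ altCoord h k := fun τ c =>
    (valueEquiv_mem_alternating Λ Φ k τ u _).trans (thetaEquiv_mem_alternating hk hev h τ c)
  have hMalt : ∀ (g : Mo2 n) (c : ThetaIndex Λ k → ℂ), c ∈ altCoord h k → M g c ∈ altCoord h k :=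
    fun g c hc => by
      -- The coordinate space of alternating sections does not depend on `τ`, so its stability can
      -- be checked at one point, where the geometric action visibly commutes with the Weyl group.
      rw [← halt (act g.A UpperHalfPlane.I)]
      intro w x
      rw [← hM]
      exact metaAct_alternating g _ ((halt _ c).mpr hc) w x
  let θ : ∀ τ : ℍ, Module.Basis (ThetaIndex Λ k) ℂ (H δ Λ k τ) := fun τ =>
    Module.Basis.ofEquivFun (E τ).symm
  have hθ : ∀ τ i, θ τ i = E τ (Pi.single i 1) := fun τ i => by
    simp [θ]
  have hΨ : ∀ τ τ' c, (θ τ).equiv (θ τ') (Equiv.refl _) (E τ c) = E τ' c := fun τ τ' c => by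
    have h1 : (((θ τ).equiv (θ τ') (Equiv.refl _)) : H δ Λ k τ →ₗ[ℂ] H δ Λ k τ') =
        ((E τ).symm.trans (E τ') : H δ Λ k τ ≃ₗ[ℂ] H δ Λ k τ') := by
      refine (θ τ).ext fun i => ?_
      rw [LinearEquiv.coe_coe, LinearEquiv.coe_coe, Module.Basis.equiv_apply, Equiv.refl_apply,
        hθ, hθ]
      exact congrArg (E τ') ((E τ).symm_apply_apply _).symm
    exact (LinearMap.congr_fun h1 (E τ c)).trans (congrArg (E τ') ((E τ).symm_apply_apply c))
  refine ⟨θ, fun τ μ => ?_, fun τ => ?_⟩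
  · rw [hθ]
    funext x
    change u ((thetaEquiv hk hev τ _ : 𝔱 × 𝔱 → ℂ) x) = _
    rw [hu, thetaEquiv_coe_apply]
    simp only [Pi.single_apply, ite_mul, one_mul, zero_mul, Finset.sum_ite_eq', Finset.mem_univ,
      if_true]
    rw [thetaH_mk]
  -- Conjugating a matrix representation independent of `τ` makes multiplicativity immediate; the
  -- formula through `metaAct` is verified afterwards.
  let R₂ : Representation ℂ (Mo2 n) (H δ Λ k τ) :=
    { toFun := fun g => (E τ : (ThetaIndex Λ k → ℂ) →ₗ[ℂ] H δ Λ k τ) ∘ₗ M g ∘ₗ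
        ((E τ).symm : H δ Λ k τ →ₗ[ℂ] (ThetaIndex Λ k → ℂ))
      map_one' := by
        refine LinearMap.ext fun F => ?_
        simp
      map_mul' := fun g g' => by
        refine LinearMap.ext fun F => ?_
        simp }
  have hR : ∀ g c, R₂ g (E τ c) = E τ (M g c) := fun g c => by
    change E τ (M g ((E τ).symm (E τ c))) = _
    rw [LinearEquiv.symm_apply_apply]
  have hpres : ∀ g, ∀ F ∈ alternating δ Λ Φ k τ, R₂ g F ∈ alternating δ Λ Φ k τ := fun g F hF => by
    obtain ⟨c, rfl⟩ := (E τ).surjective F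
    rw [hR, halt]
    exact hMalt g c ((halt τ c).mp hF)
  let R₂alt : Representation ℂ (Mo2 n) (alternating δ Λ Φ k τ) :=
    { toFun := fun g => (R₂ g).restrict (hpres g)
      map_one' := by
        refine LinearMap.ext fun F => Subtype.ext ?_
        rw [LinearMap.coe_restrict_apply, map_one]
        rfl
      map_mul' := fun g g' => by
        refine LinearMap.ext fun F => Subtype.ext ?_
        rw [LinearMap.coe_restrict_apply, map_mul]
        rfl }
  have hRalt : ∀ (g : Mo2 n) (F : alternating δ Λ Φ k τ), (R₂alt g F : H δ Λ k τ) = R₂ g F :=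
    fun g F => rfl
  refine ⟨R₂, fun g F => ?_, R₂alt, hRalt, ?_⟩
  · obtain ⟨c, rfl⟩ := (E τ).surjective F
    rw [hR, hΨ, hM, ← act_mul, mul_inv_cancel, act_one]
  let Ealt : altCoord h k ≃ₗ[ℂ] alternating δ Λ Φ k τ :=
    (E τ).ofSubmodules (altCoord h k) (alternating δ Λ Φ k τ) (by
      ext F
      obtain ⟨c, rfl⟩ := (E τ).surjective F
      rw [halt, Submodule.mem_map]
      exact ⟨fun ⟨c', hc', he⟩ => (E τ).injective he ▸ hc', fun hc => ⟨c, hc, rfl⟩⟩)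
  have hEalt : ∀ c : altCoord h k, (Ealt c : H δ Λ k τ) = E τ c.1 := fun c => rfl
  let b := (chiBasis h).map Ealt
  have hb : ∀ μ, (b μ : H δ Λ k τ) = E τ (chiCoord h (alcoveIndex μ)) := fun μ => by
    rw [← chiBasis_apply, ← hEalt]
    rfl
  have hrepr : ∀ (F : alternating δ Λ Φ k τ) (c : ThetaIndex Λ k → ℂ), (F : H δ Λ k τ) = E τ c →
      ∀ μ', b.repr F μ' = c (Submodule.Quotient.mk (alcoveIndex μ')) := fun F c hF μ' => by
    have hc : c ∈ altCoord h k := (halt τ c).mp (hF ▸ F.2)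
    have : F = Ealt ⟨c, hc⟩ := Subtype.ext hF
    rw [this, Module.Basis.map_repr, LinearEquiv.trans_apply, LinearEquiv.symm_apply_apply,
      chiBasis_repr]
  have hmat : ∀ g μ μ', b.repr (R₂alt g (b μ)) μ' =
      M g (chiCoord h (alcoveIndex μ)) (Submodule.Quotient.mk (alcoveIndex μ')) := fun g μ μ' =>
    hrepr _ _ (by rw [hRalt, hb, hR]) μ'
  refine ⟨b, fun μ => ?_, fun g hg μ μ' => ?_, fun g hg he μ μ' => ?_⟩
  · rw [hb]
    funext x
    change u ((thetaEquiv hk hev τ _ : 𝔱 × 𝔱 → ℂ) x) = _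
    rw [hu, ← chi_eq_thetaEquiv]
    rfl
  · have h1 : M g = _ := (hasMatrix_metaRep hk hev hn g).ext (hasMatrix_S hn hg)
    rw [hmat, h1, LinearMap.smul_apply, Pi.smul_apply, fourierMap_chiCoord hev h, smul_eq_mul]
    rfl
  · have h1 : M g = _ := (hasMatrix_metaRep hk hev hn g).ext (exists_hasMatrix_T hg)
    rw [hmat, h1, he, one_smul, twistMap_chiCoord hev h, Pi.smul_apply,
      chiCoord_mk h (alcoveIndex_mem μ) (alcoveIndex_mem μ')]
    by_cases hμ : μ = μ'
    · subst hμ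
      rw [if_pos rfl, smul_eq_mul, mul_one, Set.indicator_of_mem (Set.mem_singleton μ)]
      rfl
    · rw [if_neg (fun he => hμ (alcoveIndex_inj.mp he)), smul_zero,
        Set.indicator_of_notMem (fun he => hμ (Set.mem_singleton_iff.mp he).symm)]

theorem modAct_S_chi [DiscreteTopology (integralLattice Φ)]
    [IsZLattice ℝ (integralLattice Φ)] [Fintype (ThetaIndex (integralLattice Φ) k)]
    [Fintype (weylGroup Φ)] [Fintype (alcoveWeights (integralLattice Φ) P a₀ k)] (hk : 0 < k)
    (h : IsBasedRootSet Φ P a₀) (τ : ℍ) (μ : scaledDual (integralLattice Φ) k) (x : 𝔱 × 𝔱) :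
    modAct ModularGroup.S (chi (integralLattice Φ) Φ k τ μ) x =
      (((act ModularGroup.S τ : ℂ) / Complex.I) ^ ((Module.finrank ℝ 𝔱 : ℂ) / 2) *
        volConst (integralLattice Φ) k) *
        ∑ μ' : alcoveWeights (integralLattice Φ) P a₀ k,
          weylSum Φ k μ μ' * chi (integralLattice Φ) Φ k (act ModularGroup.S τ) μ' x := by
  have hev := h.isEvenLattice
  have hchi : ∀ τ (ν : scaledDual (integralLattice Φ) k), chi (integralLattice Φ) Φ k τ ν =
      (thetaEquiv hk hev τ (chiCoord h ν) : 𝔱 × 𝔱 → ℂ) := fun τ ν =>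
    funext fun y => chi_eq_thetaEquiv hk hev h τ ν y
  rw [hchi, modAct_S_thetaEquiv, eq_sum_chiCoord h (fourierMap_mem_altCoord hev h (chiCoord_mem h μ)),
    map_sum, Submodule.coe_sum, Finset.sum_apply]
  congr 1
  refine Finset.sum_congr rfl fun μ' _ => ?_
  rw [fourierMap_chiCoord hev h, map_smul, Submodule.coe_smul, Pi.smul_apply, smul_eq_mul, ← hchi]
  rfl

theorem modAct_T_chi [DiscreteTopology (integralLattice Φ)]
    [IsZLattice ℝ (integralLattice Φ)] [Fintype (ThetaIndex (integralLattice Φ) k)]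
    [Fintype (weylGroup Φ)] (hk : 0 < k)
    (h : IsBasedRootSet Φ P a₀) (τ : ℍ) (μ : scaledDual (integralLattice Φ) k) (x : 𝔱 × 𝔱) :
    modAct ModularGroup.T (chi (integralLattice Φ) Φ k τ μ) x =
      Complex.exp (Complex.I * Real.pi * k * (⟪(μ : 𝔱), (μ : 𝔱)⟫ : ℝ)) *
        chi (integralLattice Φ) Φ k (act ModularGroup.T τ) μ x := by
  have hev := h.isEvenLattice
  have hchi : ∀ τ (ν : scaledDual (integralLattice Φ) k), chi (integralLattice Φ) Φ k τ ν =
      (thetaEquiv hk hev τ (chiCoord h ν) : 𝔱 × 𝔱 → ℂ) := fun τ ν =>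
    funext fun y => chi_eq_thetaEquiv hk hev h τ ν y
  rw [hchi, modAct_T_thetaEquiv, twistMap_chiCoord hev h, map_smul, Submodule.coe_smul,
    Pi.smul_apply, smul_eq_mul, ← hchi]

end Representations

end TorusCS

end

/-! ### The theorem, from the Lie algebra data. -/

open TorusCS in
theorem mainTheorem9
    {𝔤 : Type*} [LieRing 𝔤] [LieAlgebra ℝ 𝔤] [FiniteDimensional ℝ 𝔤] [LieAlgebra.IsSimple ℝ 𝔤]
    {𝔱 : Type*} [NormedAddCommGroup 𝔱] [InnerProductSpace ℝ 𝔱] [FiniteDimensional ℝ 𝔱]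
    [MeasurableSpace 𝔱] [BorelSpace 𝔱]
    (B : LinearMap.BilinForm ℝ 𝔤) (j : 𝔱 →ₗ[ℝ] 𝔤)
    (hB : IsBasicInnerProduct B j) (hj : IsMaximalAbelian j)
    (Φ : Set 𝔱) (hΦ : Φ = realRoots j)
    (P : Set 𝔱) (hP : IsPositiveSystem Φ P)
    (a₀ : 𝔱) (ha₀ : IsHighestRoot Φ P a₀)
    (Λ : Submodule ℤ 𝔱) (hΛ : Λ = integralLattice Φ)
    (n : ℕ) (hn : n = Module.finrank ℝ 𝔱)
    {δ : Type*} [NormedAddCommGroup δ] [NormedSpace ℂ δ] (hδ : Module.finrank ℂ δ = 1)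
    (φ : δ ⊗[ℂ] δ ≃ₗ[ℂ] (ℂ ⊗[ℝ] 𝔱) [⋀^Fin n]→ₗ[ℂ] ℂ)
    (γ : Module.Basis (Fin n) ℤ Λ) (Ωh : δ)
    (hΩ : φ (Ωh ⊗ₜ[ℂ] Ωh) (fun i => (1 : ℂ) ⊗ₜ[ℝ] (γ i : 𝔱)) = 1)
    (k : ℕ) (hk : 0 < k) :
    -- the action of `S` and `T` on the alternating sections of `L^k`
    (∀ (τ : ℍ), ∀ μ ∈ alcoveWeights Λ P a₀ k,
      (∀ x : 𝔱 × 𝔱, modAct ModularGroup.S (chi Λ Φ k τ μ) x =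
        (((act ModularGroup.S τ : ℂ) / Complex.I) ^ ((n : ℂ) / 2) * volConst Λ k) *
          ∑ᶠ μ' : alcoveWeights Λ P a₀ k,
            weylSum Φ k μ μ' * chi Λ Φ k (act ModularGroup.S τ) μ' x) ∧
      (∀ x : 𝔱 × 𝔱, modAct ModularGroup.T (chi Λ Φ k τ μ) x =
        Complex.exp (Complex.I * Real.pi * k * (inner ℝ μ μ : ℝ)) *
          chi Λ Φ k (act ModularGroup.T τ) μ x)) ∧
    -- the sections `Θ^τ_{μ,k} s_τ^k ⊗ Ω^{1/2}` form bases of the spaces of holomorphic sections;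
    -- these bases define the identifications `Ψ_{τ₁,τ₂}`
    ∃ θ : ∀ τ : ℍ, Module.Basis (ThetaIndex Λ k) ℂ (H δ Λ k τ),
      (∀ (τ : ℍ) (μ : scaledDual Λ k),
        (θ τ (Submodule.Quotient.mk μ) : 𝔱 × 𝔱 → δ) = fun x => thetaSec Λ k τ μ x • Ωh) ∧
      -- the representation `R₂` on holomorphic sections, `(A, e) ↦ (A, e) ∘ Ψ_{τ, A⁻¹.τ}`
      ∀ τ : ℍ, ∃ R₂ : Representation ℂ (Mo2 n) (H δ Λ k τ),
        (∀ (g : Mo2 n) (F : H δ Λ k τ),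
          (R₂ g F : 𝔱 × 𝔱 → δ) = metaAct g (act g.A⁻¹ τ)
            ((θ τ).equiv (θ (act g.A⁻¹ τ)) (Equiv.refl _) F : 𝔱 × 𝔱 → δ)) ∧
        -- its restriction to alternating sections, its basis, and the matrices
        ∃ R₂alt : Representation ℂ (Mo2 n) (alternating δ Λ Φ k τ),
          (∀ (g : Mo2 n) (F : alternating δ Λ Φ k τ),
            (R₂alt g F : H δ Λ k τ) = R₂ g F) ∧
          ∃ b : Module.Basis (alcoveWeights Λ P a₀ k) ℂ (alternating δ Λ Φ k τ),
            (∀ μ : alcoveWeights Λ P a₀ k,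
              ((b μ : H δ Λ k τ) : 𝔱 × 𝔱 → δ) =
                fun x => chi Λ Φ k τ μ x • Ωh) ∧
            (∀ g : Mo2 n, g.A = ModularGroup.S →
              ∀ μ μ' : alcoveWeights Λ P a₀ k,
                b.repr (R₂alt g (b μ)) μ' =
                  g.e UpperHalfPlane.I * volConst Λ k * weylSum Φ k μ μ') ∧
            (∀ g : Mo2 n, g.A = ModularGroup.T → (∀ τ' : ℍ, g.e τ' = 1) →
              ∀ μ μ' : alcoveWeights Λ P a₀ k,
                b.repr (R₂alt g (b μ)) μ' =
                  Set.indicator {μ} (fun _ => Complex.exp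
                    (Complex.I * Real.pi * k * (inner ℝ (μ : 𝔱) μ : ℝ))) μ') := by
  subst hΦ hΛ
  have h : IsBasedRootSet (realRoots j) P a₀ :=
    { toIsRootSet := isRootSet_realRoots hB hj
      positive := hP
      highest := ha₀
      normalized := hB.normalized }
  -- Discreteness of the coroot lattice is obtained from the given integral basis `γ`, which has
  -- `dim 𝔱` elements.
  have hlat : ∃ _ : DiscreteTopology (integralLattice (realRoots j)),
      IsZLattice ℝ (integralLattice (realRoots j)) := by
    subst hn
    exact (isZLattice_of_basis (span_integralLattice_eq_top h.toIsRootSet) γ).2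
  obtain ⟨_, _⟩ := hlat
  have := finite_thetaIndex hk h.isEvenLattice
  have := Fintype.ofFinite (ThetaIndex (integralLattice (realRoots j)) k)
  have := h.finite_weylGroup
  have := Fintype.ofFinite (weylGroup (realRoots j))
  have := finite_alcoveWeights (k := k) h
  have := Fintype.ofFinite (alcoveWeights (integralLattice (realRoots j)) P a₀ k)
  -- A square root of a form taking the value `1` cannot vanish, so it generates the line `δ`.
  have h0 : Ωh ≠ 0 := fun h0 => by
    rw [h0, TensorProduct.zero_tmul, map_zero, AlternatingMap.zero_apply] at hΩ
    exact zero_ne_one hΩ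
  obtain ⟨u, hu⟩ := exists_lineEquiv hδ h0
  refine ⟨fun τ μ hμ => ⟨fun x => ?_, fun x => modAct_T_chi hk h τ ⟨μ, hμ.2⟩ x⟩,
    exists_representations hk hn h u hu⟩
  rw [finsum_eq_sum_of_fintype, hn]
  exact modAct_S_chi hk h τ ⟨μ, hμ.2⟩ x
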